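/- Let $\{a_{ij}\}_{i\le j,\ i,j\in\mathbb N}$ be jointly independent identically distributed real random variables with all moments finite, $\mathbf E a_{ij}^k=X_k$ for $k\in\mathbb N$. Let $p>0$ and $\alpha\in(0,1)$. For every integer $N\ge p$ let $\{d^{(N,p)}_{ij}\}_{1\le i\le j\le N}$ be jointly independent random variables, independent of the family $\{a_{ij}\}$, with $d^{(N,p)}_{ij}=1$ with probability $p/N$ and $d^{(N,p)}_{ij}=0$ with probability $1-p/N$. Put $a_{ji}=a_{ij}$, $d^{(N,p)}_{ji}=d^{(N,p)}_{ij}$ and $I_{\alpha,N}=\{1,\dots,\lfloor\alpha N\rfloor\}$, and let $A^{(N,p,\alpha)}$ be the real symmetric $N\times N$ matrix whose $(i,j)$ entry is $a_{ij}d^{(N,p)}_{ij}$ if exactly one of $i,j$ belongs to $I_{\alpha,N}$, and $0$ otherwise. Let $\lambda_1\le\dots\le\lambda_N$ be its eigenvalues (with multiplicity) and let $\sigma(\cdot\,;A^{(N,p,\alpha)})=\frac1N\sum_{j=1}^N\delta_{\lambda_j}$ be its normalized eigenvalue counting measure. Suppose that for some constant $C$ $$X_{2m}\le (Cm)^{2m}\qquad\text{for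 all integers } m\ge 1 .$$ Then there is a nonrandom probability measure $\sigma_{p,\alpha}$ on $\mathbb R$ such that $\sigma(\cdot\,;A^{(N,p,\alpha)})$ converges weakly in probability to $\sigma_{p,\alpha}$ as $N\to\infty$; that is, for every bounded continuous $\varphi:\mathbb R\to\mathbb R$, $\int\varphi\,d\sigma(\cdot\,;A^{(N,p,\alpha)})\to\int\varphi\,d\sigma_{p,\alpha}$ in probability. The measure $\sigma_{p,\alpha}$ has finite moments of all orders, and for all integers $k\ge 0$ $$\int\lambda^{2k}\,d\sigma_{p,\alpha}=\sum_{i=0}^{k}\bigl(S^{(1)}(k,i)+S^{(2)}(k,i)\bigr),\qquad \int\lambda^{2k+1}\,d\sigma_{p,\alpha}=0 ,$$ and it is the only measure on $\mathbb R$ with these moments. Here the numbers $S^{(1)}(l,r)$, $S^{(2)}(l,r)$, $0\le r\le l$, are determined by the initial conditions $$S^{(1)}(l,0)=\alpha\,\delta_{l,0},\qquad S^{(2)}(l,0)=(1-\alpha)\,\delta_{l,0},$$ and, for $1\le r\le l$, by the recurrence relations $$S^{(1)}(l,r)=p\sum_{f=1}^{r}\binom{r-1}{f-1}X_{2f}\sum_{u=0}^{l-r}S^{(1)}(l-u-f,r-f)\sum_{v=0}^{u}\binom{f+v-1}{f-1}S^{(2)}(u,v),$$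 $$S^{(2)}(l,r)=p\sum_{f=1}^{r}\binom{r-1}{f-1}X_{2f}\sum_{u=0}^{l-r}S^{(2)}(l-u-f,r-f)\sum_{v=0}^{u}\binom{f+v-1}{f-1}S^{(1)}(u,v).$$ -/

import Mathlib

open MeasureTheory ProbabilityTheory Filter Topology BoundedContinuousFunction

/-! ### The random matrix -/

/-- `i` (numbered from `0`) lies in the first part, which consists of the first `⌊α N⌋` vertices. -/
abbrev InFirstPart (α : ℝ) (N : ℕ) (i : Fin N) : Prop := (i : ℕ) < ⌊α * (N : ℝ)⌋₊

/-- The weighted adjacency matrix of the bipartite graph. Weights `a` and edge indicators `d` are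
indexed by unordered pairs (with the diagonal), so that `a_{ij} = a_{ji}` and `d_{ij} = d_{ji}`. -/
noncomputable def bipartiteMatrix (α : ℝ) (N : ℕ) (a : Sym2 ℕ → ℝ) (d : Sym2 (Fin N) → ℝ) :
    Matrix (Fin N) (Fin N) ℝ := fun i j =>
  if (InFirstPart α N i ∧ ¬ InFirstPart α N j) ∨ (¬ InFirstPart α N i ∧ InFirstPart α N j) then
    a s((i : ℕ), (j : ℕ)) * d s(i, j)
  else 0

theorem bipartiteMatrix_isHermitian (α : ℝ) (N : ℕ) (a : Sym2 ℕ → ℝ) (d : Sym2 (Fin N) → ℝ) :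
    (bipartiteMatrix α N a d).IsHermitian := by
  ext i j
  simp only [Matrix.conjTranspose_apply, star_trivial, bipartiteMatrix]
  rw [Sym2.eq_swap (a := (j : ℕ)), Sym2.eq_swap (a := j)]
  refine if_congr ?_ rfl rfl
  tauto

/-- The normalized eigenvalue counting measure `N⁻¹ ∑ⱼ δ_{λⱼ}` of a real symmetric matrix, its
eigenvalues being repeated according to multiplicity. -/
noncomputable def eigenvalueMeasure {N : ℕ} (A : Matrix (Fin N) (Fin N) ℝ) (hA : A.IsHermitian) :
    Measure ℝ :=
  (N : ENNReal)⁻¹ • ∑ j : Fin N, Measure.dirac (hA.eigenvalues j)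

/-- Its distribution function is the normalized eigenvalue counting function. -/
theorem eigenvalueMeasure_Iio {N : ℕ} (A : Matrix (Fin N) (Fin N) ℝ) (hA : A.IsHermitian) (t : ℝ) :
    (eigenvalueMeasure A hA).real (Set.Iio t) =
      (Nat.card {j : Fin N // hA.eigenvalues j < t} : ℝ) / N := by
  classical
  have h : (∑ j : Fin N, Measure.dirac (hA.eigenvalues j)) (Set.Iio t) =
      (Nat.card {j : Fin N // hA.eigenvalues j < t} : ENNReal) := by
    rw [Measure.finsetSum_apply]
    simp [Set.indicator_apply, Finset.sum_boole, Fintype.card_subtype]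
  rw [measureReal_def, eigenvalueMeasure, Measure.smul_apply, h]
  simp [ENNReal.toReal_mul, div_eq_inv_mul]

/-- The weights `a` and, for every `N ≥ p`, the edge indicators `d N`, as random variables on a
common probability space: the `a e` are i.i.d. with all moments finite, `E (a e)^k = X k`;
the `d N e` are independent Bernoulli variables with parameter `p / N`; and the family `d N` is
independent of the family `a`. Nothing is assumed on the joint law of `d N` for different `N`. -/
structure IsSparseModel {Ω : Type*} [MeasurableSpace Ω] (P : Measure Ω) (p : ℝ) (X : ℕ → ℝ)
    (a : Sym2 ℕ → Ω → ℝ) (d : (N : ℕ) → Sym2 (Fin N) → Ω → ℝ) : Prop where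
  measurable_weight : ∀ e, Measurable (a e)
  indep_weight : iIndepFun a P
  identDistrib_weight : ∀ e e', IdentDistrib (a e) (a e') P P
  integrable_weight : ∀ e (k : ℕ), Integrable (fun ω => a e ω ^ k) P
  moment_weight : ∀ e (k : ℕ), ∫ ω, a e ω ^ k ∂P = X k
  measurable_edge : ∀ N : ℕ, p ≤ N → ∀ e, Measurable (d N e)
  indep_edge : ∀ N : ℕ, p ≤ N → iIndepFun (d N) P
  prob_one : ∀ N : ℕ, p ≤ N → ∀ e, P.real {ω | d N e ω = 1} = p / N
  prob_zero : ∀ N : ℕ, p ≤ N → ∀ e, P.real {ω | d N e ω = 0} = 1 - p / N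
  indep_weight_edge : ∀ N : ℕ, p ≤ N →
    IndepFun (fun ω (e : Sym2 ℕ) => a e ω) (fun ω (e : Sym2 (Fin N)) => d N e ω) P

/-- The random measure `σ(· ; A^{(N,p,α)})`. -/
noncomputable def spectralMeasure {Ω : Type*} (α : ℝ) (a : Sym2 ℕ → Ω → ℝ)
    (d : (N : ℕ) → Sym2 (Fin N) → Ω → ℝ) (N : ℕ) (ω : Ω) : Measure ℝ :=
  eigenvalueMeasure (bipartiteMatrix α N (fun e => a e ω) (fun e => d N e ω))
    (bipartiteMatrix_isHermitian α N (fun e => a e ω) (fun e => d N e ω))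

/-- Weak convergence in probability of random measures on `ℝ` to a nonrandom measure: for every
bounded continuous test function the integrals converge in probability. -/
def TendstoWeaklyInProbability {Ω : Type*} [MeasurableSpace Ω] (P : Measure Ω)
    (ρ : ℕ → Ω → Measure ℝ) (σ : Measure ℝ) : Prop :=
  ∀ f : ℝ →ᵇ ℝ, TendstoInMeasure P (fun N ω => ∫ x, f x ∂(ρ N ω)) atTop (fun _ => ∫ x, f x ∂σ)

/-! ### The limiting moments -/

/-- The two coupled arrays: `true` stands for `S⁽¹⁾`, `false` for `S⁽²⁾`. The variable `f` below is
shifted by one. The arrays are given the value `0` outside of `r ≤ l`. -/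
noncomputable def coupledS (p α : ℝ) (X : ℕ → ℝ) (b : Bool) (l r : ℕ) : ℝ :=
  if r = 0 then
    if l = 0 then (if b then α else 1 - α) else 0
  else if h : 1 ≤ r ∧ r ≤ l then
    p * ∑ f : Fin r, ((r - 1).choose (f : ℕ) : ℝ) * X (2 * ((f : ℕ) + 1)) *
      ∑ u : Fin (l - r + 1), coupledS p α X b (l - (u : ℕ) - ((f : ℕ) + 1)) (r - ((f : ℕ) + 1)) *
        ∑ v : Fin ((u : ℕ) + 1), (((f : ℕ) + 1 + (v : ℕ) - 1).choose (f : ℕ) : ℝ) *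
          coupledS p α X (!b) (u : ℕ) (v : ℕ)
  else 0
termination_by l
decreasing_by
  all_goals
    have h1 := u.isLt
    omega

/-- `S⁽¹⁾(l, r)` -/
noncomputable def S1 (p α : ℝ) (X : ℕ → ℝ) (l r : ℕ) : ℝ := coupledS p α X true l r

/-- `S⁽²⁾(l, r)` -/
noncomputable def S2 (p α : ℝ) (X : ℕ → ℝ) (l r : ℕ) : ℝ := coupledS p α X false l r

theorem S1_init (p α : ℝ) (X : ℕ → ℝ) (l : ℕ) :
    S1 p α X l 0 = α * (if l = 0 then 1 else 0) := by
  rw [S1, coupledS]; simp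

theorem S2_init (p α : ℝ) (X : ℕ → ℝ) (l : ℕ) :
    S2 p α X l 0 = (1 - α) * (if l = 0 then 1 else 0) := by
  rw [S2, coupledS]; simp

theorem coupledS_rec (p α : ℝ) (X : ℕ → ℝ) (b : Bool) {l r : ℕ} (hr : 1 ≤ r) (hl : r ≤ l) :
    coupledS p α X b l r = p * ∑ f ∈ Finset.Icc 1 r, ((r - 1).choose (f - 1) : ℝ) * X (2 * f) *
      ∑ u ∈ Finset.Icc 0 (l - r), coupledS p α X b (l - u - f) (r - f) *
        ∑ v ∈ Finset.Icc 0 u, ((f + v - 1).choose (f - 1) : ℝ) * coupledS p α X (!b) u v := by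
  have hI : ∀ n : ℕ, Finset.Icc 0 n = Finset.range (n + 1) := fun n => by
    ext x; simp; try omega
  have hJ : ∀ g : ℕ → ℝ, ∑ f ∈ Finset.Icc 1 r, g f = ∑ f ∈ Finset.range r, g (f + 1) := fun g => by
    rw [Finset.range_eq_Ico, Finset.sum_Ico_add' g 0 r 1]
    congr 1
  rw [coupledS, if_neg (by omega), dif_pos ⟨hr, hl⟩, hJ, Finset.sum_range]
  simp only [hI, Finset.sum_range, Nat.add_sub_cancel]

/-- The recurrence for `S⁽¹⁾`. -/
theorem S1_rec (p α : ℝ) (X : ℕ → ℝ) {l r : ℕ} (hr : 1 ≤ r) (hl : r ≤ l) :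
    S1 p α X l r = p * ∑ f ∈ Finset.Icc 1 r, ((r - 1).choose (f - 1) : ℝ) * X (2 * f) *
      ∑ u ∈ Finset.Icc 0 (l - r), S1 p α X (l - u - f) (r - f) *
        ∑ v ∈ Finset.Icc 0 u, ((f + v - 1).choose (f - 1) : ℝ) * S2 p α X u v :=
  coupledS_rec p α X true hr hl

/-- The recurrence for `S⁽²⁾`. -/
theorem S2_rec (p α : ℝ) (X : ℕ → ℝ) {l r : ℕ} (hr : 1 ≤ r) (hl : r ≤ l) :
    S2 p α X l r = p * ∑ f ∈ Finset.Icc 1 r, ((r - 1).choose (f - 1) : ℝ) * X (2 * f) *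
      ∑ u ∈ Finset.Icc 0 (l - r), S2 p α X (l - u - f) (r - f) *
        ∑ v ∈ Finset.Icc 0 u, ((f + v - 1).choose (f - 1) : ℝ) * S1 p α X u v :=
  coupledS_rec p α X false hr hl

/-- The measure `σ` has finite moments of all orders, its odd moments vanish, and its `2k`-th
moment is `∑_{i=0}^k (S⁽¹⁾(k,i) + S⁽²⁾(k,i))`. (The moment of order `0` is included.) -/
def HasLimitMoments (p α : ℝ) (X : ℕ → ℝ) (σ : Measure ℝ) : Prop :=
  (∀ s : ℕ, Integrable (fun x : ℝ => x ^ s) σ) ∧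
  (∀ k : ℕ, ∫ x, x ^ (2 * k) ∂σ = ∑ i ∈ Finset.Icc 0 k, (S1 p α X k i + S2 p α X k i)) ∧
  (∀ k : ℕ, ∫ x, x ^ (2 * k + 1) ∂σ = 0)

/-!
The proof is by the method of moments. The `s`-th moment of the eigenvalue counting measure is
`N⁻¹ tr A ^ s`, a weighted count of closed walks of length `s` in a sparse random bipartite graph.

*Walks on forests.* The trace is a polynomial in the edge variables `a_e d_e`, and the expectation of
a polynomial is the linear functional `edgeExp`, which sends a monomial with edge set `S` to
`∏ e ∈ S, (p / N) X (μ e)`. Each new edge of a walk costs a factor `p / N` and a new vertex gains a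
factor `N`, so that monomials with a cycle contribute only `O(1 / N)` (`sum_cycleWeight_le`,
`abs_edgeExp_sub_forestExp_le`). The remaining monomials are those whose edges form a forest hanging
from the starting points of the walks, the roots; forests are encoded by orientations, in which every
edge selects a child different from the roots and from the other children. One computes modulo the
ideal `cycleIdeal` of the other monomials. There an excursion from a root returns through the edge by
which it has left (`X_mul_genMatrix_pow_mul_X_mem`), so that the generating function of closed walks is
the geometric series in that of the excursions (`map_walkSeries`). If the edge from a root `x` to its
first child `y` is used by `f` excursions, it can be removed at the cost of the factor
`(p / N) X (2 f)`, and `y` becomes a root (`forestExp_X_pow_mul`). This gives an exact recurrence for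
the expected number `forestMoment` of families of walks with prescribed lengths and numbers of
departures from the roots (`forestMoment_rec`). Its limit is the recurrence of the arrays `S1` and
`S2`, normalized by the proportions of the two parts (`rootMoment_rec`), and hence the forest moments
are products of normalized entries of these arrays, up to `O(1 / N)`
(`exists_abs_forestMoment_sub_le`).

*Concentration.* With one root this yields the expectation of `N⁻¹ tr A ^ s`, and with two roots that of
its square. The moments of the counting measure therefore differ from `limitMoment p α X s` by `O(1 / N)`
in mean square (`exists_edgeExp_sq_trace_sub_le`, `IsSparseModel.exists_integral_sq_trace_sub_le`), and
they converge almost surely along subsequences which grow exponentially.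

*The limit measure.* The recurrence and the bound on the `X (2 m)` imply that the even limiting moments
grow at most like `K ^ k * (2 k)!` (`exists_limitMoment_le`). A measure with such moments has a moment
generating function near `0` and is determined by its moments (`Measure.ext_of_moments`). By
tightness, convergence of all moments then implies weak convergence (`tendsto_of_moments`), which gives
the existence of the limit measure and, through almost surely convergent subsequences, the convergence
in probability.
-/

/-! ### Moment-determinate measures and the method of moments -/

/-- Moments of factorial growth give a finite exponential moment. -/
theorem integrable_exp_mul_of_moment_le {ν : Measure ℝ} [IsFiniteMeasure ν] {c K t : ℝ}
    (hint : ∀ s : ℕ, Integrable (fun x : ℝ => x ^ s) ν)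
    (hbd : ∀ k : ℕ, ∫ x, x ^ (2 * k) ∂ν ≤ c * K ^ k * (2 * k).factorial)
    (hK : 0 ≤ K) (ht : K * t ^ 2 ≤ 1 / 2) :
    Integrable (fun x : ℝ => Real.exp (t * x)) ν := by
  have hcosh : Integrable (fun x : ℝ => Real.cosh (t * x)) ν := by
    refine ⟨by fun_prop, ?_⟩
    rw [hasFiniteIntegral_iff_norm]
    have hpt : ∀ x : ℝ, ENNReal.ofReal ‖Real.cosh (t * x)‖
        = ∑' k : ℕ, ENNReal.ofReal ((t * x) ^ (2 * k) / (2 * k).factorial) := by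
      intro x
      have h := Real.hasSum_cosh (t * x)
      rw [Real.norm_of_nonneg (Real.cosh_pos _).le, ← h.tsum_eq]
      exact ENNReal.ofReal_tsum_of_nonneg
        (fun k => by rw [pow_mul]; positivity) h.summable
    simp_rw [hpt]
    rw [lintegral_tsum (fun k => by fun_prop)]
    have hc : 0 ≤ c := by
      have h0 := hbd 0
      simp only [mul_zero, pow_zero, Nat.factorial_zero, Nat.cast_one, mul_one] at h0
      exact le_trans (integral_nonneg fun _ => zero_le_one) h0
    -- the `k`-th term of the Taylor series of `cosh (t x)`
    have hterm : ∀ k : ℕ, ∫⁻ x, ENNReal.ofReal ((t * x) ^ (2 * k) / (2 * k).factorial) ∂ν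
        ≤ ENNReal.ofReal (c * (1 / 2) ^ k) := by
      intro k
      rw [← ofReal_integral_eq_lintegral_ofReal]
      · refine ENNReal.ofReal_le_ofReal ?_
        have h1 : ∀ x : ℝ, (t * x) ^ (2 * k) / ((2 * k).factorial : ℝ)
            = t ^ (2 * k) / (2 * k).factorial * x ^ (2 * k) := fun x => by
          rw [mul_pow]; ring
        simp_rw [h1]
        rw [integral_const_mul]
        have hf : (0 : ℝ) < (2 * k).factorial := by positivity
        calc t ^ (2 * k) / (2 * k).factorial * ∫ x, x ^ (2 * k) ∂ν
            ≤ t ^ (2 * k) / (2 * k).factorial * (c * K ^ k * (2 * k).factorial) := by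
              refine mul_le_mul_of_nonneg_left (hbd k) ?_
              rw [pow_mul]; positivity
          _ = c * (K * t ^ 2) ^ k := by
              rw [mul_pow, ← pow_mul]; field_simp
          _ ≤ c * (1 / 2) ^ k := by gcongr
      · have h1 : ∀ x : ℝ, (t * x) ^ (2 * k) / ((2 * k).factorial : ℝ)
            = t ^ (2 * k) / (2 * k).factorial * x ^ (2 * k) := fun x => by
          rw [mul_pow]; ring
        simp_rw [h1]
        exact (hint _).const_mul _
      · exact Eventually.of_forall fun x => by
          simp only [Pi.zero_apply]; rw [pow_mul]; positivity
    refine lt_of_le_of_lt (ENNReal.tsum_le_tsum hterm) ?_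
    have hs : Summable fun k : ℕ => c * (1 / 2 : ℝ) ^ k :=
      (summable_geometric_of_lt_one (by norm_num) (by norm_num)).mul_left c
    rw [← ENNReal.ofReal_tsum_of_nonneg (fun k => by positivity) hs]
    exact ENNReal.ofReal_lt_top
  refine (hcosh.const_mul 2).mono' (by fun_prop) (Eventually.of_forall fun x => ?_)
  rw [Real.norm_of_nonneg (Real.exp_pos _).le, Real.cosh_eq]
  linarith [Real.exp_pos (-(t * x))]

theorem zero_mem_interior_integrableExpSet_of_moment_le {ν : Measure ℝ} [IsFiniteMeasure ν]
    {c K : ℝ} (hint : ∀ s : ℕ, Integrable (fun x : ℝ => x ^ s) ν)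
    (hbd : ∀ k : ℕ, ∫ x, x ^ (2 * k) ∂ν ≤ c * K ^ k * (2 * k).factorial) (hK : 0 ≤ K) :
    (0 : ℝ) ∈ interior (integrableExpSet id ν) := by
  have hlim : ∀ᶠ t : ℝ in 𝓝 0, K * t ^ 2 < 1 / 2 := by
    have : Tendsto (fun t : ℝ => K * t ^ 2) (𝓝 0) (𝓝 (K * 0 ^ 2)) :=
      Continuous.tendsto (by fun_prop) 0
    exact this.eventually_lt_const (by norm_num)
  rw [mem_interior_iff_mem_nhds]
  filter_upwards [hlim] with t ht
  exact integrable_exp_mul_of_moment_le hint hbd hK ht.le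

/-- Measures with a common sequence of moments of factorial growth coincide: both complex
moment generating functions are analytic on a vertical strip and have the same Taylor series at
`0`, so they agree on the imaginary axis. -/
theorem Measure.ext_of_moments {μ ν : Measure ℝ} [IsFiniteMeasure μ] [IsFiniteMeasure ν] {c K : ℝ}
    (hK : 0 ≤ K) (hμ : ∀ s : ℕ, Integrable (fun x : ℝ => x ^ s) μ)
    (hν : ∀ s : ℕ, Integrable (fun x : ℝ => x ^ s) ν)
    (heq : ∀ s : ℕ, ∫ x, x ^ s ∂μ = ∫ x, x ^ s ∂ν)
    (hbd : ∀ k : ℕ, ∫ x, x ^ (2 * k) ∂μ ≤ c * K ^ k * (2 * k).factorial) : μ = ν := by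
  have h0μ := zero_mem_interior_integrableExpSet_of_moment_le hμ hbd hK
  have h0ν := zero_mem_interior_integrableExpSet_of_moment_le hν (fun k => heq _ ▸ hbd k) hK
  set U : Set ℝ := interior (integrableExpSet id μ) ∩ interior (integrableExpSet id ν) with hU
  have hconv : Convex ℝ U := convex_integrableExpSet.interior.inter convex_integrableExpSet.interior
  have haμ : AnalyticOnNhd ℂ (complexMGF id μ) {z | z.re ∈ U} :=
    analyticOnNhd_complexMGF.mono fun z hz => hz.1
  have haν : AnalyticOnNhd ℂ (complexMGF id ν) {z | z.re ∈ U} :=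
    analyticOnNhd_complexMGF.mono fun z hz => hz.2
  have h0 : (0 : ℂ) ∈ {z : ℂ | z.re ∈ U} := ⟨by simpa using h0μ, by simpa using h0ν⟩
  have hev : complexMGF id μ =ᶠ[𝓝 0] complexMGF id ν := by
    have h1 := (haμ 0 h0).hasFPowerSeriesAt
    have h2 := (haν 0 h0).hasFPowerSeriesAt
    -- the derivatives at `0` are the moments
    have hder : ∀ n, iteratedDeriv n (complexMGF id μ) 0 = iteratedDeriv n (complexMGF id ν) 0 := by
      intro n
      rw [iteratedDeriv_complexMGF (by simpa using h0μ),
        iteratedDeriv_complexMGF (by simpa using h0ν)]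
      simp only [id, zero_mul, Complex.exp_zero, mul_one]
      have h3 : ∀ ρ : Measure ℝ, ∫ x : ℝ, (x : ℂ) ^ n ∂ρ = ((∫ x : ℝ, x ^ n ∂ρ : ℝ) : ℂ) := by
        intro ρ
        rw [← integral_complex_ofReal]
        simp
      rw [h3, h3, heq]
    simp_rw [hder] at h1
    have h3 := h1.sub h2
    rw [sub_self] at h3
    filter_upwards [h3.eventually_eq_zero] with z hz
    simpa [sub_eq_zero] using hz
  have hpre : IsPreconnected {z : ℂ | z.re ∈ U} :=
    (hconv.linear_preimage Complex.reLm).isPreconnected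
  have hEq := haμ.eqOn_of_preconnected_of_eventuallyEq haν hpre h0 hev
  refine Measure.ext_of_charFun ?_
  ext t
  rw [← complexMGF_id_mul_I, ← complexMGF_id_mul_I]
  exact hEq (by simpa using h0)

/-- Fatou's lemma for weak convergence. -/
theorem integrable_of_tendsto_of_integral_le {μ : ℕ → ProbabilityMeasure ℝ}
    {ν : ProbabilityMeasure ℝ} (hlim : Tendsto μ atTop (𝓝 ν)) {g : ℝ → ℝ} (hg : Continuous g)
    (hg0 : ∀ x, 0 ≤ g x) {B : ℝ} (hint : ∀ n, Integrable g (μ n : Measure ℝ))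
    (hB : ∀ n, ∫ x, g x ∂(μ n : Measure ℝ) ≤ B) :
    Integrable g (ν : Measure ℝ) ∧ ∫ x, g x ∂(ν : Measure ℝ) ≤ B := by
  have h0B : 0 ≤ B := (integral_nonneg hg0).trans (hB 0)
  have h1 : ∫⁻ x, ENNReal.ofReal (g x) ∂(ν : Measure ℝ) ≤ ENNReal.ofReal B := by
    refine (lintegral_le_liminf_lintegral_of_forall_isOpen_measure_le_liminf_measure hg hg0
      (fun G hG => ProbabilityMeasure.le_liminf_measure_open_of_tendsto hlim hG)).trans ?_
    refine liminf_le_of_le (by isBoundedDefault) fun b hb => ?_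
    obtain ⟨n, hn⟩ := hb.exists
    refine hn.trans ?_
    rw [← ofReal_integral_eq_lintegral_ofReal (hint n) (Eventually.of_forall hg0)]
    exact ENNReal.ofReal_le_ofReal (hB n)
  have hi : Integrable g (ν : Measure ℝ) := by
    refine ⟨hg.aestronglyMeasurable, ?_⟩
    rw [hasFiniteIntegral_iff_norm]
    simp_rw [Real.norm_of_nonneg (hg0 _)]
    exact h1.trans_lt ENNReal.ofReal_lt_top
  refine ⟨hi, ?_⟩
  rw [← ofReal_integral_eq_lintegral_ofReal hi (Eventually.of_forall hg0)] at h1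
  exact (ENNReal.ofReal_le_ofReal_iff h0B).1 h1

/-- Moments pass to weak limits when all moments stay bounded: the truncation of `x ^ s` at height
`r` costs at most the moment of order `2 s` divided by `r`. -/
theorem tendsto_moment_of_tendsto {μ : ℕ → ProbabilityMeasure ℝ}
    {ν : ProbabilityMeasure ℝ} (hlim : Tendsto μ atTop (𝓝 ν))
    (hint : ∀ n s, Integrable (fun x : ℝ => x ^ s) (μ n : Measure ℝ)) {B : ℕ → ℝ}
    (hB : ∀ n s, ∫ x, x ^ (2 * s) ∂(μ n : Measure ℝ) ≤ B s) (s : ℕ) :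
    Integrable (fun x : ℝ => x ^ s) (ν : Measure ℝ) ∧
      Tendsto (fun n => ∫ x, x ^ s ∂(μ n : Measure ℝ)) atTop (𝓝 (∫ x, x ^ s ∂(ν : Measure ℝ))) := by
  have hsq : ∀ x : ℝ, 0 ≤ x ^ (2 * s) := fun x => by rw [pow_mul]; positivity
  obtain ⟨hi2, hB2⟩ := integrable_of_tendsto_of_integral_le hlim
    (g := fun x => x ^ (2 * s)) (by fun_prop) hsq (fun n => hint n _) (fun n => hB n s)
  have hi1 : Integrable (fun x : ℝ => x ^ s) (ν : Measure ℝ) := by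
    refine ((integrable_const (1 : ℝ)).add hi2).mono' (by fun_prop) (Eventually.of_forall fun x => ?_)
    simp only [Pi.add_apply, Real.norm_eq_abs]
    rw [mul_comm, pow_mul, ← sq_abs]
    nlinarith [sq_nonneg (|x ^ s| - 1)]
  refine ⟨hi1, ?_⟩
  have h0B : 0 ≤ B s := (integral_nonneg hsq).trans (hB 0 s)
  -- the truncation of `x ^ s`
  let F (r : ℝ) (hr : 0 < r) : ℝ →ᵇ ℝ := BoundedContinuousFunction.ofNormedAddCommGroup
    (fun x => max (-r) (min r (x ^ s))) (by fun_prop) r (fun x => by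
      rw [Real.norm_eq_abs, abs_le]
      exact ⟨le_max_left _ _, max_le (by linarith) (min_le_left _ _)⟩)
  have hF : ∀ (r : ℝ) (hr : 0 < r) (x : ℝ), |x ^ s - F r hr x| ≤ x ^ (2 * s) / r := by
    intro r hr x
    change |x ^ s - max (-r) (min r (x ^ s))| ≤ _
    rw [mul_comm 2 s, pow_mul, le_div_iff₀ hr]
    generalize x ^ s = y
    rcases le_total y r with h | h
    · rw [min_eq_right h]
      rcases le_total (-r) y with h' | h'
      · rw [max_eq_right h']; simp; positivity
      · rw [max_eq_left h', abs_of_nonpos (by linarith)]; nlinarith [sq_nonneg (y + r)]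
    · rw [min_eq_left h, max_eq_right (by linarith), abs_of_nonneg (by linarith)]
      nlinarith [sq_nonneg (y - r)]
  have hdiff : ∀ (ρ : ProbabilityMeasure ℝ), Integrable (fun x : ℝ => x ^ s) (ρ : Measure ℝ) →
      Integrable (fun x : ℝ => x ^ (2 * s)) (ρ : Measure ℝ) →
      ∫ x, x ^ (2 * s) ∂(ρ : Measure ℝ) ≤ B s → ∀ (r : ℝ) (hr : 0 < r),
      |∫ x, x ^ s ∂(ρ : Measure ℝ) - ∫ x, F r hr x ∂(ρ : Measure ℝ)| ≤ B s / r := by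
    intro ρ h1 h2 h3 r hr
    rw [← integral_sub h1 ((F r hr).integrable _)]
    calc |∫ x, (x ^ s - F r hr x) ∂(ρ : Measure ℝ)|
        ≤ ∫ x, |x ^ s - F r hr x| ∂(ρ : Measure ℝ) := abs_integral_le_integral_abs
      _ ≤ ∫ x, x ^ (2 * s) / r ∂(ρ : Measure ℝ) :=
          integral_mono (h1.sub ((F r hr).integrable _)).abs (h2.div_const r) (hF r hr)
      _ = (∫ x, x ^ (2 * s) ∂(ρ : Measure ℝ)) / r := integral_div _ _
      _ ≤ B s / r := by gcongr
  rw [Metric.tendsto_atTop]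
  intro ε hε
  obtain ⟨r, hr, hrB⟩ : ∃ r : ℝ, 0 < r ∧ B s / r < ε / 3 := by
    refine ⟨(B s + 1) / (ε / 3), by positivity, ?_⟩
    rw [div_div_eq_mul_div, div_lt_iff₀ (by positivity)]
    nlinarith
  have hlimF := (ProbabilityMeasure.tendsto_iff_forall_integral_tendsto.1 hlim) (F r hr)
  obtain ⟨n0, hn0⟩ := Metric.tendsto_atTop.1 hlimF (ε / 3) (by positivity)
  refine ⟨n0, fun n hn => ?_⟩
  have h1 := hdiff (μ n) (hint n s) (hint n _) (hB n s) r hr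
  have h2 := hdiff ν hi1 hi2 hB2 r hr
  have h3 := hn0 n hn
  rw [Real.dist_eq] at h3 ⊢
  rw [abs_lt] at h3 ⊢
  rw [abs_le] at h1 h2
  constructor <;> linarith [h1.1, h1.2, h2.1, h2.2, h3.1, h3.2]

/-- Compactness part of the method of moments: if all moments converge, a subsequence converges
weakly, to a measure with the limiting moments. -/
theorem exists_subseq_tendsto_of_moments {μ : ℕ → ProbabilityMeasure ℝ}
    (hint : ∀ n s, Integrable (fun x : ℝ => x ^ s) (μ n : Measure ℝ)) {m : ℕ → ℝ}
    (hm : ∀ s, Tendsto (fun n => ∫ x, x ^ s ∂(μ n : Measure ℝ)) atTop (𝓝 (m s))) :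
    ∃ (ν : ProbabilityMeasure ℝ) (φ : ℕ → ℕ), StrictMono φ ∧ Tendsto (μ ∘ φ) atTop (𝓝 ν) ∧
      (∀ s, Integrable (fun x : ℝ => x ^ s) (ν : Measure ℝ)) ∧
      ∀ s, ∫ x, x ^ s ∂(ν : Measure ℝ) = m s := by
  have hbdd : ∀ s, ∃ B, ∀ n, ∫ x, x ^ (2 * s) ∂(μ n : Measure ℝ) ≤ B := by
    intro s
    obtain ⟨B, hB⟩ := (hm (2 * s)).bddAbove_range
    exact ⟨B, fun n => hB ⟨n, rfl⟩⟩
  choose B hB using hbdd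
  -- by Chebyshev's inequality, since the second moments are bounded
  have htight : IsTightMeasureSet
      {((ρ : ProbabilityMeasure ℝ) : Measure ℝ) | ρ ∈ Set.range μ} := by
    refine isTightMeasureSet_of_tendsto_measure_norm_gt ?_
    have hlim0 : Tendsto (fun r : ℝ => ENNReal.ofReal (B 1 / r ^ 2)) atTop (𝓝 0) := by
      rw [← ENNReal.ofReal_zero]
      refine ENNReal.tendsto_ofReal ?_
      exact Tendsto.div_atTop tendsto_const_nhds (tendsto_pow_atTop (by norm_num))
    refine tendsto_of_tendsto_of_tendsto_of_le_of_le' tendsto_const_nhds hlim0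
      (Eventually.of_forall fun _ => zero_le) ?_
    filter_upwards [eventually_gt_atTop 0] with r hr
    refine iSup₂_le ?_
    rintro _ ⟨_, ⟨n, rfl⟩, rfl⟩
    have hi : Integrable (fun x : ℝ => x ^ 2) (μ n : Measure ℝ) := hint n 2
    have hmk := mul_meas_ge_le_integral_of_nonneg (μ := (μ n : Measure ℝ))
      (f := fun x : ℝ => x ^ 2) (Eventually.of_forall fun x => by positivity) hi (r ^ 2)
    have h2 : (μ n : Measure ℝ).real {x | r ^ 2 ≤ x ^ 2} ≤ B 1 / r ^ 2 := by
      rw [le_div_iff₀ (by positivity), mul_comm]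
      exact hmk.trans (by simpa using hB 1 n)
    rw [← ENNReal.ofReal_toReal (measure_ne_top (μ n : Measure ℝ) {x | r < ‖x‖})]
    refine ENNReal.ofReal_le_ofReal (le_trans ?_ h2)
    refine measureReal_mono (fun x hx => ?_)
    simp only [Set.mem_ofPred_eq, Real.norm_eq_abs] at hx ⊢
    rw [← sq_abs x]
    gcongr
  obtain ⟨ν, -, φ, hφ, hν⟩ := (isCompact_closure_of_isTightMeasureSet htight).tendsto_subseq
    (fun n => subset_closure (Set.mem_range_self n))
  have hmom := fun s => tendsto_moment_of_tendsto hν (fun n s => hint (φ n) s)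
    (fun n s => hB s (φ n)) s
  exact ⟨ν, φ, hφ, hν, fun s => (hmom s).1,
    fun s => tendsto_nhds_unique (hmom s).2 ((hm s).comp hφ.tendsto_atTop)⟩

/-- **Method of moments**: convergence of all moments to those of a moment-determinate measure
implies weak convergence. -/
theorem tendsto_of_moments {μ : ℕ → ProbabilityMeasure ℝ} {σ : ProbabilityMeasure ℝ}
    (hint : ∀ n s, Integrable (fun x : ℝ => x ^ s) (μ n : Measure ℝ)) {m : ℕ → ℝ}
    (hm : ∀ s, Tendsto (fun n => ∫ x, x ^ s ∂(μ n : Measure ℝ)) atTop (𝓝 (m s)))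
    (huniq : ∀ ν : ProbabilityMeasure ℝ, (∀ s, Integrable (fun x : ℝ => x ^ s) (ν : Measure ℝ)) →
      (∀ s, ∫ x, x ^ s ∂(ν : Measure ℝ) = m s) → ν = σ) :
    Tendsto μ atTop (𝓝 σ) := by
  refine tendsto_of_subseq_tendsto fun ns hns => ?_
  obtain ⟨ν, φ, -, hφ, hi, he⟩ := exists_subseq_tendsto_of_moments (μ := μ ∘ ns)
    (fun n s => hint (ns n) s) (fun s => (hm s).comp hns)
  exact ⟨φ, huniq ν hi he ▸ hφ⟩

/-! ### Growth of the limiting moments -/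

theorem coupledS_of_lt (p α : ℝ) (X : ℕ → ℝ) (b : Bool) {l r : ℕ} (h : l < r) :
    coupledS p α X b l r = 0 := by
  rw [coupledS, if_neg (by omega), dif_neg (by omega)]

theorem coupledS_zero_right (p α : ℝ) (X : ℕ → ℝ) (b : Bool) (l : ℕ) :
    coupledS p α X b l 0 = if l = 0 then (if b then α else 1 - α) else 0 := by
  rw [coupledS, if_pos rfl]

theorem factorial_succ_mul_factorial_succ_le (a b : ℕ) :
    (a + 1).factorial * (b + 1).factorial ≤ (a + b + 1).factorial := by
  induction a with
  | zero => simp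
  | succ a ih =>
    calc (a + 1 + 1).factorial * (b + 1).factorial
        = (a + 1 + 1) * ((a + 1).factorial * (b + 1).factorial) := by
          rw [Nat.factorial_succ (a + 1)]; ring
      _ ≤ (a + b + 1 + 1) * (a + b + 1).factorial := by gcongr; omega
      _ = (a + 1 + b + 1).factorial := by
          rw [show a + 1 + b + 1 = (a + b + 1) + 1 by omega, Nat.factorial_succ (a + b + 1)]

theorem sum_factorial_mul_factorial_le (n : ℕ) :
    ∑ u ∈ Finset.range (n + 1), u.factorial * (n - u).factorial ≤ 3 * n.factorial := by
  rcases n with _ | n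
  · simp
  rw [Finset.sum_range_succ, Finset.sum_range_succ']
  have h : ∑ k ∈ Finset.range n, (k + 1).factorial * (n + 1 - (k + 1)).factorial
      ≤ ∑ _k ∈ Finset.range n, n.factorial := by
    refine Finset.sum_le_sum fun k hk => ?_
    have hk' := Finset.mem_range.1 hk
    have := factorial_succ_mul_factorial_succ_le k (n - k - 1)
    rw [show k + (n - k - 1) + 1 = n by omega, show n - k - 1 + 1 = n + 1 - (k + 1) by omega] at this
    exact this
  rw [Finset.sum_const, Finset.card_range, smul_eq_mul] at h
  have h2 : n * n.factorial ≤ (n + 1).factorial := by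
    rw [Nat.factorial_succ]; gcongr; omega
  simp only [Nat.factorial_zero, tsub_zero, one_mul, tsub_self, mul_one]
  omega

theorem sum_sq_factorial_mul_factorial_le (n : ℕ) :
    ∑ u ∈ Finset.range (n + 1), ((u.factorial : ℝ) * (n - u).factorial) ^ 2
      ≤ 3 * (n.factorial : ℝ) ^ 2 := by
  calc ∑ u ∈ Finset.range (n + 1), ((u.factorial : ℝ) * (n - u).factorial) ^ 2
      ≤ ∑ u ∈ Finset.range (n + 1), (n.factorial : ℝ) * ((u.factorial : ℝ) * (n - u).factorial) := by
        refine Finset.sum_le_sum fun u hu => ?_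
        have hu' : u ≤ n := Nat.lt_succ_iff.1 (Finset.mem_range.1 hu)
        have : u.factorial * (n - u).factorial ≤ n.factorial :=
          Nat.le_of_dvd (Nat.factorial_pos _) (by
            have := Nat.factorial_mul_factorial_dvd_factorial hu'
            exact this)
        rw [sq]
        refine mul_le_mul_of_nonneg_right ?_ (by positivity)
        exact_mod_cast this
    _ = (n.factorial : ℝ) * ∑ u ∈ Finset.range (n + 1), ((u.factorial : ℝ) * (n - u).factorial) := by
        rw [Finset.mul_sum]
    _ ≤ (n.factorial : ℝ) * (3 * n.factorial) := by
        refine mul_le_mul_of_nonneg_left ?_ (by positivity)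
        exact_mod_cast sum_factorial_mul_factorial_le n
    _ = 3 * (n.factorial : ℝ) ^ 2 := by ring

theorem choose_mul_sq_factorial_le {l r f : ℕ} (hf : 1 ≤ f) (hfr : f ≤ r) (hrl : r ≤ l) :
    ((r - 1).choose (f - 1) : ℝ) * (f.factorial : ℝ) ^ 2 * ((l - f).factorial : ℝ) ^ 2
      ≤ (l.factorial : ℝ) ^ 2 := by
  have h1 : (r - 1).choose (f - 1) ≤ l.choose f := by
    obtain ⟨f, rfl⟩ : ∃ g, f = g + 1 := ⟨f - 1, by omega⟩
    obtain ⟨l, rfl⟩ : ∃ g, l = g + 1 := ⟨l - 1, by omega⟩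
    rw [Nat.choose_succ_succ, Nat.add_sub_cancel]
    exact (Nat.choose_le_choose f (by omega)).trans (Nat.le_add_right _ _)
  have h2 := Nat.choose_mul_factorial_mul_factorial (show f ≤ l by omega)
  have h3 : f.factorial * (l - f).factorial ≤ l.factorial :=
    Nat.le_of_dvd (Nat.factorial_pos _) (Nat.factorial_mul_factorial_dvd_factorial (by omega))
  have h4 : (r - 1).choose (f - 1) * f.factorial ^ 2 * (l - f).factorial ^ 2 ≤ l.factorial ^ 2 := by
    calc (r - 1).choose (f - 1) * f.factorial ^ 2 * (l - f).factorial ^ 2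
        ≤ l.choose f * f.factorial ^ 2 * (l - f).factorial ^ 2 := by gcongr
      _ = (l.choose f * f.factorial * (l - f).factorial) * (f.factorial * (l - f).factorial) := by
          ring
      _ ≤ l.factorial * l.factorial := by rw [h2]; gcongr
      _ = l.factorial ^ 2 := by ring
  exact_mod_cast h4

theorem sum_two_pow_mul_quarter_pow_le (n : ℕ) :
    ∑ v ∈ Finset.range n, (2 : ℝ) ^ v * (1 / 4) ^ v ≤ 2 := by
  have h : ∀ v : ℕ, (2 : ℝ) ^ v * (1 / 4) ^ v = (1 / 2) ^ v := fun v => by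
    rw [← mul_pow]; norm_num
  simp_rw [h]
  exact sum_geometric_two_le n

/-- The arrays grow like `(l !) ^ 2`. Of the binomial coefficients in the recurrence, the first is
absorbed by `(l !) ^ 2`, because `(r-1).choose (f-1) * (f ! * (l-f)!) ^ 2 ≤ (l !) ^ 2`; the second is
at most `2 ^ (f + v)`, and the weight `4 ^ (-r)` makes the sum over `v` converge. -/
theorem abs_coupledS_le {p α : ℝ} {X : ℕ → ℝ} (hp : 0 < p) (hα : α ∈ Set.Ioo (0 : ℝ) 1) {K₀ : ℝ}
    (hK₀ : 0 < K₀) (hX : ∀ f : ℕ, 1 ≤ f → |X (2 * f)| ≤ K₀ ^ f * (f.factorial : ℝ) ^ 2)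
    (b : Bool) (l r : ℕ) :
    |coupledS p α X b l r|
      ≤ (8 * K₀ * (1 + 6 * p)) ^ l * (l.factorial : ℝ) ^ 2 * (1 / 4) ^ r := by
  induction l using Nat.strong_induction_on generalizing b r with
  | _ l ih =>
  -- the sums over `v` and `u` cost the factors `2` and `3`, and `M` is such that the remaining
  -- sum of `M⁻¹ ^ f` over `f` is at most `1 / (6 p)`
  set M : ℝ := 1 + 6 * p with hM
  set K : ℝ := 8 * K₀ * M with hK
  have hM0 : 0 < M := by positivity
  have hK0 : 0 < K := by positivity
  rcases Nat.eq_zero_or_pos r with rfl | hr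
  · rw [coupledS_zero_right]
    split_ifs with h1 h2
    · subst h1; simp only [pow_zero, Nat.factorial_zero, Nat.cast_one, one_pow, mul_one]
      rw [abs_le]; constructor <;> linarith [hα.1, hα.2]
    · subst h1; simp only [pow_zero, Nat.factorial_zero, Nat.cast_one, one_pow, mul_one]
      rw [abs_le]; constructor <;> linarith [hα.1, hα.2]
    · rw [abs_zero]; positivity
  rcases lt_or_ge l r with hlr | hrl
  · rw [coupledS_of_lt _ _ _ _ hlr, abs_zero]; positivity
  rw [coupledS_rec p α X b hr hrl, abs_mul, abs_of_pos hp]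
  have hterm : ∀ f ∈ Finset.Icc 1 r,
      |((r - 1).choose (f - 1) : ℝ) * X (2 * f) *
        ∑ u ∈ Finset.Icc 0 (l - r), coupledS p α X b (l - u - f) (r - f) *
          ∑ v ∈ Finset.Icc 0 u, ((f + v - 1).choose (f - 1) : ℝ) * coupledS p α X (!b) u v|
        ≤ 6 * (K ^ l * (l.factorial : ℝ) ^ 2 * (1 / 4) ^ r) * (1 / M) ^ f := by
    intro f hf
    obtain ⟨hf1, hfr⟩ := Finset.mem_Icc.1 hf
    have hv : ∀ u ∈ Finset.Icc 0 (l - r),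
        |∑ v ∈ Finset.Icc 0 u, ((f + v - 1).choose (f - 1) : ℝ) * coupledS p α X (!b) u v|
          ≤ 2 ^ f * 2 * (K ^ u * (u.factorial : ℝ) ^ 2) := by
      intro u hu
      have hu' := (Finset.mem_Icc.1 hu).2
      refine (Finset.abs_sum_le_sum_abs _ _).trans ?_
      calc ∑ v ∈ Finset.Icc 0 u, |((f + v - 1).choose (f - 1) : ℝ) * coupledS p α X (!b) u v|
          ≤ ∑ v ∈ Finset.Icc 0 u, 2 ^ f * (K ^ u * (u.factorial : ℝ) ^ 2) *
              (2 ^ v * (1 / 4) ^ v) := by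
            refine Finset.sum_le_sum fun v _ => ?_
            rw [abs_mul, Nat.abs_cast]
            have h1 : ((f + v - 1).choose (f - 1) : ℝ) ≤ 2 ^ f * 2 ^ v := by
              have : (f + v - 1).choose (f - 1) ≤ 2 ^ (f + v) :=
                (Nat.choose_le_two_pow _ _).trans (Nat.pow_le_pow_right (by norm_num) (by omega))
              rw [← pow_add]
              exact_mod_cast this
            calc _ ≤ 2 ^ f * 2 ^ v * (K ^ u * (u.factorial : ℝ) ^ 2 * (1 / 4) ^ v) :=
                  mul_le_mul h1 (ih u (by omega) (!b) v) (abs_nonneg _) (by positivity)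
              _ = _ := by ring
        _ = 2 ^ f * (K ^ u * (u.factorial : ℝ) ^ 2) *
              ∑ v ∈ Finset.range (u + 1), 2 ^ v * (1 / 4) ^ v := by
            rw [← Finset.mul_sum]
            congr 1
            refine Finset.sum_congr ?_ fun _ _ => rfl
            ext x; simp
        _ ≤ 2 ^ f * (K ^ u * (u.factorial : ℝ) ^ 2) * 2 := by
            gcongr; exact sum_two_pow_mul_quarter_pow_le _
        _ = _ := by ring
    have hu : |∑ u ∈ Finset.Icc 0 (l - r), coupledS p α X b (l - u - f) (r - f) *
          ∑ v ∈ Finset.Icc 0 u, ((f + v - 1).choose (f - 1) : ℝ) * coupledS p α X (!b) u v|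
        ≤ 2 ^ f * 2 * K ^ (l - f) * (1 / 4) ^ (r - f) * (3 * ((l - f).factorial : ℝ) ^ 2) := by
      refine (Finset.abs_sum_le_sum_abs _ _).trans ?_
      calc _ ≤ ∑ u ∈ Finset.Icc 0 (l - r), 2 ^ f * 2 * K ^ (l - f) * (1 / 4) ^ (r - f) *
              ((u.factorial : ℝ) * (l - f - u).factorial) ^ 2 := by
            refine Finset.sum_le_sum fun u hu => ?_
            have hu' := (Finset.mem_Icc.1 hu).2
            rw [abs_mul]
            calc _ ≤ (K ^ (l - u - f) * ((l - u - f).factorial : ℝ) ^ 2 * (1 / 4) ^ (r - f)) *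
                  (2 ^ f * 2 * (K ^ u * (u.factorial : ℝ) ^ 2)) :=
                  mul_le_mul (ih _ (by omega) b _) (hv u hu) (abs_nonneg _) (by positivity)
              _ = _ := by
                  rw [show l - f = (l - u - f) + u by omega, pow_add,
                    show l - u - f + u - u = l - u - f by omega]
                  ring
        _ ≤ ∑ u ∈ Finset.range (l - f + 1), 2 ^ f * 2 * K ^ (l - f) * (1 / 4) ^ (r - f) *
              ((u.factorial : ℝ) * (l - f - u).factorial) ^ 2 := by
            refine Finset.sum_le_sum_of_subset_of_nonneg (fun u hu => ?_)
              (fun _ _ _ => by positivity)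
            have := (Finset.mem_Icc.1 hu).2
            exact Finset.mem_range.2 (by omega)
        _ ≤ _ := by
            rw [← Finset.mul_sum]
            refine mul_le_mul_of_nonneg_left (sum_sq_factorial_mul_factorial_le _) (by positivity)
    rw [abs_mul, abs_mul, Nat.abs_cast]
    calc ((r - 1).choose (f - 1) : ℝ) * |X (2 * f)| * _
        ≤ ((r - 1).choose (f - 1) : ℝ) * (K₀ ^ f * (f.factorial : ℝ) ^ 2) *
          (2 ^ f * 2 * K ^ (l - f) * (1 / 4) ^ (r - f) * (3 * ((l - f).factorial : ℝ) ^ 2)) := by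
          refine mul_le_mul (mul_le_mul_of_nonneg_left (hX f hf1) (by positivity)) hu
            (abs_nonneg _) (by positivity)
      _ = (((r - 1).choose (f - 1) : ℝ) * (f.factorial : ℝ) ^ 2 * ((l - f).factorial : ℝ) ^ 2) *
          (6 * ((2 * K₀) ^ f * K ^ (l - f) * (1 / 4) ^ (r - f))) := by
          rw [mul_pow]; ring
      _ ≤ (l.factorial : ℝ) ^ 2 * (6 * ((2 * K₀) ^ f * K ^ (l - f) * (1 / 4) ^ (r - f))) :=
          mul_le_mul_of_nonneg_right (choose_mul_sq_factorial_le hf1 hfr hrl) (by positivity)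
      _ = 6 * (K ^ l * (l.factorial : ℝ) ^ 2 * (1 / 4) ^ r) * (1 / M) ^ f := by
          have e1 : K ^ l = K ^ (l - f) * K ^ f := by rw [← pow_add]; congr 1; omega
          have e2 : (1 / 4 : ℝ) ^ r = (1 / 4) ^ (r - f) * (1 / 4) ^ f := by
            rw [← pow_add]; congr 1; omega
          have e3 : K ^ f * (1 / 4) ^ f * (1 / M) ^ f = (2 * K₀) ^ f := by
            rw [← mul_pow, ← mul_pow, hK]; congr 1; field_simp; norm_num
          rw [e1, e2, ← e3]; ring
  have hgeo : ∑ f ∈ Finset.Icc 1 r, (1 / M) ^ f ≤ 1 / (6 * p) := by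
    have hlt : 1 / M < 1 := by rw [div_lt_one hM0, hM]; linarith
    have h1 : ∑ f ∈ Finset.Icc 1 r, (1 / M) ^ f = (1 / M) * ∑ f ∈ Finset.range r, (1 / M) ^ f := by
      rw [Finset.mul_sum, ← Finset.Ico_succ_right_eq_Icc, Finset.sum_Ico_eq_sum_range]
      refine Finset.sum_congr (by simp) fun f _ => ?_
      rw [pow_add, pow_one]
    have h2 : ∑ f ∈ Finset.range r, (1 / M) ^ f ≤ (1 - 1 / M)⁻¹ := by
      rw [← tsum_geometric_of_lt_one (by positivity) hlt]
      exact (summable_geometric_of_lt_one (by positivity) hlt).sum_le_tsum _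
        (fun _ _ => by positivity)
    rw [h1]
    refine (mul_le_mul_of_nonneg_left h2 (by positivity)).trans (le_of_eq ?_)
    have : (1 - 1 / M) = 6 * p / M := by rw [hM]; field_simp; ring
    rw [this, inv_div]
    field_simp
  calc _ ≤ p * ∑ f ∈ Finset.Icc 1 r, 6 * (K ^ l * (l.factorial : ℝ) ^ 2 * (1 / 4) ^ r) *
        (1 / M) ^ f := by
        refine mul_le_mul_of_nonneg_left ?_ hp.le
        exact (Finset.abs_sum_le_sum_abs _ _).trans (Finset.sum_le_sum hterm)
    _ = p * (6 * (K ^ l * (l.factorial : ℝ) ^ 2 * (1 / 4) ^ r)) *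
        ∑ f ∈ Finset.Icc 1 r, (1 / M) ^ f := by rw [← Finset.mul_sum]; ring
    _ ≤ p * (6 * (K ^ l * (l.factorial : ℝ) ^ 2 * (1 / 4) ^ r)) * (1 / (6 * p)) := by
        gcongr
    _ = K ^ l * (l.factorial : ℝ) ^ 2 * (1 / 4) ^ r := by field_simp

/-- The moment of order `s` of the limiting measure. -/
noncomputable def limitMoment (p α : ℝ) (X : ℕ → ℝ) (s : ℕ) : ℝ :=
  if Even s then ∑ i ∈ Finset.Icc 0 (s / 2), (S1 p α X (s / 2) i + S2 p α X (s / 2) i) else 0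

theorem limitMoment_two_mul (p α : ℝ) (X : ℕ → ℝ) (k : ℕ) : limitMoment p α X (2 * k) =
    ∑ i ∈ Finset.Icc 0 k, (S1 p α X k i + S2 p α X k i) := by
  simp [limitMoment]

theorem limitMoment_two_mul_add_one (p α : ℝ) (X : ℕ → ℝ) (k : ℕ) :
    limitMoment p α X (2 * k + 1) = 0 := by
  simp [limitMoment]

theorem exists_limitMoment_le {p α : ℝ} {X : ℕ → ℝ} (hp : 0 < p) (hα : α ∈ Set.Ioo (0 : ℝ) 1)
    (hX0 : ∀ f : ℕ, 0 ≤ X (2 * f)) {C : ℝ}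
    (hX : ∀ m : ℕ, 1 ≤ m → X (2 * m) ≤ (C * m) ^ (2 * m)) :
    ∃ K : ℝ, 0 ≤ K ∧ ∀ k : ℕ, limitMoment p α X (2 * k) ≤ 4 * K ^ k * (2 * k).factorial := by
  -- `f ^ f ≤ e ^ f * f !` brings the hypothesis into the form required by `abs_coupledS_le`
  set K₀ : ℝ := (C ^ 2 + 1) * Real.exp 1 ^ 2 with hK₀
  have hK₀0 : 0 < K₀ := by positivity
  have hX' : ∀ f : ℕ, 1 ≤ f → |X (2 * f)| ≤ K₀ ^ f * (f.factorial : ℝ) ^ 2 := by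
    intro f hf
    rw [abs_of_nonneg (hX0 f)]
    refine (hX f hf).trans ?_
    have h1 : (f : ℝ) ^ f ≤ Real.exp 1 ^ f * f.factorial := by
      have := Real.pow_div_factorial_le_exp (f : ℝ) (by positivity) f
      rw [div_le_iff₀ (by positivity)] at this
      rwa [← Real.exp_nat_mul, mul_one]
    calc (C * f) ^ (2 * f) = (C ^ 2) ^ f * ((f : ℝ) ^ f) ^ 2 := by
          rw [mul_pow, pow_mul C, ← pow_mul (f : ℝ) f 2, mul_comm f 2]
      _ ≤ (C ^ 2 + 1) ^ f * (Real.exp 1 ^ f * f.factorial) ^ 2 := by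
          gcongr; linarith
      _ = K₀ ^ f * (f.factorial : ℝ) ^ 2 := by
          rw [hK₀, mul_pow, mul_pow, ← pow_mul, ← pow_mul, mul_comm 2 f]; ring
  refine ⟨8 * K₀ * (1 + 6 * p), by positivity, fun k => ?_⟩
  set K : ℝ := 8 * K₀ * (1 + 6 * p) with hK
  rw [limitMoment_two_mul]
  have hgeo : ∑ i ∈ Finset.Icc 0 k, (1 / 4 : ℝ) ^ i ≤ 2 := by
    refine le_trans ?_ (sum_two_pow_mul_quarter_pow_le (k + 1))
    have : Finset.Icc 0 k = Finset.range (k + 1) := by ext x; simp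
    rw [this]
    refine Finset.sum_le_sum fun i _ => ?_
    exact le_mul_of_one_le_left (by positivity) (one_le_pow₀ (by norm_num))
  have hfac : (k.factorial : ℝ) ^ 2 ≤ (2 * k).factorial := by
    have := Nat.le_of_dvd (Nat.factorial_pos _) (Nat.factorial_mul_factorial_dvd_factorial_add k k)
    rw [two_mul, sq]
    exact_mod_cast this
  have hK0 : 0 ≤ K := by positivity
  calc ∑ i ∈ Finset.Icc 0 k, (S1 p α X k i + S2 p α X k i)
      ≤ ∑ i ∈ Finset.Icc 0 k, 2 * (K ^ k * (k.factorial : ℝ) ^ 2) * (1 / 4) ^ i := by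
        refine Finset.sum_le_sum fun i _ => ?_
        have h1 := (le_abs_self _).trans (abs_coupledS_le hp hα hK₀0 hX' true k i)
        have h2 := (le_abs_self _).trans (abs_coupledS_le hp hα hK₀0 hX' false k i)
        rw [S1, S2]
        linarith
    _ = 2 * (K ^ k * (k.factorial : ℝ) ^ 2) * ∑ i ∈ Finset.Icc 0 k, (1 / 4 : ℝ) ^ i := by
        rw [Finset.mul_sum]
    _ ≤ 2 * (K ^ k * (k.factorial : ℝ) ^ 2) * 2 := by gcongr
    _ ≤ 2 * (K ^ k * (2 * k).factorial) * 2 := by gcongr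
    _ = 4 * K ^ k * (2 * k).factorial := by ring

/-! ### Forests hanging from a set of roots -/

section Forest

variable {V : Type*}

/-- An orientation of the edge set `S` with roots `R`: every edge selects one of its end points, its
child, in such a way that no root is a child and no vertex is the child of two edges. -/
structure IsOrientation (R : Finset V) (S : Finset (Sym2 V)) (f : Sym2 V → V) : Prop where
  mem : ∀ e ∈ S, f e ∈ e
  notMem_roots : ∀ e ∈ S, f e ∉ R
  injOn : Set.InjOn f S

/-- The edge set `S` can be oriented with roots `R`. For edge sets each of whose components meets
`R`, this means that `S` is a forest and each of its trees contains exactly one root. -/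
def IsRootedForest (R : Finset V) (S : Finset (Sym2 V)) : Prop := ∃ f, IsOrientation R S f

theorem IsOrientation.anti {R R' : Finset V} {S S' : Finset (Sym2 V)} {f : Sym2 V → V}
    (h : IsOrientation R S f) (hR : R' ⊆ R) (hS : S' ⊆ S) : IsOrientation R' S' f :=
  ⟨fun e he => h.mem e (hS he), fun e he hm => h.notMem_roots e (hS he) (hR hm),
    h.injOn.mono (by exact_mod_cast hS)⟩

theorem IsRootedForest.anti {R R' : Finset V} {S S' : Finset (Sym2 V)}
    (h : IsRootedForest R S) (hR : R' ⊆ R) (hS : S' ⊆ S) : IsRootedForest R' S' :=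
  h.imp fun _ hf => hf.anti hR hS

theorem isRootedForest_empty (R : Finset V) [Nonempty V] : IsRootedForest R ∅ :=
  ⟨fun _ => Classical.arbitrary V, by simp, by simp, by simp⟩

theorem IsOrientation.apply_eq_right {R : Finset V} {S : Finset (Sym2 V)} {f : Sym2 V → V}
    (h : IsOrientation R S f) {x y : V} (hx : x ∈ R) (he : s(x, y) ∈ S) : f s(x, y) = y := by
  rcases Sym2.mem_iff.1 (h.mem _ he) with h1 | h1
  · exact absurd (by rw [h1]; exact hx) (h.notMem_roots _ he)
  · exact h1

theorem not_isRootedForest_of_mem {R : Finset V} {S : Finset (Sym2 V)} {x y : V} (hx : x ∈ R)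
    (hy : y ∈ R) (he : s(x, y) ∈ S) : ¬ IsRootedForest R S := by
  rintro ⟨f, hf⟩
  exact hf.notMem_roots _ he (by rwa [hf.apply_eq_right hx he])

/-- An edge from a root to another vertex can be removed at the cost of making that vertex a
root. -/
theorem isRootedForest_insert_iff [DecidableEq V] {R : Finset V} {S : Finset (Sym2 V)} {x y : V}
    (hx : x ∈ R) (hy : y ∉ R) (he : s(x, y) ∉ S) :
    IsRootedForest R (insert s(x, y) S) ↔ IsRootedForest (insert y R) S := by
  constructor
  · rintro ⟨f, hf⟩
    have hfe := hf.apply_eq_right hx (Finset.mem_insert_self _ _)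
    refine ⟨f, fun e h => hf.mem e (Finset.mem_insert_of_mem h), fun e h hm => ?_,
      (hf.anti subset_rfl (Finset.subset_insert _ _)).injOn⟩
    rcases Finset.mem_insert.1 hm with h1 | h1
    · have := hf.injOn (by simp [h]) (by simp) (h1.trans hfe.symm)
      exact he (this ▸ h)
    · exact hf.notMem_roots e (Finset.mem_insert_of_mem h) h1
  · rintro ⟨f, hf⟩
    have hne : ∀ e ∈ S, e ≠ s(x, y) := fun e h h' => he (h' ▸ h)
    refine ⟨Function.update f s(x, y) y, fun e h => ?_, fun e h => ?_, ?_⟩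
    · rcases Finset.mem_insert.1 h with rfl | h
      · simp
      · rw [Function.update_of_ne (hne e h)]; exact hf.mem e h
    · rcases Finset.mem_insert.1 h with rfl | h
      · simpa using hy
      · rw [Function.update_of_ne (hne e h)]
        exact fun h' => hf.notMem_roots e h (Finset.mem_insert_of_mem h')
    · rw [Finset.coe_insert, Set.injOn_insert (by exact_mod_cast he)]
      refine ⟨fun e h e' h' hee => ?_, ?_⟩
      · rw [Function.update_of_ne (hne e h), Function.update_of_ne (hne e' h')] at hee
        exact hf.injOn h h' hee
      · rintro ⟨e, h, hee⟩
        rw [Function.update_of_ne (hne e h), Function.update_self] at hee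
        exact hf.notMem_roots e h (hee ▸ Finset.mem_insert_self _ _)

/-- A pendant edge does not matter. -/
theorem IsRootedForest.insert_of_forall_notMem [DecidableEq V] {R : Finset V}
    {S : Finset (Sym2 V)} (h : IsRootedForest R S) {z y : V} (hy : y ∉ R)
    (hS : ∀ e ∈ S, y ∉ e) : IsRootedForest R (insert s(z, y) S) := by
  obtain ⟨f, hf⟩ := h
  have hne : ∀ e ∈ S, e ≠ s(z, y) := fun e h h' => hS e h (by simp [h'])
  refine ⟨Function.update f s(z, y) y, fun e h => ?_, fun e h => ?_, ?_⟩
  · rcases Finset.mem_insert.1 h with rfl | h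
    · simp
    · rw [Function.update_of_ne (hne e h)]; exact hf.mem e h
  · rcases Finset.mem_insert.1 h with rfl | h
    · simpa using hy
    · rw [Function.update_of_ne (hne e h)]; exact hf.notMem_roots e h
  · rw [Finset.coe_insert, Set.injOn_insert (fun h' => hne _ h' rfl)]
    refine ⟨fun e h e' h' hee => ?_, ?_⟩
    · rw [Function.update_of_ne (hne e h), Function.update_of_ne (hne e' h')] at hee
      exact hf.injOn h h' hee
    · rintro ⟨e, h, hee⟩
      rw [Function.update_of_ne (hne e h), Function.update_self] at hee
      exact hS e h (hee ▸ hf.mem e h)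

/-- `z` is a descendant of `y` for the orientation `f` of `S`. -/
def IsDescendant (S : Finset (Sym2 V)) (f : Sym2 V → V) (y z : V) : Prop :=
  Relation.ReflTransGen (fun u v => s(u, v) ∈ S ∧ f s(u, v) = v) y z

theorem IsDescendant.mono {S S' : Finset (Sym2 V)} {f : Sym2 V → V} {y z : V}
    (h : IsDescendant S f y z) (hS : S ⊆ S') : IsDescendant S' f y z :=
  Relation.ReflTransGen.mono (fun _ _ h => ⟨hS h.1, h.2⟩) y z h

theorem IsDescendant.notMem_roots {R : Finset V} {S : Finset (Sym2 V)} {f : Sym2 V → V}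
    (hf : IsOrientation R S f) {y z : V} (hy : y ∉ R) (h : IsDescendant S f y z) : z ∉ R := by
  cases h with
  | refl => exact hy
  | tail _ h2 => exact h2.2 ▸ hf.notMem_roots _ h2.1

/-- A walk which avoids the roots and starts from a child `y` of a root stays among the descendants
of `y`. -/
theorem IsDescendant.step {R : Finset V} {S : Finset (Sym2 V)} {f : Sym2 V → V}
    (hf : IsOrientation R S f) {x y z w : V} (hx : x ∈ R) (hxy : s(x, y) ∈ S)
    (h : IsDescendant S f y z) (hzw : s(z, w) ∈ S) (hw : w ∉ R) : IsDescendant S f y w := by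
  rcases Sym2.mem_iff.1 (hf.mem _ hzw) with h1 | h1
  · cases h with
    | refl =>
      have h2 := hf.injOn hzw hxy (h1.trans (hf.apply_eq_right hx hxy).symm)
      rcases Sym2.eq_iff.1 h2 with ⟨h3, h4⟩ | ⟨h3, h4⟩
      · exact h4 ▸ Relation.ReflTransGen.refl
      · exact absurd (h4 ▸ hx) hw
    | tail h3 h4 =>
      have h2 := hf.injOn hzw h4.1 (h1.trans h4.2.symm)
      rcases Sym2.eq_iff.1 h2 with ⟨h5, h6⟩ | ⟨h5, h6⟩
      · rw [h6]; exact Relation.ReflTransGen.tail h3 h4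
      · exact h6 ▸ h3
  · exact Relation.ReflTransGen.tail h ⟨hzw, h1⟩

/-- A descendant `z` of the child `y` of the root `x` is joined to a root only if `z = y` and the
root is `x`. -/
theorem IsDescendant.eq_of_mem_roots {R : Finset V} {S : Finset (Sym2 V)} {f : Sym2 V → V}
    (hf : IsOrientation R S f) {x y z w : V} (hx : x ∈ R) (hy : y ∉ R) (hxy : s(x, y) ∈ S)
    (h : IsDescendant S f y z) (hzw : s(z, w) ∈ S) (hw : w ∈ R) : z = y ∧ w = x := by
  have hz := h.notMem_roots hf hy
  have h1 : f s(z, w) = z := by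
    rw [Sym2.eq_swap] at hzw ⊢
    exact hf.apply_eq_right hw hzw
  cases h with
  | refl =>
    have h2 := hf.injOn hzw hxy (h1.trans (hf.apply_eq_right hx hxy).symm)
    rcases Sym2.eq_iff.1 h2 with ⟨h3, h4⟩ | ⟨h3, h4⟩
    · exact absurd (h3 ▸ hx) hy
    · exact ⟨rfl, h4⟩
  | tail h3 h4 =>
    have h2 := hf.injOn hzw h4.1 (h1.trans h4.2.symm)
    rcases Sym2.eq_iff.1 h2 with ⟨h5, h6⟩ | ⟨h5, h6⟩
    · exact absurd (h6 ▸ hw) hz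
    · exact absurd (h6 ▸ hw) (IsDescendant.notMem_roots hf hy h3)

end Forest

/-! ### Polynomials in the edge variables -/

section EdgePoly

open MvPolynomial

variable {V : Type*}

/-- Polynomials in one variable for each (possible) edge. A monomial records how often a walk, or a
family of walks, uses each edge. -/
abbrev EdgePoly (V : Type*) := MvPolynomial (Sym2 V) ℝ

/-- The linear functional with prescribed values on the monomials. -/
noncomputable def monomialFunctional (φ : (Sym2 V →₀ ℕ) → ℝ) : EdgePoly V →ₗ[ℝ] ℝ :=
  (basisMonomials (Sym2 V) ℝ).constr ℝ φ

theorem monomialFunctional_monomial (φ : (Sym2 V →₀ ℕ) → ℝ) (μ : Sym2 V →₀ ℕ) (c : ℝ) :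
    monomialFunctional φ (monomial μ c) = c * φ μ := by
  have h : monomial μ c = c • (basisMonomials (Sym2 V) ℝ) μ := by
    rw [coe_basisMonomials, smul_monomial, smul_eq_mul, mul_one]
  rw [h, map_smul, monomialFunctional, Module.Basis.constr_basis, smul_eq_mul]

/-- The expectation of the monomial `∏ (a_e d_e) ^ μ_e`, if `d_e` is a Bernoulli variable with
parameter `q` and `X` is the sequence of moments of `a_e`. -/
noncomputable def edgeWeight (q : ℝ) (X : ℕ → ℝ) (μ : Sym2 V →₀ ℕ) : ℝ :=
  ∏ e ∈ μ.support, q * X (μ e)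

/-- The expectation functional. -/
noncomputable def edgeExp (q : ℝ) (X : ℕ → ℝ) : EdgePoly V →ₗ[ℝ] ℝ :=
  monomialFunctional (edgeWeight q X)

open Classical in
/-- The expectation functional, restricted to the monomials whose edges form a forest with
roots `R`. -/
noncomputable def forestExp (q : ℝ) (X : ℕ → ℝ) (R : Finset V) : EdgePoly V →ₗ[ℝ] ℝ :=
  monomialFunctional fun μ => if IsRootedForest R μ.support then edgeWeight q X μ else 0

/-- The ideal spanned by the monomials whose edges do not form a forest with roots `R`. -/
noncomputable def cycleIdeal (R : Finset V) : Ideal (EdgePoly V) :=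
  Ideal.span ((fun μ => monomial μ (1 : ℝ)) '' {μ | ¬ IsRootedForest R μ.support})

theorem monomial_mem_cycleIdeal {R : Finset V} {μ : Sym2 V →₀ ℕ}
    (h : ¬ IsRootedForest R μ.support) (c : ℝ) : monomial μ c ∈ cycleIdeal R := by
  have : monomial μ c = C c * monomial μ 1 := by rw [C_mul_monomial, mul_one]
  rw [this]
  exact Ideal.mul_mem_left _ _ (Ideal.subset_span ⟨μ, h, rfl⟩)

theorem X_mem_cycleIdeal {R : Finset V} {x y : V} (hx : x ∈ R) (hy : y ∈ R) :
    (X s(x, y) : EdgePoly V) ∈ cycleIdeal R :=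
  monomial_mem_cycleIdeal (not_isRootedForest_of_mem hx hy (by simp)) 1

theorem cycleIdeal_mono {R R' : Finset V} (h : R ⊆ R') : cycleIdeal R ≤ cycleIdeal R' := by
  refine Ideal.span_le.2 ?_
  rintro _ ⟨μ, hμ, rfl⟩
  exact monomial_mem_cycleIdeal (fun h' => hμ (h'.anti h subset_rfl)) 1

theorem forestExp_eq_zero_of_mem (q : ℝ) (X : ℕ → ℝ) {R : Finset V} {P : EdgePoly V}
    (hP : P ∈ cycleIdeal R) : forestExp q X R P = 0 := by
  classical
  suffices h : ∀ Q : EdgePoly V, forestExp q X R (Q * P) = 0 by simpa using h 1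
  refine Submodule.span_induction (p := fun P _ => ∀ Q : EdgePoly V, forestExp q X R (Q * P) = 0)
    ?_ (by simp) (fun a b _ _ ha hb Q => by rw [mul_add, map_add, ha, hb, add_zero])
    (fun a b _ hb Q => by rw [smul_eq_mul, ← mul_assoc]; exact hb _) hP
  rintro _ ⟨μ, hμ, rfl⟩ Q
  induction Q using MvPolynomial.induction_on' with
  | monomial ν c =>
    rw [monomial_mul, forestExp, monomialFunctional_monomial, if_neg, mul_zero]
    exact fun h => hμ (h.anti subset_rfl (Finsupp.support_mono le_add_self))
  | add a b ha hb => rw [add_mul, map_add, ha, hb, add_zero]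

theorem forestExp_congr (q : ℝ) (X : ℕ → ℝ) {R : Finset V} {P Q : EdgePoly V}
    (h : Ideal.Quotient.mk (cycleIdeal R) P = Ideal.Quotient.mk (cycleIdeal R) Q) :
    forestExp q X R P = forestExp q X R Q := by
  rw [← sub_eq_zero, ← map_sub]
  exact forestExp_eq_zero_of_mem q X (Ideal.Quotient.eq.1 h)

theorem forestExp_one (q : ℝ) (X : ℕ → ℝ) [Nonempty V] (R : Finset V) :
    forestExp q X R 1 = 1 := by
  rw [show (1 : EdgePoly V) = monomial 0 1 from rfl, forestExp, monomialFunctional_monomial,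
    if_pos (by simpa using isRootedForest_empty R)]
  simp [edgeWeight]

/-- The edge from the root `x` to the vertex `y` is independent of the rest, in which `y` becomes a
root. -/
theorem forestExp_X_pow_mul [DecidableEq V] (q : ℝ) (X' : ℕ → ℝ) {R : Finset V} {x y : V}
    (hx : x ∈ R) (hy : y ∉ R) {k : ℕ} (hk : k ≠ 0) {P : EdgePoly V}
    (hP : P ∈ supported ℝ ({s(x, y)}ᶜ : Set (Sym2 V))) :
    forestExp q X' R (X s(x, y) ^ k * P) = q * X' k * forestExp q X' (insert y R) P := by
  classical
  rw [P.as_sum, Finset.mul_sum, map_sum, map_sum, Finset.mul_sum]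
  refine Finset.sum_congr rfl fun μ hμ => ?_
  have he : s(x, y) ∉ μ.support := by
    intro h
    have h1 : s(x, y) ∈ P.vars := (mem_vars_iff_mem_support _).2 ⟨μ, hμ, h⟩
    have h2 := mem_supported.1 hP h1
    simp at h2
  rw [X_pow_eq_monomial, monomial_mul, forestExp, forestExp, monomialFunctional_monomial,
    monomialFunctional_monomial, one_mul]
  have hsupp : (Finsupp.single s(x, y) k + μ).support = insert s(x, y) μ.support := by
    rw [Finsupp.support_add_eq, Finsupp.support_single _ hk]
    · rfl
    · rw [Finsupp.support_single _ hk]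
      exact Finset.disjoint_singleton_left.2 he
  have hw : edgeWeight q X' (Finsupp.single s(x, y) k + μ) = q * X' k * edgeWeight q X' μ := by
    rw [edgeWeight, hsupp, Finset.prod_insert he, edgeWeight]
    congr 1
    · simp [Finsupp.notMem_support_iff.1 he]
    · refine Finset.prod_congr rfl fun e h => ?_
      have : e ≠ s(x, y) := fun h' => he (h' ▸ h)
      simp [this.symm]
  rw [hsupp, isRootedForest_insert_iff hx hy he, hw]
  split_ifs <;> ring

end EdgePoly

/-! ### Formal power series -/

section PowerSeries

open PowerSeries

/-- The powers of the geometric series `G = 1 / (1 - Z)`. -/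
theorem coeff_pow_of_eq_one_add_mul {A : Type*} [CommRing A] {Z G : A⟦X⟧}
    (hZ : X ∣ Z) (hG : G = 1 + Z * G) (f b : ℕ) :
    coeff b (G ^ (f + 1)) = ∑ v ∈ Finset.range (b + 1), ((f + v).choose f : A) * coeff b (Z ^ v) := by
  have hG1 : (1 - Z) * G = 1 := by linear_combination hG
  -- modulo `X ^ B`, by induction on `f`: multiplication by `1 - Z` lowers `f`, by Pascal's rule
  have key : ∀ f B : ℕ, (X : A⟦X⟧) ^ B ∣
      G ^ (f + 1) - ∑ v ∈ Finset.range B, ((f + v).choose f : A⟦X⟧) * Z ^ v := by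
    intro f B
    have hZB : (X : A⟦X⟧) ^ B ∣ Z ^ B := pow_dvd_pow_of_dvd hZ B
    induction f with
    | zero =>
      have h1 : (1 - Z) * ∑ v ∈ Finset.range B, Z ^ v = 1 - Z ^ B := mul_neg_geom_sum Z B
      have h2 : G ^ (0 + 1) - ∑ v ∈ Finset.range B, ((0 + v).choose 0 : A⟦X⟧) * Z ^ v
          = Z ^ B * G := by
        simp only [zero_add, pow_one, Nat.choose_zero_right, Nat.cast_one, one_mul]
        linear_combination (∑ v ∈ Finset.range B, Z ^ v) * hG1 - G * h1
      rw [h2]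
      exact hZB.mul_right _
    | succ f ih =>
      have h1 : ∀ B : ℕ, (1 - Z) * ∑ v ∈ Finset.range B, ((f + 1 + v).choose (f + 1) : A⟦X⟧) * Z ^ v
          = ∑ v ∈ Finset.range B, ((f + v).choose f : A⟦X⟧) * Z ^ v
            - ((f + B).choose (f + 1) : A⟦X⟧) * Z ^ B := by
        intro B
        induction B with
        | zero => simp
        | succ B ihB =>
          rw [Finset.sum_range_succ, Finset.sum_range_succ, mul_add, ihB]
          have h3 : (f + 1 + B).choose (f + 1) = (f + B).choose f + (f + B).choose (f + 1) := by
            rw [show f + 1 + B = (f + B) + 1 by omega, Nat.choose_succ_succ]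
          rw [show f + (B + 1) = f + 1 + B by omega, h3]
          push_cast
          ring
      set T := ∑ v ∈ Finset.range B, ((f + 1 + v).choose (f + 1) : A⟦X⟧) * Z ^ v with hT
      set T' := ∑ v ∈ Finset.range B, ((f + v).choose f : A⟦X⟧) * Z ^ v with hT'
      have h2 : G ^ (f + 1 + 1) - T
          = G * ((G ^ (f + 1) - T') + ((f + B).choose (f + 1) : A⟦X⟧) * Z ^ B) := by
        linear_combination T * hG1 - G * h1 B
      rw [h2]
      exact (dvd_add ih (hZB.mul_left _)).mul_left _
  have h := X_pow_dvd_iff.1 (key f (b + 1)) b (Nat.lt_succ_self b)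
  rw [map_sub, sub_eq_zero, map_sum] at h
  rw [h]
  refine Finset.sum_congr rfl fun v _ => ?_
  rw [← nsmul_eq_mul, map_nsmul, nsmul_eq_mul]

/-- Expansion of a power of a sum according to the first factor and to the number of the other
factors in which the same term is chosen. -/
theorem sum_pow_succ_eq {ι A : Type*} [DecidableEq ι] [CommSemiring A] (T : Finset ι) (ξ : ι → A)
    (n : ℕ) : (∑ y ∈ T, ξ y) ^ (n + 1) = ∑ y ∈ T, ∑ j ∈ Finset.range (n + 1),
      (n.choose j : A) * (ξ y ^ (j + 1) * (∑ z ∈ T.erase y, ξ z) ^ (n - j)) := by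
  rw [pow_succ', Finset.sum_mul]
  refine Finset.sum_congr rfl fun y hy => ?_
  rw [← Finset.add_sum_erase T ξ hy, add_pow, Finset.mul_sum]
  refine Finset.sum_congr rfl fun j _ => ?_
  ring

end PowerSeries

/-! ### Closed walks from the roots of a forest -/

section Walks

open MvPolynomial

variable {V : Type*} [DecidableEq V] (c : V → Bool)

/-- The adjacency matrix, over the edge variables, of the complete bipartite graph with colour
classes given by `c`, after deletion of the vertices of `U`. -/
noncomputable def genMatrix (U : Finset V) : Matrix V V (EdgePoly V) := fun x y =>
  if c x ≠ c y ∧ x ∉ U ∧ y ∉ U then X s(x, y) else 0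

variable {c}

theorem genMatrix_of_mem_left {U : Finset V} {x y : V} (h : x ∈ U) : genMatrix c U x y = 0 :=
  if_neg fun h' => h'.2.1 h

theorem genMatrix_of_mem_right {U : Finset V} {x y : V} (h : y ∈ U) : genMatrix c U x y = 0 :=
  if_neg fun h' => h'.2.2 h

theorem genMatrix_of_notMem {U U' : Finset V} {x y : V} (hx : x ∉ U) (hy : y ∉ U) (hx' : x ∉ U')
    (hy' : y ∉ U') : genMatrix c U x y = genMatrix c U' x y := by
  simp [genMatrix, hx, hy, hx', hy']

theorem genMatrix_empty (x y : V) :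
    genMatrix c ∅ x y = if c x ≠ c y then X s(x, y) else 0 := by
  simp [genMatrix]

theorem genMatrix_empty_symm (x y : V) : genMatrix c ∅ x y = genMatrix c ∅ y x := by
  rw [genMatrix_empty, genMatrix_empty, Sym2.eq_swap]
  simp [ne_comm]

theorem genMatrix_self (U : Finset V) (x : V) : genMatrix c U x x = 0 := by
  simp [genMatrix]

/-- Modulo the monomials with a cycle, the edge variables between two roots vanish. -/
theorem mk_genMatrix_eq_zero {R : Finset V} {x y : V} (hx : x ∈ R) (hy : y ∈ R) :
    Ideal.Quotient.mk (cycleIdeal R) (genMatrix c ∅ x y) = 0 := by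
  rw [genMatrix_empty]
  split_ifs
  · exact Ideal.Quotient.eq_zero_iff_mem.2 (X_mem_cycleIdeal hx hy)
  · exact map_zero _

variable [Fintype V]

/-- The decomposition of a walk from `z` to `y` which avoids `U` at its first visit to `y`: `w` is the
vertex before this visit, and the rest is a closed walk at `y`. -/
theorem genMatrix_pow_succ_apply {U : Finset V} {y : V} (hy : y ∉ U) (n : ℕ) {z : V}
    (hz : z ∉ insert y U) : (genMatrix c U ^ (n + 1)) z y =
      ∑ km ∈ Finset.HasAntidiagonal.antidiagonal n, ∑ w ∈ (insert y U)ᶜ,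
        (genMatrix c (insert y U) ^ km.1) z w * genMatrix c ∅ w y * (genMatrix c U ^ km.2) y y := by
  have hD0 : ∀ {z : V}, z ∉ insert y U → ∀ F : V → EdgePoly V,
      ∑ w ∈ (insert y U)ᶜ, (genMatrix c (insert y U) ^ 0) z w * F w = F z := by
    intro z hz F
    rw [Finset.sum_eq_single z]
    · simp
    · intro w _ hw; simp [hw.symm]
    · intro h; exact absurd (Finset.mem_compl.2 hz) h
  induction n generalizing z with
  | zero =>
    simp only [Finset.Nat.antidiagonal_zero, Finset.sum_singleton]
    simp_rw [mul_assoc]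
    rw [hD0 hz]
    have hz' : z ∉ U := fun h => hz (Finset.mem_insert_of_mem h)
    simp [genMatrix_of_notMem hz' hy (Finset.notMem_empty z) (Finset.notMem_empty y)]
  | succ n ih =>
    have hz' : z ∉ U := fun h => hz (Finset.mem_insert_of_mem h)
    have h1 : (genMatrix c U ^ (n + 1 + 1)) z y
        = genMatrix c ∅ z y * (genMatrix c U ^ (n + 1)) y y +
          ∑ w ∈ (insert y U)ᶜ, genMatrix c (insert y U) z w * (genMatrix c U ^ (n + 1)) w y := by
      rw [pow_succ' _ (n + 1), Matrix.mul_apply,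
        ← Finset.sum_add_sum_compl (insert y U), Finset.sum_insert hy]
      congr 1
      · rw [Finset.sum_eq_zero (s := U), add_zero,
          genMatrix_of_notMem hz' hy (Finset.notMem_empty z) (Finset.notMem_empty y)]
        intro w hw
        rw [genMatrix_of_mem_right hw, zero_mul]
      · refine Finset.sum_congr rfl fun w hw => ?_
        have hw' := Finset.mem_compl.1 hw
        rw [genMatrix_of_notMem hz' (fun h => hw' (Finset.mem_insert_of_mem h)) hz hw']
    rw [h1, Finset.Nat.antidiagonal_succ, Finset.sum_cons]
    congr 1
    · simp_rw [mul_assoc]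
      rw [hD0 hz]
    · rw [Finset.sum_map]
      have h2 : ∀ w ∈ (insert y U)ᶜ,
          genMatrix c (insert y U) z w * (genMatrix c U ^ (n + 1)) w y =
          ∑ km ∈ Finset.HasAntidiagonal.antidiagonal n, ∑ w' ∈ (insert y U)ᶜ, genMatrix c (insert y U) z w *
            ((genMatrix c (insert y U) ^ km.1) w w' * genMatrix c ∅ w' y *
              (genMatrix c U ^ km.2) y y) := by
        intro w hw
        rw [ih (Finset.mem_compl.1 hw), Finset.mul_sum]
        simp_rw [Finset.mul_sum]
      rw [Finset.sum_congr rfl h2, Finset.sum_comm]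
      refine Finset.sum_congr rfl fun km _ => ?_
      rw [Finset.sum_comm]
      refine Finset.sum_congr rfl fun w' _ => ?_
      simp only [Function.Embedding.prodMap, Function.Embedding.coeFn_mk, Prod.map,
        Function.Embedding.refl_apply]
      rw [Nat.succ_eq_add_one, pow_succ', Matrix.mul_apply,
        ← Finset.sum_add_sum_compl (insert y U),
        Finset.sum_eq_zero (s := insert y U), zero_add, Finset.sum_mul, Finset.sum_mul]
      · refine Finset.sum_congr rfl fun w _ => ?_
        ring
      · intro w hw
        rw [genMatrix_of_mem_right hw, zero_mul]

variable (c)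

/-- The generating function of the closed walks at `y` which avoid `U`. -/
noncomputable def walkSeries (U : Finset V) (y : V) : PowerSeries (EdgePoly V) :=
  PowerSeries.mk fun n => (genMatrix c U ^ n) y y

/-- The generating function of the excursions from the root `x`, outside of the set `R ∋ x` of
roots, which begin with the step from `x` to `y` and end with the reverse of this step. -/
noncomputable def childSeries (R : Finset V) (x y : V) : PowerSeries (EdgePoly V) :=
  PowerSeries.X ^ 2 * (PowerSeries.C (genMatrix c ∅ x y) ^ 2 * walkSeries c R y)

/-- The generating function of the excursions from the root `x`, outside of the set `R ∋ x` of
roots, which end with the reverse of their first step. -/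
noncomputable def excursionSeries (R : Finset V) (x : V) : PowerSeries (EdgePoly V) :=
  ∑ y ∈ Rᶜ, childSeries c R x y

variable {c}

theorem coeff_walkSeries (U : Finset V) (y : V) (n : ℕ) :
    PowerSeries.coeff n (walkSeries c U y) = (genMatrix c U ^ n) y y := by
  rw [walkSeries, PowerSeries.coeff_mk]

theorem X_dvd_excursionSeries (R : Finset V) (x : V) :
    PowerSeries.X ∣ excursionSeries c R x :=
  Finset.dvd_sum fun _ _ => Dvd.dvd.mul_right (dvd_pow_self _ two_ne_zero) _

/-- For a walk from a child `y` of the root `x`, whose edges belong to a forest, the only way back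
to the roots is the step from `y` to `x`. -/
theorem X_mul_genMatrix_pow_mul_X_mem {R : Finset V} {x y z w : V} (hx : x ∈ R) (hy : y ∉ R)
    (hw : w ∈ R) (hne : ¬ (z = y ∧ w = x)) (n : ℕ) :
    X s(x, y) * (genMatrix c R ^ n) y z * X s(z, w) ∈ cycleIdeal R := by
  classical
  -- `W z` is spanned by the monomials which contain the edge from `x` to `y` and in which `z` is a
  -- descendant of `y` for every orientation
  let W : V → Submodule ℝ (EdgePoly V) := fun z => Submodule.span ℝ
    ((fun μ => monomial μ (1 : ℝ)) '' {μ | s(x, y) ∈ μ.support ∧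
      ∀ f, IsOrientation R μ.support f → IsDescendant μ.support f y z})
  have hmul : ∀ (z z' : V), z' ∉ R → ∀ P ∈ W z, P * X s(z, z') ∈ W z' := by
    intro z z' hz' P hP
    refine Submodule.span_induction (p := fun P _ => P * X s(z, z') ∈ W z') ?_ (by simp)
      (fun a b _ _ ha hb => by rw [add_mul]; exact add_mem ha hb)
      (fun a b _ hb => by rw [smul_mul_assoc]; exact Submodule.smul_mem _ _ hb) hP
    rintro _ ⟨μ, ⟨hμ1, hμ2⟩, rfl⟩
    have hle : μ.support ⊆ (μ + Finsupp.single s(z, z') 1).support :=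
      Finsupp.support_mono le_self_add
    have hmem : s(z, z') ∈ (μ + Finsupp.single s(z, z') 1).support := by
      simp [Finsupp.mem_support_iff]
    rw [X, monomial_mul, one_mul]
    refine Submodule.subset_span ⟨_, ⟨hle hμ1, fun f hf => ?_⟩, rfl⟩
    have := (hμ2 f (hf.anti subset_rfl hle)).mono hle
    exact this.step hf hx (hle hμ1) hmem hz'
  have hpow : ∀ (n : ℕ) (z : V), X s(x, y) * (genMatrix c R ^ n) y z ∈ W z := by
    intro n
    induction n with
    | zero =>
      intro z
      rw [pow_zero, Matrix.one_apply]
      split_ifs with h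
      · subst h
        rw [mul_one, X]
        exact Submodule.subset_span ⟨_, ⟨by simp, fun f _ => Relation.ReflTransGen.refl⟩, rfl⟩
      · simp
    | succ n ih =>
      intro z
      rw [pow_succ, Matrix.mul_apply, Finset.mul_sum]
      refine Submodule.sum_mem _ fun u _ => ?_
      rw [← mul_assoc]
      by_cases h : c u ≠ c z ∧ u ∉ R ∧ z ∉ R
      · rw [show genMatrix c R u z = X s(u, z) from if_pos h]
        exact hmul u z h.2.2 _ (ih u)
      · rw [show genMatrix c R u z = 0 from if_neg h, mul_zero]
        exact Submodule.zero_mem _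
  have hle : ∀ P ∈ W z, P * X s(z, w) ∈ cycleIdeal R := by
    intro P hP
    refine Submodule.span_induction (p := fun P _ => P * X s(z, w) ∈ cycleIdeal R) ?_ (by simp)
      (fun a b _ _ ha hb => by rw [add_mul]; exact add_mem ha hb)
      (fun a b _ hb => by
        rw [smul_mul_assoc, smul_eq_C_mul]; exact Ideal.mul_mem_left _ _ hb) hP
    rintro _ ⟨μ, ⟨hμ1, hμ2⟩, rfl⟩
    have hle : μ.support ⊆ (μ + Finsupp.single s(z, w) 1).support :=
      Finsupp.support_mono le_self_add
    have hmem : s(z, w) ∈ (μ + Finsupp.single s(z, w) 1).support := by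
      simp [Finsupp.mem_support_iff]
    rw [X, monomial_mul, one_mul]
    refine monomial_mem_cycleIdeal ?_ 1
    rintro ⟨f, hf⟩
    have := (hμ2 f (hf.anti subset_rfl hle)).mono hle
    exact hne (this.eq_of_mem_roots hf hx hy (hle hμ1) hmem hw)
  exact hle _ (hpow n z)

/-- Modulo the monomials with a cycle, an additional root `y` may be deleted from the walks which
start from a child of another root. -/
theorem mk_X_mul_genMatrix_pow {R : Finset V} {x y w : V} (hx : x ∈ R) (hy : y ∉ R)
    (hw : w ∉ insert y R) (n : ℕ) (z : V) :
    Ideal.Quotient.mk (cycleIdeal (insert y R)) (X s(x, w) * (genMatrix c R ^ n) w z) =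
      if z = y then 0 else
        Ideal.Quotient.mk (cycleIdeal (insert y R))
          (X s(x, w) * (genMatrix c (insert y R) ^ n) w z) := by
  induction n generalizing z with
  | zero =>
    split_ifs with h
    · have : w ≠ z := fun h' => hw (by rw [h', h]; exact Finset.mem_insert_self _ _)
      simp [this]
    · simp
  | succ n ih =>
    have hexp : ∀ (U : Finset V), Ideal.Quotient.mk (cycleIdeal (insert y R))
        (X s(x, w) * (genMatrix c U ^ (n + 1)) w z) =
        ∑ u, Ideal.Quotient.mk (cycleIdeal (insert y R)) (X s(x, w) * (genMatrix c U ^ n) w u) *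
          Ideal.Quotient.mk (cycleIdeal (insert y R)) (genMatrix c U u z) := by
      intro U
      rw [pow_succ, Matrix.mul_apply, Finset.mul_sum, map_sum]
      refine Finset.sum_congr rfl fun u _ => ?_
      rw [← map_mul, mul_assoc]
    rw [hexp, hexp]
    split_ifs with h
    · subst h
      refine Finset.sum_eq_zero fun u _ => ?_
      rw [ih]
      split_ifs with hu
      · rw [zero_mul]
      · by_cases hM : c u ≠ c z ∧ u ∉ R ∧ z ∉ R
        · rw [show genMatrix c R u z = X s(u, z) from if_pos hM, ← map_mul,
            Ideal.Quotient.eq_zero_iff_mem]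
          refine X_mul_genMatrix_pow_mul_X_mem (Finset.mem_insert_of_mem hx) hw
            (Finset.mem_insert_self _ _) ?_ n
          rintro ⟨-, h2⟩
          exact hy (h2 ▸ hx)
        · rw [show genMatrix c R u z = 0 from if_neg hM, map_zero, mul_zero]
    · refine Finset.sum_congr rfl fun u _ => ?_
      rw [ih]
      split_ifs with hu
      · rw [zero_mul, genMatrix_of_mem_left (hu ▸ Finset.mem_insert_self _ _), map_zero, mul_zero]
      · congr 2
        simp [genMatrix, hu, h]

/-- Modulo the monomials with a cycle, the excursions from a root do not see an additional root. -/
theorem map_excursionSeries_insert {R : Finset V} {x y : V} (hx : x ∈ R) (hy : y ∉ R) :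
    PowerSeries.map (Ideal.Quotient.mk (cycleIdeal (insert y R)))
        (∑ w ∈ Rᶜ.erase y, childSeries c R x w) =
      PowerSeries.map (Ideal.Quotient.mk (cycleIdeal (insert y R)))
        (excursionSeries c (insert y R) x) := by
  have hset : Rᶜ.erase y = (insert y R)ᶜ := by
    rw [Finset.compl_insert]
  rw [excursionSeries, hset, map_sum, map_sum]
  refine Finset.sum_congr rfl fun w hw => ?_
  have hw' := Finset.mem_compl.1 hw
  simp only [childSeries, map_mul, map_pow, PowerSeries.map_X, PowerSeries.map_C]
  congr 1
  rw [sq, mul_assoc, mul_assoc]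
  congr 1
  ext n
  rw [PowerSeries.coeff_C_mul, PowerSeries.coeff_C_mul, PowerSeries.coeff_map,
    PowerSeries.coeff_map, coeff_walkSeries, coeff_walkSeries, genMatrix_empty]
  split_ifs with h
  · rw [← map_mul, ← map_mul, mk_X_mul_genMatrix_pow hx hy hw', if_neg]
    exact fun h' => hw' (h' ▸ Finset.mem_insert_self _ _)
  · simp

/-- An additional root `y` removes the excursions through `y`, and these contain an edge between two
roots. -/
theorem map_excursionSeries {R : Finset V} {x y : V} (hx : x ∈ R) (hy : y ∉ R) :
    PowerSeries.map (Ideal.Quotient.mk (cycleIdeal (insert y R))) (excursionSeries c R x) =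
      PowerSeries.map (Ideal.Quotient.mk (cycleIdeal (insert y R)))
        (excursionSeries c (insert y R) x) := by
  rw [← map_excursionSeries_insert hx hy, excursionSeries,
    ← Finset.add_sum_erase _ _ (Finset.mem_compl.2 hy), map_add]
  simp only [childSeries, map_mul, map_pow, PowerSeries.map_C,
    mk_genMatrix_eq_zero (Finset.mem_insert_of_mem hx) (Finset.mem_insert_self y R)]
  simp

/-- Modulo the monomials with a cycle, a closed walk is a sequence of excursions each of which ends
with the reverse of its first step. -/
theorem map_walkSeries {U : Finset V} {y : V} (hy : y ∉ U) :
    PowerSeries.map (Ideal.Quotient.mk (cycleIdeal (insert y U))) (walkSeries c U y) =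
      1 + PowerSeries.map (Ideal.Quotient.mk (cycleIdeal (insert y U)))
          (excursionSeries c (insert y U) y) *
        PowerSeries.map (Ideal.Quotient.mk (cycleIdeal (insert y U))) (walkSeries c U y) := by
  ext n
  rw [← map_mul, map_add, PowerSeries.coeff_map, PowerSeries.coeff_map, coeff_walkSeries]
  have hy' : y ∈ insert y U := Finset.mem_insert_self _ _
  have hX : excursionSeries c (insert y U) y * walkSeries c U y = PowerSeries.X ^ 2 *
      ((∑ z ∈ (insert y U)ᶜ, PowerSeries.C (genMatrix c ∅ y z) ^ 2 *
        walkSeries c (insert y U) z) * walkSeries c U y) := by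
    simp only [excursionSeries, childSeries]
    rw [← Finset.mul_sum, mul_assoc]
  rw [hX]
  rcases n with _ | _ | n
  · simp [pow_succ, mul_assoc]
  · rw [zero_add, pow_one, genMatrix_self, PowerSeries.coeff_X_pow_mul']
    simp [PowerSeries.coeff_one]
  · rw [PowerSeries.coeff_one, if_neg (by omega), zero_add, PowerSeries.coeff_X_pow_mul',
      if_pos (by omega), show n + 1 + 1 - 2 = n by omega,
      PowerSeries.coeff_mul, pow_succ' _ (n + 1), Matrix.mul_apply,
      ← Finset.sum_add_sum_compl (insert y U), Finset.sum_eq_zero (s := insert y U), zero_add]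
    · have h1 : ∀ z ∈ (insert y U)ᶜ, genMatrix c U y z * (genMatrix c U ^ (n + 1)) z y =
          ∑ km ∈ Finset.HasAntidiagonal.antidiagonal n, ∑ w ∈ (insert y U)ᶜ, genMatrix c ∅ y z *
            ((genMatrix c (insert y U) ^ km.1) z w * genMatrix c ∅ w y *
              (genMatrix c U ^ km.2) y y) := by
        intro z hz
        have hz' := Finset.mem_compl.1 hz
        rw [genMatrix_pow_succ_apply hy n hz', Finset.mul_sum,
          genMatrix_of_notMem hy (fun h => hz' (Finset.mem_insert_of_mem h))
            (Finset.notMem_empty y) (Finset.notMem_empty z)]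
        simp_rw [Finset.mul_sum]
      rw [Finset.sum_congr rfl h1, Finset.sum_comm, map_sum, map_sum]
      refine Finset.sum_congr rfl fun km _ => ?_
      rw [coeff_walkSeries, map_sum, map_sum, Finset.sum_mul, map_sum]
      refine Finset.sum_congr rfl fun z hz => ?_
      have hz' := Finset.mem_compl.1 hz
      rw [← map_pow, PowerSeries.coeff_C_mul, coeff_walkSeries, map_sum,
        Finset.sum_eq_single z]
      · congr 1
        rw [genMatrix_empty_symm z y]
        ring
      · -- an excursion which leaves through `z` and returns through `w ≠ z` closes a cycle
        intro w hw hwz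
        rw [genMatrix_empty, genMatrix_empty]
        split_ifs with h2 h3
        · have h4 : (X s(y, z) * ((genMatrix c (insert y U) ^ km.1) z w * X s(w, y) *
              (genMatrix c U ^ km.2) y y) : EdgePoly V) = (genMatrix c U ^ km.2) y y *
              (X s(y, z) * (genMatrix c (insert y U) ^ km.1) z w * X s(w, y)) := by ring
          rw [h4, Ideal.Quotient.eq_zero_iff_mem]
          refine Ideal.mul_mem_left _ _ (X_mul_genMatrix_pow_mul_X_mem hy' hz' hy' ?_ _)
          exact fun h5 => hwz h5.1
        all_goals simp
      · intro h; exact absurd hz h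
    · intro z hz
      rcases Finset.mem_insert.1 hz with rfl | hz
      · rw [genMatrix_self, zero_mul]
      · rw [genMatrix_of_mem_right hz, zero_mul]

end Walks

/-! ### The recurrence for the forest moments -/

section Recurrence

open MvPolynomial

theorem PowerSeries.coeff_mul_mem {A : Type*} [CommRing A] [Algebra ℝ A] (S : Subalgebra ℝ A)
    {F G : PowerSeries A} (hF : ∀ n, PowerSeries.coeff n F ∈ S)
    (hG : ∀ n, PowerSeries.coeff n G ∈ S) (n : ℕ) : PowerSeries.coeff n (F * G) ∈ S := by
  rw [PowerSeries.coeff_mul]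
  exact sum_mem fun p _ => mul_mem (hF _) (hG _)

theorem PowerSeries.coeff_pow_mem {A : Type*} [CommRing A] [Algebra ℝ A] (S : Subalgebra ℝ A)
    {F : PowerSeries A} (hF : ∀ n, PowerSeries.coeff n F ∈ S) (k n : ℕ) :
    PowerSeries.coeff n (F ^ k) ∈ S := by
  induction k generalizing n with
  | zero =>
    rw [pow_zero, PowerSeries.coeff_one]
    split_ifs
    · exact one_mem _
    · exact zero_mem _
  | succ k ih => rw [pow_succ]; exact PowerSeries.coeff_mul_mem S ih hF n

variable {V : Type*} [Fintype V] [DecidableEq V] {c : V → Bool}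

theorem genMatrix_pow_mem_supported {R : Finset V} {x : V} (hx : x ∈ R) (y : V) (n : ℕ) (z w : V) :
    (genMatrix c R ^ n) z w ∈ supported ℝ ({s(x, y)}ᶜ : Set (Sym2 V)) := by
  induction n generalizing w with
  | zero =>
    rw [pow_zero, Matrix.one_apply]
    split_ifs
    · exact one_mem _
    · exact zero_mem _
  | succ n ih =>
    rw [pow_succ, Matrix.mul_apply]
    refine sum_mem fun u _ => mul_mem (ih u) ?_
    rw [genMatrix]
    split_ifs with h
    · refine (X_mem_supported (R := ℝ)).2 fun he => ?_
      rcases Sym2.eq_iff.1 (Set.mem_singleton_iff.1 he) with ⟨h1, -⟩ | ⟨-, h1⟩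
      · exact h.2.1 (h1 ▸ hx)
      · exact h.2.2 (h1 ▸ hx)
    · exact zero_mem _

/-- The series of the excursions from the root `x'` with the first step to `w` does not involve
any other edge at a root. -/
theorem coeff_excursion_mem_supported {R : Finset V} {x y x' w : V} (hx : x ∈ R)
    (hne : s(x', w) ≠ s(x, y)) (n : ℕ) :
    PowerSeries.coeff n (childSeries c R x' w) ∈ supported ℝ ({s(x, y)}ᶜ : Set (Sym2 V)) := by
  refine PowerSeries.coeff_mul_mem _ (PowerSeries.coeff_pow_mem _ (fun k => ?_) _)
    (PowerSeries.coeff_mul_mem _ (PowerSeries.coeff_pow_mem _ (fun k => ?_) _) fun k => ?_) n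
  · rw [PowerSeries.coeff_X]
    split_ifs
    · exact one_mem _
    · exact zero_mem _
  · rw [PowerSeries.coeff_C]
    split_ifs
    · rw [genMatrix_empty]
      split_ifs
      · exact (X_mem_supported (R := ℝ)).2 hne
      · exact zero_mem _
    · exact zero_mem _
  · rw [coeff_walkSeries]
    exact genMatrix_pow_mem_supported hx y k w w

variable (c) in
/-- The expected number (weighted with the edge variables, and restricted to forests) of families
of closed walks in the graph of all edges between the colour classes, one at each root `x`, of length
`s x` and with `r x` departures from `x`. -/
noncomputable def forestMoment (q : ℝ) (X' : ℕ → ℝ) (R : Finset V) (s r : V → ℕ) : ℝ :=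
  forestExp q X' R (∏ x ∈ R, PowerSeries.coeff (s x) (excursionSeries c R x ^ r x))

theorem mk_coeff_pow_eq_of_map_eq {A B : Type*} [CommRing A] [CommRing B] (φ : A →+* B)
    {F G : PowerSeries A} (h : PowerSeries.map φ F = PowerSeries.map φ G) (k n : ℕ) :
    φ (PowerSeries.coeff n (F ^ k)) = φ (PowerSeries.coeff n (G ^ k)) := by
  rw [← PowerSeries.coeff_map, ← PowerSeries.coeff_map, map_pow (PowerSeries.map φ),
    map_pow (PowerSeries.map φ), h]

/-- The binomial coefficient is the number of ways to distribute the `v` excursions from `y` among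
`f + 1` closed walks at `y`. -/
theorem mk_coeff_walkSeries_pow {U : Finset V} {y : V} (hy : y ∉ U) (f b : ℕ) :
    Ideal.Quotient.mk (cycleIdeal (insert y U)) (PowerSeries.coeff b (walkSeries c U y ^ (f + 1))) =
      Ideal.Quotient.mk (cycleIdeal (insert y U)) (∑ v ∈ Finset.range (b + 1),
        ((f + v).choose f : EdgePoly V) *
          PowerSeries.coeff b (excursionSeries c (insert y U) y ^ v)) := by
  rw [← PowerSeries.coeff_map, map_pow,
    coeff_pow_of_eq_one_add_mul _ (map_walkSeries hy), map_sum]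
  · refine Finset.sum_congr rfl fun v _ => ?_
    rw [map_mul, map_natCast, ← map_pow, PowerSeries.coeff_map]
  · have := map_dvd (PowerSeries.map (Ideal.Quotient.mk (cycleIdeal (insert y U))))
      (X_dvd_excursionSeries (c := c) (insert y U) y)
    rwa [PowerSeries.map_X] at this

/-- After the edge from `x` to `y` has been split off, the remaining factors do not involve it. -/
theorem coeff_walkSeries_pow_mul_mem_supported {R : Finset V} {x y : V} (hx : x ∈ R)
    (s r : V → ℕ) (k m n : ℕ) :
    PowerSeries.coeff n (walkSeries c R y ^ k * (∑ w ∈ Rᶜ.erase y, childSeries c R x w) ^ m) *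
        ∏ x' ∈ R.erase x, PowerSeries.coeff (s x') (excursionSeries c R x' ^ r x') ∈
      supported ℝ ({s(x, y)}ᶜ : Set (Sym2 V)) := by
  have hedge : ∀ x' ∈ R, ∀ w ∉ R, ¬ (x' = x ∧ w = y) → s(x', w) ≠ s(x, y) := by
    intro x' _ w hw hne h
    rcases Sym2.eq_iff.1 h with h2 | ⟨-, h2⟩
    · exact hne h2
    · exact hw (h2 ▸ hx)
  refine mul_mem (PowerSeries.coeff_mul_mem _ (PowerSeries.coeff_pow_mem _ (fun k => ?_) _)
    (PowerSeries.coeff_pow_mem _ (fun k => ?_) _) _) (prod_mem fun x' hx' =>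
      PowerSeries.coeff_pow_mem _ (fun k => ?_) _ _)
  · rw [coeff_walkSeries]; exact genMatrix_pow_mem_supported hx y k y y
  · rw [map_sum]
    refine sum_mem fun w hw => coeff_excursion_mem_supported hx ?_ k
    obtain ⟨hwy, hwR⟩ := Finset.mem_erase.1 hw
    exact hedge x hx w (Finset.mem_compl.1 hwR) fun h => hwy h.2
  · obtain ⟨hx'x, hx'R⟩ := Finset.mem_erase.1 hx'
    rw [excursionSeries, map_sum]
    refine sum_mem fun w hw => coeff_excursion_mem_supported hx ?_ k
    exact hedge x' hx'R w (Finset.mem_compl.1 hw) fun h => hx'x h.1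

/-- After the edge from `x` to `y` has been split off, what remains is a combination of forest moments
in which `y` is a further root. -/
theorem forestExp_insert_walkSeries {q : ℝ} {X' : ℕ → ℝ} {R : Finset V} {x y : V} (hx : x ∈ R)
    (hy : y ∉ R) (s r : V → ℕ) (j m a b : ℕ) :
    forestExp q X' (insert y R) (PowerSeries.coeff b (walkSeries c R y ^ (j + 1)) *
        PowerSeries.coeff a ((∑ w ∈ Rᶜ.erase y, childSeries c R x w) ^ m) *
        ∏ x' ∈ R.erase x, PowerSeries.coeff (s x') (excursionSeries c R x' ^ r x')) =
      ∑ v ∈ Finset.range (b + 1), ((j + v).choose j : ℝ) *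
        forestMoment c q X' (insert y R) (Function.update (Function.update s x a) y b)
          (Function.update (Function.update r x m) y v) := by
  have hxy : x ≠ y := fun h => hy (h ▸ hx)
  have hcongr : forestExp q X' (insert y R)
      (PowerSeries.coeff b (walkSeries c R y ^ (j + 1)) *
        PowerSeries.coeff a ((∑ w ∈ Rᶜ.erase y, childSeries c R x w) ^ m) *
        ∏ x' ∈ R.erase x, PowerSeries.coeff (s x') (excursionSeries c R x' ^ r x')) =
      forestExp q X' (insert y R) (∑ v ∈ Finset.range (b + 1), ((j + v).choose j : ℝ) •
        (PowerSeries.coeff b (excursionSeries c (insert y R) y ^ v) *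
          (PowerSeries.coeff a (excursionSeries c (insert y R) x ^ m) *
          ∏ x' ∈ R.erase x,
            PowerSeries.coeff (s x') (excursionSeries c (insert y R) x' ^ r x')))) := by
    refine forestExp_congr q X' ?_
    rw [mul_assoc, map_mul, mk_coeff_walkSeries_pow hy, map_mul,
      mk_coeff_pow_eq_of_map_eq _ (map_excursionSeries_insert hx hy) m, map_prod,
      Finset.prod_congr rfl fun x' hx' => mk_coeff_pow_eq_of_map_eq _
        (map_excursionSeries (c := c) (Finset.mem_of_mem_erase hx') hy) _ _,
      ← map_prod, ← map_mul, ← map_mul, Finset.sum_mul]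
    refine congrArg _ (Finset.sum_congr rfl fun v _ => ?_)
    rw [MvPolynomial.smul_eq_C_mul, map_natCast, mul_assoc]
  rw [hcongr, map_sum]
  refine Finset.sum_congr rfl fun v _ => ?_
  rw [map_smul, smul_eq_mul, forestMoment, Finset.prod_insert hy, Function.update_self,
    Function.update_self, ← Finset.mul_prod_erase R _ hx, Function.update_of_ne hxy,
    Function.update_of_ne hxy, Function.update_self, Function.update_self]
  have hprod : ∏ x' ∈ R.erase x, PowerSeries.coeff (s x')
        (excursionSeries c (insert y R) x' ^ r x') =
      ∏ x' ∈ R.erase x, PowerSeries.coeff (Function.update (Function.update s x a) y b x')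
        (excursionSeries c (insert y R) x' ^
          Function.update (Function.update r x m) y v x') := by
    refine Finset.prod_congr rfl fun x' hx' => ?_
    obtain ⟨hx'x, hx'R⟩ := Finset.mem_erase.1 hx'
    have hx'y : x' ≠ y := fun h => hy (h ▸ hx'R)
    rw [Function.update_of_ne hx'y, Function.update_of_ne hx'x, Function.update_of_ne hx'y,
      Function.update_of_ne hx'x]
  rw [hprod]

/-- The contribution to a forest moment of the walks whose first step from the root `x` leads to
`y`, the edge being used in `j + 1` of the `m + j + 1` excursions from `x`. -/
theorem forestExp_excursion {q : ℝ} {X' : ℕ → ℝ} {R : Finset V} {x y : V} (hx : x ∈ R) (hy : y ∉ R)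
    (hc : c x ≠ c y) (s r : V → ℕ) (j m : ℕ) :
    forestExp q X' R (PowerSeries.coeff (s x) (childSeries c R x y ^ (j + 1) *
          (∑ w ∈ Rᶜ.erase y, childSeries c R x w) ^ m) *
        ∏ x' ∈ R.erase x, PowerSeries.coeff (s x') (excursionSeries c R x' ^ r x')) =
      if 2 * (j + 1) ≤ s x then
        q * X' (2 * (j + 1)) * ∑ ab ∈ Finset.HasAntidiagonal.antidiagonal (s x - 2 * (j + 1)),
          ∑ v ∈ Finset.range (ab.2 + 1), ((j + v).choose j : ℝ) *
            forestMoment c q X' (insert y R) (Function.update (Function.update s x ab.1) y ab.2)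
              (Function.update (Function.update r x m) y v)
      else 0 := by
  have hsupp := fun n =>
    coeff_walkSeries_pow_mul_mem_supported (c := c) (y := y) hx s r (j + 1) m n
  have hins := fun a b =>
    forestExp_insert_walkSeries (c := c) (q := q) (X' := X') hx hy s r j m a b
  generalize ∏ x' ∈ R.erase x, PowerSeries.coeff (s x') (excursionSeries c R x' ^ r x') = Q
    at hsupp hins ⊢
  generalize ∑ w ∈ Rᶜ.erase y, childSeries c R x w = Ξ at hsupp hins ⊢
  have h1 : childSeries c R x y ^ (j + 1) * Ξ ^ m = PowerSeries.X ^ (2 * (j + 1)) *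
      (PowerSeries.C (X s(x, y) ^ (2 * (j + 1))) * (walkSeries c R y ^ (j + 1) * Ξ ^ m)) := by
    rw [childSeries, genMatrix_empty, if_pos hc, map_pow]
    ring
  rw [h1, PowerSeries.coeff_X_pow_mul']
  split_ifs with hs
  swap
  · rw [zero_mul, map_zero]
  rw [PowerSeries.coeff_C_mul, mul_assoc,
    forestExp_X_pow_mul q X' hx hy (by omega) (hsupp _), PowerSeries.coeff_mul]
  rw [Finset.sum_mul, map_sum, ← Finset.Nat.sum_antidiagonal_swap]
  refine congrArg _ (Finset.sum_congr rfl fun ab _ => ?_)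
  exact hins ab.1 ab.2

/-- The forest moments satisfy a recurrence: the first step from the root `x` leads to a vertex `y`,
`j + 1` of the excursions from `x` pass through `y`, and `y` becomes a root when the edge from `x` to
`y` is removed. The walks at the roots get shorter by `2 * (j + 1)` steps. -/
theorem forestMoment_rec {q : ℝ} {X' : ℕ → ℝ} {R : Finset V} {x : V} (hx : x ∈ R) (s r : V → ℕ)
    {n : ℕ} (hr : r x = n + 1) :
    forestMoment c q X' R s r = ∑ y ∈ Rᶜ with c x ≠ c y, ∑ j ∈ Finset.range (n + 1),
      (n.choose j : ℝ) * if 2 * (j + 1) ≤ s x then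
        q * X' (2 * (j + 1)) * ∑ ab ∈ Finset.HasAntidiagonal.antidiagonal (s x - 2 * (j + 1)),
          ∑ v ∈ Finset.range (ab.2 + 1), ((j + v).choose j : ℝ) *
            forestMoment c q X' (insert y R) (Function.update (Function.update s x ab.1) y ab.2)
              (Function.update (Function.update r x (n - j)) y v)
      else 0 := by
  rw [forestMoment, ← Finset.mul_prod_erase R _ hx, hr]
  nth_rewrite 1 [excursionSeries]
  rw [sum_pow_succ_eq, map_sum, Finset.sum_mul, map_sum, Finset.sum_filter]
  refine Finset.sum_congr rfl fun y hy => ?_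
  have hy' := Finset.mem_compl.1 hy
  split_ifs with hc
  · rw [map_sum, Finset.sum_mul, map_sum]
    refine Finset.sum_congr rfl fun j _ => ?_
    rw [← forestExp_excursion hx hy' hc s r j (n - j), ← nsmul_eq_mul, map_nsmul, smul_mul_assoc,
      map_nsmul, nsmul_eq_mul]
  · rw [Finset.sum_eq_zero, map_zero, zero_mul, map_zero]
    intro j _
    rw [childSeries, genMatrix_empty, if_neg hc]
    simp

theorem forestMoment_eq_zero_of_lt {q : ℝ} {X' : ℕ → ℝ} {R : Finset V} {x : V} (hx : x ∈ R)
    {s r : V → ℕ} (h : s x < r x) : forestMoment c q X' R s r = 0 := by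
  rw [forestMoment, Finset.prod_eq_zero hx, map_zero]
  have h1 := pow_dvd_pow_of_dvd (X_dvd_excursionSeries (c := c) R x) (r x)
  exact PowerSeries.X_pow_dvd_iff.1 h1 _ h

theorem forestMoment_eq_one [Nonempty V] {q : ℝ} {X' : ℕ → ℝ} {R : Finset V} {s r : V → ℕ}
    (hs : ∀ x ∈ R, s x = 0) (hr : ∀ x ∈ R, r x = 0) : forestMoment c q X' R s r = 1 := by
  rw [forestMoment, Finset.prod_eq_one, forestExp_one]
  intro x hx
  simp [hs x hx, hr x hx]

theorem forestMoment_eq_zero {q : ℝ} {X' : ℕ → ℝ} {R : Finset V} {s r : V → ℕ} {x : V} (hx : x ∈ R)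
    (hs : s x ≠ 0) (hr : r x = 0) : forestMoment c q X' R s r = 0 := by
  rw [forestMoment, Finset.prod_eq_zero hx, map_zero]
  simp [hr, PowerSeries.coeff_one, hs]

end Recurrence

/-! ### The limit of the forest moments -/

/-- The limiting proportion of the vertices of a given colour. -/
noncomputable def colourWeight (α : ℝ) (b : Bool) : ℝ := if b then α else 1 - α

theorem colourWeight_pos {α : ℝ} (hα : α ∈ Set.Ioo (0 : ℝ) 1) (b : Bool) : 0 < colourWeight α b := by
  cases b
  · simpa [colourWeight] using hα.2
  · simpa [colourWeight] using hα.1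

/-- The limit of the expected weighted number of closed walks of length `s` with `r` departures from a given
root of colour `b`. -/
noncomputable def rootMoment (p α : ℝ) (X : ℕ → ℝ) (b : Bool) (s r : ℕ) : ℝ :=
  if Even s then coupledS p α X b (s / 2) r / colourWeight α b else 0

theorem rootMoment_two_mul (p α : ℝ) (X : ℕ → ℝ) (b : Bool) (l r : ℕ) :
    rootMoment p α X b (2 * l) r = coupledS p α X b l r / colourWeight α b := by
  simp [rootMoment]

theorem rootMoment_of_odd (p α : ℝ) (X : ℕ → ℝ) (b : Bool) {s : ℕ} (hs : ¬ Even s) (r : ℕ) :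
    rootMoment p α X b s r = 0 := if_neg hs

theorem rootMoment_of_lt (p α : ℝ) (X : ℕ → ℝ) (b : Bool) {s r : ℕ} (h : s < 2 * r) :
    rootMoment p α X b s r = 0 := by
  rw [rootMoment]
  split_ifs
  · rw [coupledS_of_lt _ _ _ _ (by omega), zero_div]
  · rfl

theorem rootMoment_zero_right {p α : ℝ} {X : ℕ → ℝ} (hα : α ∈ Set.Ioo (0 : ℝ) 1) (b : Bool) (s : ℕ) :
    rootMoment p α X b s 0 = if s = 0 then 1 else 0 := by
  split_ifs with h
  · subst h
    rw [rootMoment, if_pos (by decide), coupledS_zero_right, if_pos rfl, ← colourWeight,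
      div_self (colourWeight_pos hα b).ne']
  · rw [rootMoment]
    split_ifs with h2
    · rw [coupledS_zero_right, if_neg, zero_div]
      obtain ⟨k, rfl⟩ := h2
      omega
    · rfl

theorem sum_antidiagonal_eq_sum_even {h : ℕ × ℕ → ℝ} (h0 : ∀ a b, ¬ Even b → h (a, b) = 0) (m : ℕ) :
    ∑ ab ∈ Finset.HasAntidiagonal.antidiagonal (2 * m), h ab =
      ∑ u ∈ Finset.range (m + 1), h (2 * (m - u), 2 * u) := by
  symm
  refine Finset.sum_of_injOn (fun u => (2 * (m - u), 2 * u)) ?_ ?_ ?_ ?_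
  · intro u _ v _ huv
    simp only [Prod.mk.injEq] at huv
    omega
  · intro u hu
    have hu' : u < m + 1 := by simpa using hu
    simp only [Finset.mem_coe, Finset.HasAntidiagonal.mem_antidiagonal]
    omega
  · rintro ⟨a, b⟩ hab hne
    refine h0 a b fun ⟨k, hk⟩ => hne ⟨k, ?_, ?_⟩
    all_goals
      have := Finset.HasAntidiagonal.mem_antidiagonal.1 hab
      simp only at this
    · simp only [Finset.coe_range, Set.mem_Iio]; omega
    · simp only [Prod.mk.injEq]; omega
  · intro _ _; rfl

/-- The recurrence of the arrays `coupledS`, normalized by the colour weights, in the form of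
`forestMoment_rec`. The prefactor is the limiting proportion of the vertices which may be chosen as the
child. -/
theorem rootMoment_rec {p α : ℝ} {X : ℕ → ℝ} (hα : α ∈ Set.Ioo (0 : ℝ) 1) (b : Bool) (s n : ℕ) :
    rootMoment p α X b s (n + 1) = colourWeight α (!b) *
      ∑ j ∈ Finset.range (n + 1), (n.choose j : ℝ) * if 2 * (j + 1) ≤ s then
        p * X (2 * (j + 1)) * ∑ ab ∈ Finset.HasAntidiagonal.antidiagonal (s - 2 * (j + 1)),
          ∑ v ∈ Finset.range (ab.2 + 1), ((j + v).choose j : ℝ) *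
            (rootMoment p α X (!b) ab.2 v * rootMoment p α X b ab.1 (n - j))
      else 0 := by
  by_cases hs : Even s
  swap
  · rw [rootMoment_of_odd _ _ _ _ hs, Finset.sum_eq_zero, mul_zero]
    intro j _
    split_ifs with hj
    · rw [Finset.sum_eq_zero, mul_zero, mul_zero]
      intro ab hab
      refine Finset.sum_eq_zero fun v _ => ?_
      have := Finset.HasAntidiagonal.mem_antidiagonal.1 hab
      by_cases h1 : Even ab.1
      · rw [rootMoment_of_odd _ _ _ (!b), zero_mul, mul_zero]
        intro h2
        refine hs ?_
        rw [show s = ab.1 + ab.2 + 2 * (j + 1) by omega]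
        exact (h1.add h2).add (even_two_mul _)
      · rw [rootMoment_of_odd _ _ _ b h1, mul_zero, mul_zero]
    · rw [mul_zero]
  obtain ⟨l, rfl⟩ : ∃ l, s = 2 * l := ⟨s / 2, by obtain ⟨k, rfl⟩ := hs; omega⟩
  rcases lt_or_ge l (n + 1) with hlt | hle
  · rw [rootMoment_of_lt _ _ _ _ (by omega), Finset.sum_eq_zero, mul_zero]
    intro j hj
    have hj' := Finset.mem_range.1 hj
    split_ifs with h
    · rw [Finset.sum_eq_zero, mul_zero, mul_zero]
      intro ab hab
      have := Finset.HasAntidiagonal.mem_antidiagonal.1 hab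
      refine Finset.sum_eq_zero fun v _ => ?_
      rw [rootMoment_of_lt _ _ _ b (by omega), mul_zero, mul_zero]
    · rw [mul_zero]
  have hw := (colourWeight_pos hα b).ne'
  have hw' := (colourWeight_pos hα (!b)).ne'
  rw [rootMoment_two_mul, coupledS_rec p α X b (by omega) hle, Finset.mul_sum, Finset.mul_sum,
    Finset.sum_div, ← Finset.Ico_succ_right_eq_Icc, Finset.sum_Ico_eq_sum_range]
  refine Finset.sum_congr (by simp) fun j hj => ?_
  have hj' : j < n + 1 := by simpa using hj
  rw [if_pos (by omega), show 1 + j = j + 1 by omega, Nat.add_sub_cancel, Nat.add_sub_cancel,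
    show 2 * l - 2 * (j + 1) = 2 * (l - (j + 1)) by omega, sum_antidiagonal_eq_sum_even]
  swap
  · intro a b' hb'
    refine Finset.sum_eq_zero fun v _ => ?_
    rw [rootMoment_of_odd _ _ _ _ hb', zero_mul, mul_zero]
  have hsub : Finset.Icc 0 (l - (n + 1)) ⊆ Finset.range (l - (j + 1) + 1) := by
    intro u hu
    have := (Finset.mem_Icc.1 hu).2
    exact Finset.mem_range.2 (by omega)
  have key : ∑ u ∈ Finset.range (l - (j + 1) + 1), ∑ v ∈ Finset.range (2 * u + 1),
      ((j + v).choose j : ℝ) * (rootMoment p α X (!b) (2 * u) v *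
        rootMoment p α X b (2 * (l - (j + 1) - u)) (n - j)) =
      (∑ u ∈ Finset.Icc 0 (l - (n + 1)), coupledS p α X b (l - u - (j + 1)) (n + 1 - (j + 1)) *
        ∑ v ∈ Finset.Icc 0 u, ((j + 1 + v - 1).choose j : ℝ) * coupledS p α X (!b) u v) /
        (colourWeight α b * colourWeight α (!b)) := by
    rw [← Finset.sum_subset hsub, Finset.sum_div]
    · refine Finset.sum_congr rfl fun u hu => ?_
      have hu' := (Finset.mem_Icc.1 hu).2
      have hsub2 : Finset.Icc 0 u ⊆ Finset.range (2 * u + 1) := by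
        intro v hv
        have := (Finset.mem_Icc.1 hv).2
        exact Finset.mem_range.2 (by omega)
      rw [← Finset.sum_subset hsub2, Finset.mul_sum, Finset.sum_div]
      · refine Finset.sum_congr rfl fun v _ => ?_
        rw [rootMoment_two_mul, rootMoment_two_mul, show l - (j + 1) - u = l - u - (j + 1) by omega,
          show n + 1 - (j + 1) = n - j by omega, show j + 1 + v - 1 = j + v by omega]
        field_simp
      · intro v _ hv
        rw [rootMoment_of_lt, zero_mul, mul_zero]
        simp only [Finset.mem_Icc, zero_le, true_and, not_le] at hv
        omega
    · intro u hu hu2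
      refine Finset.sum_eq_zero fun v _ => ?_
      have := Finset.mem_range.1 hu
      simp only [Finset.mem_Icc, zero_le, true_and, not_le] at hu2
      rw [rootMoment_of_lt _ _ _ b (by omega), mul_zero, mul_zero]
  simp only [key]
  field_simp

section Limit

variable {p α : ℝ} {X : ℕ → ℝ} {N : ℕ} {c : Fin N → Bool}

/-- The linear operation in the recurrence for the walk moments: `j + 1` is the number of excursions
through the first child, `ab` are the lengths of the remaining walk from the root and of the walk
from the child, and `v` is the number of departures of the latter. -/
noncomputable def firstChildSum (q : ℝ) (X : ℕ → ℝ) (s n : ℕ) (F : ℕ → ℕ × ℕ → ℕ → ℝ) : ℝ :=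
  ∑ j ∈ Finset.range (n + 1), (n.choose j : ℝ) * if 2 * (j + 1) ≤ s then
    q * X (2 * (j + 1)) * ∑ ab ∈ Finset.HasAntidiagonal.antidiagonal (s - 2 * (j + 1)),
      ∑ v ∈ Finset.range (ab.2 + 1), ((j + v).choose j : ℝ) * F j ab v
  else 0

theorem firstChildSum_mul_div (q : ℝ) (X : ℕ → ℝ) (s n : ℕ) (F : ℕ → ℕ × ℕ → ℕ → ℝ) (a b : ℝ) :
    firstChildSum q X s n F * a / b = firstChildSum (q / b) X s n fun j ab v => F j ab v * a := by
  rw [firstChildSum, firstChildSum, Finset.sum_mul, Finset.sum_div]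
  refine Finset.sum_congr rfl fun j _ => ?_
  split_ifs
  · simp_rw [← mul_assoc, ← Finset.sum_mul]
    ring
  · simp

/-- A crude Lipschitz bound for `firstChildSum`, with a constant which depends only on the bounds `K` for
the number of departures and `t` for the length. -/
theorem abs_firstChildSum_sub_le {q : ℝ} {X : ℕ → ℝ} {s n K t : ℕ} {F F' : ℕ → ℕ × ℕ → ℕ → ℝ}
    {Xb δ : ℝ} (hq : 0 ≤ q) (hδ : 0 ≤ δ) (hn : n < K) (hst : s ≤ t)
    (hXb : ∀ j < K, |X (2 * (j + 1))| ≤ Xb)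
    (h : ∀ j ≤ n, 2 * (j + 1) ≤ s → ∀ ab ∈ Finset.HasAntidiagonal.antidiagonal (s - 2 * (j + 1)),
      ∀ v ≤ ab.2, |F j ab v - F' j ab v| ≤ δ) :
    |firstChildSum q X s n F - firstChildSum q X s n F'| ≤
      K * (2 ^ K * (q * Xb * ((t + 1) * ((t + 1) * (2 ^ (K + t) * δ))))) := by
  have hXb0 : 0 ≤ Xb := (abs_nonneg _).trans (hXb n hn)
  have hsub : firstChildSum q X s n F - firstChildSum q X s n F' =
      firstChildSum q X s n fun j ab v => F j ab v - F' j ab v := by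
    rw [firstChildSum, firstChildSum, firstChildSum, ← Finset.sum_sub_distrib]
    refine Finset.sum_congr rfl fun j _ => ?_
    rw [← mul_sub]
    congr 1
    split_ifs
    · simp_rw [mul_sub, Finset.sum_sub_distrib, mul_sub]
    · rw [sub_zero]
  rw [hsub, firstChildSum]
  refine (Finset.abs_sum_le_sum_abs _ _).trans ((Finset.sum_le_card_nsmul _ _
    (2 ^ K * (q * Xb * ((t + 1) * ((t + 1) * (2 ^ (K + t) * δ))))) fun j hj => ?_).trans ?_)
  · have hj' := Nat.lt_succ_iff.1 (Finset.mem_range.1 hj)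
    rw [abs_mul, Nat.abs_cast]
    have h6 : (n.choose j : ℝ) ≤ 2 ^ K := by
      have : n.choose j ≤ 2 ^ K :=
        (Nat.choose_le_two_pow _ _).trans (Nat.pow_le_pow_right (by norm_num) hn.le)
      exact_mod_cast this
    refine mul_le_mul h6 ?_ (abs_nonneg _) (by positivity)
    split_ifs with hjs
    swap
    · rw [abs_zero]; positivity
    rw [abs_mul, abs_mul, abs_of_nonneg hq]
    refine mul_le_mul (mul_le_mul_of_nonneg_left (hXb j (by omega)) hq) ?_ (abs_nonneg _)
      (by positivity)
    refine (Finset.abs_sum_le_sum_abs _ _).trans ((Finset.sum_le_card_nsmul _ _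
      ((t + 1) * (2 ^ (K + t) * δ)) fun ab hab => ?_).trans ?_)
    · have hab' := Finset.HasAntidiagonal.mem_antidiagonal.1 hab
      refine (Finset.abs_sum_le_sum_abs _ _).trans ((Finset.sum_le_card_nsmul _ _
        (2 ^ (K + t) * δ) fun v hv => ?_).trans ?_)
      · have hv' := Nat.lt_succ_iff.1 (Finset.mem_range.1 hv)
        rw [abs_mul, Nat.abs_cast]
        refine mul_le_mul ?_ (h j hj' hjs ab hab v hv') (abs_nonneg _) (by positivity)
        have h5 : (j + v).choose j ≤ 2 ^ (K + t) :=
          (Nat.choose_le_two_pow _ _).trans (Nat.pow_le_pow_right (by norm_num) (by omega))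
        exact_mod_cast h5
      · rw [Finset.card_range, nsmul_eq_mul]
        refine mul_le_mul_of_nonneg_right ?_ (by positivity)
        have : ab.2 + 1 ≤ t + 1 := by omega
        exact_mod_cast this
    · rw [Finset.Nat.card_antidiagonal, nsmul_eq_mul]
      refine mul_le_mul_of_nonneg_right ?_ (by positivity)
      have : s - 2 * (j + 1) + 1 ≤ t + 1 := by omega
      exact_mod_cast this
  · rw [Finset.card_range, nsmul_eq_mul]
    refine mul_le_mul_of_nonneg_right ?_ (by positivity)
    exact_mod_cast hn

theorem Bool.eq_not_of_ne' {a b : Bool} (h : a ≠ b) : b = !a := by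
  cases a <;> cases b <;> simp_all

theorem abs_card_filter_compl_sub_le {w : ℝ} {b : Bool}
    (hc : |((Finset.univ.filter fun x => c x = !b).card : ℝ) - w| ≤ 1) (R : Finset (Fin N)) :
    |((Rᶜ.filter fun y => b ≠ c y).card : ℝ) - w| ≤ R.card + 1 := by
  have h1 : (Finset.univ.filter fun y => c y = !b) ⊆ Rᶜ.filter (fun y => b ≠ c y) ∪ R := by
    intro y hy
    have h2 := (Finset.mem_filter.1 hy).2
    by_cases h3 : y ∈ R
    · exact Finset.mem_union_right _ h3
    · refine Finset.mem_union_left _ (Finset.mem_filter.2 ⟨Finset.mem_compl.2 h3, ?_⟩)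
      rw [h2]; cases b <;> simp
  have h4 : Rᶜ.filter (fun y => b ≠ c y) ⊆ Finset.univ.filter fun y => c y = !b := fun y hy =>
    Finset.mem_filter.2 ⟨Finset.mem_univ _, Bool.eq_not_of_ne' (Finset.mem_filter.1 hy).2⟩
  have h5 : ((Finset.univ.filter fun y => c y = !b).card : ℝ) ≤
      (Rᶜ.filter fun y => b ≠ c y).card + R.card := by
    exact_mod_cast (Finset.card_le_card h1).trans (Finset.card_union_le _ _)
  have h6 : ((Rᶜ.filter fun y => b ≠ c y).card : ℝ) ≤
      (Finset.univ.filter fun y => c y = !b).card := by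
    exact_mod_cast Finset.card_le_card h4
  have h7 := abs_le.1 hc
  rw [abs_le]
  constructor <;> linarith [h7.1, h7.2]

/-- One step of the recurrence: an error bound for the forest moments with one more root and with
shorter walks yields an error bound for the forest moments. -/
theorem abs_forestMoment_sub_le_of_succ (hp : 0 < p) (hα : α ∈ Set.Ioo (0 : ℝ) 1) (hN : 1 ≤ N)
    (hc : ∀ b, |((Finset.univ.filter fun x => c x = b).card : ℝ) - colourWeight α b * N| ≤ 1)
    {R : Finset (Fin N)} {s r : Fin N → ℕ} {t K n : ℕ} {x : Fin N} (hx : x ∈ R)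
    (hr : r x = n + 1) (hnK : n < K) (hst : s x ≤ t) {C' Γ Xb : ℝ} (hC' : 0 ≤ C')
    (hΓ : |∏ x ∈ R, rootMoment p α X (c x) (s x) (r x)| ≤ Γ)
    (hXb : ∀ j < K, |X (2 * (j + 1))| ≤ Xb)
    (hrec : ∀ y ∉ R, c x ≠ c y → ∀ j ≤ n, 2 * (j + 1) ≤ s x →
      ∀ ab ∈ Finset.HasAntidiagonal.antidiagonal (s x - 2 * (j + 1)), ∀ v ≤ ab.2,
      |forestMoment c (p / N) X (insert y R) (Function.update (Function.update s x ab.1) y ab.2)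
          (Function.update (Function.update r x (n - j)) y v) -
        ∏ z ∈ insert y R, rootMoment p α X (c z)
          (Function.update (Function.update s x ab.1) y ab.2 z)
          (Function.update (Function.update r x (n - j)) y v z)| ≤ C' / N) :
    |forestMoment c (p / N) X R s r - ∏ x ∈ R, rootMoment p α X (c x) (s x) (r x)| ≤
      (K * (2 ^ K * (p * Xb * ((t + 1) * ((t + 1) * (2 ^ (K + t) * C')))))
        + (R.card + 1) * (Γ / colourWeight α (!(c x)))) / N := by
  have hN0 : (0 : ℝ) < N := by exact_mod_cast hN
  have hw := colourWeight_pos hα (!(c x))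
  -- the number of possible children `y` of `x`
  have hcardY := abs_card_filter_compl_sub_le (hc (!(c x))) R
  have hrecF : forestMoment c (p / N) X R s r = ∑ y ∈ Rᶜ with c x ≠ c y,
      firstChildSum (p / N) X (s x) n fun j ab v => forestMoment c (p / N) X (insert y R)
        (Function.update (Function.update s x ab.1) y ab.2)
        (Function.update (Function.update r x (n - j)) y v) := forestMoment_rec hx s r hr
  have hprod : ∏ z ∈ R, rootMoment p α X (c z) (s z) (r z) = colourWeight α (!(c x)) *
      ((firstChildSum p X (s x) n fun j ab v =>
        rootMoment p α X (!(c x)) ab.2 v * rootMoment p α X (c x) ab.1 (n - j)) *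
        ∏ z ∈ R.erase x, rootMoment p α X (c z) (s z) (r z)) := by
    rw [← Finset.mul_prod_erase R _ hx, hr, rootMoment_rec hα, mul_assoc]
    rfl
  have hbound : ∀ y ∈ Rᶜ.filter (fun y => c x ≠ c y),
      |firstChildSum (p / N) X (s x) n (fun j ab v => forestMoment c (p / N) X (insert y R)
        (Function.update (Function.update s x ab.1) y ab.2)
        (Function.update (Function.update r x (n - j)) y v)) -
      (firstChildSum p X (s x) n fun j ab v =>
        rootMoment p α X (!(c x)) ab.2 v * rootMoment p α X (c x) ab.1 (n - j)) *
        (∏ z ∈ R.erase x, rootMoment p α X (c z) (s z) (r z)) / N| ≤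
        K * (2 ^ K * (p * Xb * ((t + 1) * ((t + 1) * (2 ^ (K + t) * C'))))) / N / N := by
    intro y hy
    obtain ⟨hyR, hcy⟩ := Finset.mem_filter.1 hy
    have hyR' := Finset.mem_compl.1 hyR
    have hxy : x ≠ y := fun h => hcy (h ▸ rfl)
    rw [firstChildSum_mul_div]
    refine (abs_firstChildSum_sub_le (by positivity) (by positivity : 0 ≤ C' / N) hnK hst hXb
      fun j hj hjs ab hab v hv => ?_).trans (le_of_eq (by ring))
    have h3 := hrec y hyR' hcy j hj hjs ab hab v hv
    rw [Finset.prod_insert hyR', ← Finset.mul_prod_erase R _ hx, Function.update_self,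
      Function.update_self, Function.update_of_ne hxy, Function.update_of_ne hxy,
      Function.update_self, Function.update_self, Bool.eq_not_of_ne' hcy, ← mul_assoc] at h3
    have h4 : ∏ z ∈ R.erase x, rootMoment p α X (c z)
        (Function.update (Function.update s x ab.1) y ab.2 z)
        (Function.update (Function.update r x (n - j)) y v z) =
        ∏ z ∈ R.erase x, rootMoment p α X (c z) (s z) (r z) := by
      refine Finset.prod_congr rfl fun z hz => ?_
      obtain ⟨hzx, hzR⟩ := Finset.mem_erase.1 hz
      have hzy : z ≠ y := fun h => hyR' (h ▸ hzR)
      rw [Function.update_of_ne hzy, Function.update_of_ne hzx, Function.update_of_ne hzy,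
        Function.update_of_ne hzx]
    rwa [h4] at h3
  rw [hrecF]
  rw [hprod] at hΓ ⊢
  -- `W` is the limiting contribution of a single child of `x`, multiplied by `N`.
  generalize (firstChildSum p X (s x) n fun j ab v =>
    rootMoment p α X (!(c x)) ab.2 v * rootMoment p α X (c x) ab.1 (n - j)) *
    ∏ z ∈ R.erase x, rootMoment p α X (c z) (s z) (r z) = W at hΓ hbound ⊢
  have hYN : ((Rᶜ.filter fun y => c x ≠ c y).card : ℝ) ≤ N := by
    have := Finset.card_le_univ (Rᶜ.filter fun y => c x ≠ c y)
    rw [Fintype.card_fin] at this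
    exact_mod_cast this
  have hW : |W| ≤ Γ / colourWeight α (!(c x)) := by
    rw [le_div_iff₀ hw, mul_comm]
    rwa [abs_mul, abs_of_pos hw] at hΓ
  have hXb0 : 0 ≤ Xb := (abs_nonneg _).trans (hXb n hnK)
  have hD0 : 0 ≤ (K : ℝ) * (2 ^ K * (p * Xb * ((t + 1) * ((t + 1) * (2 ^ (K + t) * C'))))) := by
    positivity
  generalize (K : ℝ) * (2 ^ K * (p * Xb * ((t + 1) * ((t + 1) * (2 ^ (K + t) * C'))))) = D
    at hbound hD0 ⊢
  have h1 := (Finset.abs_sum_le_sum_abs _ _).trans (Finset.sum_le_sum hbound)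
  rw [Finset.sum_sub_distrib, Finset.sum_const, Finset.sum_const, nsmul_eq_mul, nsmul_eq_mul] at h1
  generalize ((Rᶜ.filter fun y => c x ≠ c y).card : ℝ) = k at hcardY hYN h1
  have h2 : |(k - colourWeight α (!(c x)) * N) * W / N| ≤
      (R.card + 1) * (Γ / colourWeight α (!(c x))) / N := by
    rw [abs_div, abs_mul, abs_of_pos hN0]
    gcongr
  have h3 : k * (D / N / N) ≤ D / N := by
    calc k * (D / N / N) ≤ N * (D / N / N) := by gcongr
      _ = D / N := by field_simp
  have hsplit : ∀ T : ℝ, T - colourWeight α (!(c x)) * W =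
      (T - k * (W / N)) + (k - colourWeight α (!(c x)) * N) * W / N := by
    intro T
    field_simp
    ring
  rw [hsplit, add_div]
  exact (abs_add_le _ _).trans (add_le_add (h1.trans h3) h2)

/-- The forest moments factorize asymptotically, uniformly in the roots. -/
theorem exists_abs_forestMoment_sub_le (hp : 0 < p) (hα : α ∈ Set.Ioo (0 : ℝ) 1) (X : ℕ → ℝ)
    (t m K : ℕ) : ∃ C : ℝ, 0 ≤ C ∧ ∀ (N : ℕ), 1 ≤ N → ∀ c : Fin N → Bool,
      (∀ b, |((Finset.univ.filter fun x => c x = b).card : ℝ) - colourWeight α b * N| ≤ 1) →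
      ∀ (R : Finset (Fin N)) (s r : Fin N → ℕ), R.card = m → ∑ x ∈ R, s x ≤ t →
      (∀ x ∈ R, r x ≤ K) →
      |forestMoment c (p / N) X R s r - ∏ x ∈ R, rootMoment p α X (c x) (s x) (r x)| ≤ C / N := by
  -- if no walk departs or all walks are trivial, both sides are equal to `0` or both to `1`
  have hzero : ∀ (N : ℕ), 1 ≤ N → ∀ (c : Fin N → Bool) (R : Finset (Fin N)) (s r : Fin N → ℕ),
      ((∀ x ∈ R, r x = 0) ∨ ∑ x ∈ R, s x = 0) →
      forestMoment c (p / N) X R s r = ∏ x ∈ R, rootMoment p α X (c x) (s x) (r x) := by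
    intro N hN c R s r h
    have : Nonempty (Fin N) := ⟨⟨0, hN⟩⟩
    by_cases h1 : ∃ x ∈ R, r x = 0 ∧ s x ≠ 0
    · obtain ⟨x, hx, hr, hs⟩ := h1
      rw [forestMoment_eq_zero hx hs hr, Finset.prod_eq_zero hx]
      rw [hr, rootMoment_zero_right hα, if_neg hs]
    · by_cases h2 : ∃ x ∈ R, s x < r x
      · obtain ⟨x, hx, hsr⟩ := h2
        rw [forestMoment_eq_zero_of_lt hx hsr, Finset.prod_eq_zero hx]
        exact rootMoment_of_lt _ _ _ _ (by omega)
      · push Not at h1 h2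
        have hr : ∀ x ∈ R, r x = 0 := by
          intro x hx
          rcases h with h | h
          · exact h x hx
          · have := h2 x hx
            have := Finset.sum_eq_zero_iff.1 h x hx
            omega
        have hs : ∀ x ∈ R, s x = 0 := fun x hx => h1 x hx (hr x hx)
        rw [forestMoment_eq_one hs hr, Finset.prod_eq_one]
        intro x hx
        rw [hr x hx, hs x hx, rootMoment_zero_right hα, if_pos rfl]
  -- the recurrence adds a root, but it reduces the total length of the walks
  induction t generalizing m K with
  | zero =>
    refine ⟨0, le_rfl, fun N hN c _ R s r _ hs _ => ?_⟩
    rw [hzero N hN c R s r (Or.inr (Nat.le_zero.1 hs)), sub_self, abs_zero, zero_div]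
  | succ t ih =>
    obtain ⟨C', hC'0, hC'⟩ := ih (m + 1) (max K (t + 1))
    set Γ₁ : ℝ := 1 + ∑ b : Bool, ∑ s ∈ Finset.range (t + 2), ∑ r ∈ Finset.range (K + 1),
      |rootMoment p α X b s r| with hΓ₁
    have hΓ₁1 : 1 ≤ Γ₁ := by
      rw [hΓ₁]
      have : 0 ≤ ∑ b : Bool, ∑ s ∈ Finset.range (t + 2), ∑ r ∈ Finset.range (K + 1),
        |rootMoment p α X b s r| := by positivity
      linarith
    have hΓ₁le : ∀ b, ∀ s ≤ t + 1, ∀ r ≤ K, |rootMoment p α X b s r| ≤ Γ₁ := by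
      intro b s hs r hr
      have h1 : |rootMoment p α X b s r| ≤ ∑ r ∈ Finset.range (K + 1), |rootMoment p α X b s r| :=
        Finset.single_le_sum (f := fun r => |rootMoment p α X b s r|) (fun _ _ => abs_nonneg _)
          (Finset.mem_range.2 (by omega))
      have h2 : ∑ r ∈ Finset.range (K + 1), |rootMoment p α X b s r| ≤
          ∑ s ∈ Finset.range (t + 2), ∑ r ∈ Finset.range (K + 1), |rootMoment p α X b s r| :=
        Finset.single_le_sum
          (f := fun s => ∑ r ∈ Finset.range (K + 1), |rootMoment p α X b s r|)
          (fun _ _ => by positivity) (Finset.mem_range.2 (by omega))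
      have h3 : ∑ s ∈ Finset.range (t + 2), ∑ r ∈ Finset.range (K + 1), |rootMoment p α X b s r| ≤
          ∑ b : Bool, ∑ s ∈ Finset.range (t + 2), ∑ r ∈ Finset.range (K + 1),
            |rootMoment p α X b s r| :=
        Finset.single_le_sum
          (f := fun b => ∑ s ∈ Finset.range (t + 2), ∑ r ∈ Finset.range (K + 1),
            |rootMoment p α X b s r|) (fun _ _ => by positivity) (Finset.mem_univ b)
      linarith
    set Xb : ℝ := ∑ j ∈ Finset.range K, |X (2 * (j + 1))| with hXb
    have hXble : ∀ j < K, |X (2 * (j + 1))| ≤ Xb := fun j hj =>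
      Finset.single_le_sum (f := fun j => |X (2 * (j + 1))|) (fun _ _ => abs_nonneg _)
        (Finset.mem_range.2 hj)
    have hXb0 : 0 ≤ Xb := by positivity
    set D : ℝ := K * (2 ^ K * (p * Xb * (((t + 1 : ℕ) + 1) * (((t + 1 : ℕ) + 1) *
      (2 ^ (K + (t + 1)) * C'))))) with hD
    have hw1 := colourWeight_pos hα true
    have hw2 := colourWeight_pos hα false
    refine ⟨D + ((m + 1) * (Γ₁ ^ m / colourWeight α true) +
      (m + 1) * (Γ₁ ^ m / colourWeight α false)), by positivity,
      fun N hN c hc R s r hR hs hr => ?_⟩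
    have hN0 : (0 : ℝ) < N := by exact_mod_cast hN
    by_cases h0 : ∀ x ∈ R, r x = 0
    · rw [hzero N hN c R s r (Or.inl h0), sub_self, abs_zero]
      positivity
    push Not at h0
    obtain ⟨x, hx, hrx⟩ := h0
    obtain ⟨n, hn⟩ := Nat.exists_eq_succ_of_ne_zero hrx
    have hsx : ∀ z ∈ R, s z ≤ t + 1 := fun z hz =>
      (Finset.single_le_sum (f := s) (fun _ _ => Nat.zero_le _) hz).trans hs
    have hΓ : |∏ x ∈ R, rootMoment p α X (c x) (s x) (r x)| ≤ Γ₁ ^ m := by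
      rw [Finset.abs_prod, ← hR]
      rw [← Finset.prod_const]
      exact Finset.prod_le_prod (fun _ _ => abs_nonneg _)
        fun z hz => hΓ₁le _ _ (hsx z hz) _ (hr z hz)
    have hstep := abs_forestMoment_sub_le_of_succ (X := X) (t := t + 1) (K := K) hp hα hN hc hx hn
      (by have := hr x hx; omega) (hsx x hx) hC'0 hΓ hXble (fun y hy hcy j hj hjs ab hab v hv => by
        have hab' := Finset.HasAntidiagonal.mem_antidiagonal.1 hab
        have hsplit := Finset.add_sum_erase R s hx
        refine hC' N hN c hc _ _ _ (by rw [Finset.card_insert_of_notMem hy, hR]) ?_ ?_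
        · have hxy : x ≠ y := fun h => hy (h ▸ hx)
          rw [Finset.sum_insert hy, ← Finset.add_sum_erase R _ hx, Function.update_self,
            Function.update_of_ne hxy, Function.update_self,
            Finset.sum_congr rfl (g := fun z => s z)]
          · rw [← hsplit] at hs
            omega
          · intro z hz
            obtain ⟨hzx, hzR⟩ := Finset.mem_erase.1 hz
            have hzy : z ≠ y := fun h => hy (h ▸ hzR)
            rw [Function.update_of_ne hzy, Function.update_of_ne hzx]
        · intro z hz
          have h1 := hsx x hx
          by_cases hzy : z = y
          · subst hzy
            rw [Function.update_self]
            omega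
          · rw [Function.update_of_ne hzy]
            have hzR := Finset.mem_of_mem_insert_of_ne hz hzy
            by_cases hzx : z = x
            · subst hzx
              have := hr z hx
              rw [Function.update_self]
              omega
            · rw [Function.update_of_ne hzx]
              exact (hr z hzR).trans (le_max_left _ _))
    refine hstep.trans ?_
    rw [hR]
    gcongr
    cases c x
    · exact le_add_of_nonneg_right (by positivity)
    · exact le_add_of_nonneg_left (by positivity)

end Limit

/-! ### Walks with cycles are negligible -/

section Excess

open MvPolynomial

/-- The sums of monomials of degree at most `k` with nonnegative coefficients. -/
noncomputable def monomialCone (V : Type*) (k : ℕ) : AddSubmonoid (EdgePoly V) :=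
  AddSubmonoid.closure {P | ∃ (μ : Sym2 V →₀ ℕ) (a : ℝ), 0 ≤ a ∧ μ.degree ≤ k ∧ P = monomial μ a}

theorem monomialCone_mono (V : Type*) {k l : ℕ} (h : k ≤ l) : monomialCone V k ≤ monomialCone V l :=
  AddSubmonoid.closure_mono fun _ ⟨μ, a, ha, hμ, hP⟩ => ⟨μ, a, ha, hμ.trans h, hP⟩

theorem one_mem_monomialCone (V : Type*) : (1 : EdgePoly V) ∈ monomialCone V 0 :=
  AddSubmonoid.subset_closure ⟨0, 1, zero_le_one, by simp, rfl⟩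

theorem mul_X_mem_monomialCone {V : Type*} {k : ℕ} {P : EdgePoly V} (hP : P ∈ monomialCone V k)
    (e : Sym2 V) : P * X e ∈ monomialCone V (k + 1) := by
  induction hP using AddSubmonoid.closure_induction with
  | mem P h =>
    obtain ⟨μ, a, ha, hμ, rfl⟩ := h
    refine AddSubmonoid.subset_closure ⟨μ + Finsupp.single e 1, a, ha, ?_, ?_⟩
    · rw [map_add, Finsupp.degree_single]; omega
    · rw [X, monomial_mul, mul_one]
  | zero => rw [zero_mul]; exact zero_mem _
  | add P Q _ _ hP hQ => rw [add_mul]; exact add_mem hP hQ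

theorem card_support_le_degree {σ : Type*} (μ : σ →₀ ℕ) : μ.support.card ≤ μ.degree := by
  rw [Finsupp.degree_apply, Finset.card_eq_sum_ones]
  exact Finset.sum_le_sum fun e he => Nat.one_le_iff_ne_zero.2 (Finsupp.mem_support_iff.1 he)

variable {N : ℕ} {c : Fin N → Bool} {p : ℝ}

open Classical in
/-- The weight of a monomial in which every edge counts `p / N` and the presence of a cycle counts
`N`. -/
noncomputable def cycleWeight (p : ℝ) (R : Finset (Fin N)) (μ : Sym2 (Fin N) →₀ ℕ) : ℝ :=
  (p / N) ^ μ.support.card * if IsRootedForest R μ.support then (1 : ℝ) else (N : ℝ)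

theorem cycleWeight_nonneg (hp : 0 < p) (R : Finset (Fin N)) (μ : Sym2 (Fin N) →₀ ℕ) :
    0 ≤ cycleWeight p R μ := by
  rw [cycleWeight]
  split_ifs <;> positivity

theorem monomialFunctional_cycleWeight_nonneg (hp : 0 < p) (R : Finset (Fin N)) {k : ℕ}
    {P : EdgePoly (Fin N)} (hP : P ∈ monomialCone (Fin N) k) :
    0 ≤ monomialFunctional (cycleWeight p R) P := by
  induction hP using AddSubmonoid.closure_induction with
  | mem P h =>
    obtain ⟨μ, a, ha, -, rfl⟩ := h
    rw [monomialFunctional_monomial]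
    exact mul_nonneg ha (cycleWeight_nonneg hp R μ)
  | zero => rw [map_zero]
  | add P Q _ _ hP hQ => rw [map_add]; exact add_nonneg hP hQ

/-- The next step of a walk either leads to one of the `N` vertices, with an edge which counts
`p / N` and does not close a cycle, or to one of the boundedly many vertices visited before; in this
case either the edge is not new, or the factor `N` for a cycle is compensated by `p / N`. -/
theorem sum_cycleWeight_le (hp : 0 < p) (hN : 1 ≤ N) (R : Finset (Fin N))
    (μ : Sym2 (Fin N) →₀ ℕ) (z : Fin N) :
    ∑ y with c z ≠ c y, cycleWeight p R (μ + Finsupp.single s(z, y) 1) ≤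
      (p + (2 * μ.degree + R.card + 1) * (1 + p)) * cycleWeight p R μ := by
  have hN0 : (0 : ℝ) < N := by exact_mod_cast hN
  have hN1 : (1 : ℝ) ≤ N := by exact_mod_cast hN
  -- the vertices visited before
  set O : Finset (Fin N) := insert z (R ∪ μ.support.biUnion fun e => e.toFinset) with hO
  have hOcard : (O.card : ℝ) ≤ 2 * μ.degree + R.card + 1 := by
    have h1 : (μ.support.biUnion fun e => e.toFinset).card ≤ μ.support.card * 2 := by
      refine Finset.card_biUnion_le_card_mul _ _ _ fun e _ => ?_
      rw [Sym2.card_toFinset]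
      split_ifs <;> omega
    have h2 := card_support_le_degree μ
    have h3 : O.card ≤ 2 * μ.degree + R.card + 1 := by
      refine (Finset.card_insert_le _ _).trans ?_
      have := Finset.card_union_le R (μ.support.biUnion fun e => e.toFinset)
      omega
    exact_mod_cast h3
  have hsupp : ∀ y, (μ + Finsupp.single s(z, y) 1).support = insert s(z, y) μ.support := by
    intro y
    ext e
    simp only [Finsupp.mem_support_iff, Finsupp.add_apply, Finset.mem_insert]
    by_cases he : e = s(z, y)
    · simp [he]
    · simp [he]
  have hW := cycleWeight_nonneg hp R μ
  have hnew : ∀ y ∉ O, cycleWeight p R (μ + Finsupp.single s(z, y) 1)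
      = p / N * cycleWeight p R μ := by
    intro y hy
    simp only [hO, Finset.mem_insert, Finset.mem_union, Finset.mem_biUnion, Sym2.mem_toFinset,
      not_or, not_exists, not_and] at hy
    obtain ⟨-, hyR, hyμ⟩ := hy
    have hnot : s(z, y) ∉ μ.support := fun h => hyμ _ h (by simp)
    have hiff : IsRootedForest R (insert s(z, y) μ.support) ↔ IsRootedForest R μ.support :=
      ⟨fun h => h.anti subset_rfl (Finset.subset_insert _ _),
        fun h => h.insert_of_forall_notMem hyR hyμ⟩
    rw [cycleWeight, cycleWeight, hsupp, Finset.card_insert_of_notMem hnot, pow_succ]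
    by_cases hf : IsRootedForest R μ.support
    · rw [if_pos hf, if_pos (hiff.2 hf)]
      ring
    · rw [if_neg hf, if_neg (mt hiff.1 hf)]
      ring
  have hold : ∀ y, cycleWeight p R (μ + Finsupp.single s(z, y) 1)
      ≤ (1 + p) * cycleWeight p R μ := by
    intro y
    by_cases hmem : s(z, y) ∈ μ.support
    · rw [cycleWeight, hsupp, Finset.insert_eq_of_mem hmem, ← cycleWeight]
      nlinarith
    · have h1 : (p / N) ^ μ.support.card ≤ cycleWeight p R μ := by
        rw [cycleWeight]
        refine le_mul_of_one_le_right (by positivity) ?_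
        split_ifs
        · exact le_rfl
        · exact hN1
      have h2 : cycleWeight p R (μ + Finsupp.single s(z, y) 1) ≤ p * (p / N) ^ μ.support.card := by
        rw [cycleWeight, hsupp, Finset.card_insert_of_notMem hmem]
        calc _ ≤ (p / N) ^ (μ.support.card + 1) * N := by
              refine mul_le_mul_of_nonneg_left ?_ (by positivity)
              split_ifs
              · exact hN1
              · exact le_rfl
          _ = p * (p / N) ^ μ.support.card := by rw [pow_succ]; field_simp
      nlinarith
  calc ∑ y with c z ≠ c y, cycleWeight p R (μ + Finsupp.single s(z, y) 1)
      ≤ ∑ y, cycleWeight p R (μ + Finsupp.single s(z, y) 1) :=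
        Finset.sum_le_sum_of_subset_of_nonneg (Finset.filter_subset _ _)
          fun _ _ _ => cycleWeight_nonneg hp R _
    _ = ∑ y ∈ O, cycleWeight p R (μ + Finsupp.single s(z, y) 1) +
          ∑ y ∈ Oᶜ, cycleWeight p R (μ + Finsupp.single s(z, y) 1) :=
        (Finset.sum_add_sum_compl O _).symm
    _ ≤ O.card * ((1 + p) * cycleWeight p R μ) + N * (p / N * cycleWeight p R μ) := by
        refine add_le_add ?_ ?_
        · refine (Finset.sum_le_sum fun y _ => hold y).trans ?_
          rw [Finset.sum_const, nsmul_eq_mul]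
        · rw [Finset.sum_congr rfl fun y hy => hnew y (Finset.mem_compl.1 hy), Finset.sum_const,
            nsmul_eq_mul]
          refine mul_le_mul_of_nonneg_right ?_ (by positivity)
          have := Finset.card_le_univ Oᶜ
          rw [Fintype.card_fin] at this
          exact_mod_cast this
    _ = (p + O.card * (1 + p)) * cycleWeight p R μ := by field_simp; ring
    _ ≤ _ := by gcongr

theorem sum_cycleWeight_mul_genMatrix_le (hp : 0 < p) (hN : 1 ≤ N) (R : Finset (Fin N)) {k : ℕ}
    {P : EdgePoly (Fin N)} (hP : P ∈ monomialCone (Fin N) k) (z : Fin N) :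
    ∑ y, monomialFunctional (cycleWeight p R) (P * genMatrix c ∅ z y) ≤
      (p + (2 * k + R.card + 1) * (1 + p)) * monomialFunctional (cycleWeight p R) P := by
  induction hP using AddSubmonoid.closure_induction with
  | mem P h =>
    obtain ⟨μ, a, ha, hμ, rfl⟩ := h
    have h1 : ∑ y, monomialFunctional (cycleWeight p R) (monomial μ a * genMatrix c ∅ z y) =
        a * ∑ y with c z ≠ c y, cycleWeight p R (μ + Finsupp.single s(z, y) 1) := by
      rw [Finset.sum_filter, Finset.mul_sum]
      refine Finset.sum_congr rfl fun y _ => ?_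
      rw [genMatrix_empty]
      split_ifs
      · rw [X, monomial_mul, mul_one, monomialFunctional_monomial]
      · simp
    rw [h1, monomialFunctional_monomial]
    have hμ' : (μ.degree : ℝ) ≤ k := by exact_mod_cast hμ
    calc _ ≤ a * ((p + (2 * μ.degree + R.card + 1) * (1 + p)) * cycleWeight p R μ) :=
          mul_le_mul_of_nonneg_left (sum_cycleWeight_le hp hN R μ z) ha
      _ ≤ a * ((p + (2 * k + R.card + 1) * (1 + p)) * cycleWeight p R μ) := by
          have := cycleWeight_nonneg hp R μ
          gcongr
      _ = _ := by ring
  | zero => simp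
  | add P Q _ _ hP hQ =>
    rw [map_add, mul_add]
    refine le_trans (le_of_eq ?_) (add_le_add hP hQ)
    rw [← Finset.sum_add_distrib]
    exact Finset.sum_congr rfl fun y _ => by rw [add_mul, map_add]

theorem mul_genMatrix_pow_mem_monomialCone {k : ℕ} {P : EdgePoly (Fin N)}
    (hP : P ∈ monomialCone (Fin N) k) (s : ℕ) (z y : Fin N) :
    P * (genMatrix c ∅ ^ s) z y ∈ monomialCone (Fin N) (k + s) := by
  induction s generalizing y with
  | zero =>
    rw [pow_zero, Matrix.one_apply]
    split_ifs
    · rwa [mul_one]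
    · rw [mul_zero]; exact zero_mem _
  | succ s ih =>
    rw [pow_succ, Matrix.mul_apply, Finset.mul_sum]
    refine sum_mem fun u _ => ?_
    rw [← mul_assoc, genMatrix_empty]
    split_ifs
    · exact mul_X_mem_monomialCone (ih u) _
    · rw [mul_zero]; exact zero_mem _

/-- A walk of bounded length, whose end point is free, adds only a bounded factor to the weight. -/
theorem sum_cycleWeight_mul_genMatrix_pow_le (hp : 0 < p) (hN : 1 ≤ N) (R : Finset (Fin N)) {k : ℕ}
    {P : EdgePoly (Fin N)} (hP : P ∈ monomialCone (Fin N) k) (s l : ℕ) (hl : k + s ≤ l)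
    (z : Fin N) :
    ∑ y, monomialFunctional (cycleWeight p R) (P * (genMatrix c ∅ ^ s) z y) ≤
      (p + (2 * l + R.card + 1) * (1 + p)) ^ s * monomialFunctional (cycleWeight p R) P := by
  induction s with
  | zero =>
    rw [Finset.sum_eq_single z]
    · simp
    · intro y _ hy
      rw [pow_zero, Matrix.one_apply_ne hy.symm, mul_zero, map_zero]
    · simp
  | succ s ih =>
    have h1 : ∀ y, monomialFunctional (cycleWeight p R) (P * (genMatrix c ∅ ^ (s + 1)) z y) =
        ∑ u, monomialFunctional (cycleWeight p R)
          (P * (genMatrix c ∅ ^ s) z u * genMatrix c ∅ u y) := by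
      intro y
      rw [pow_succ, Matrix.mul_apply, Finset.mul_sum, map_sum]
      simp_rw [mul_assoc]
    simp_rw [h1]
    rw [Finset.sum_comm]
    have h2 : ∀ u ∈ Finset.univ, ∑ y, monomialFunctional (cycleWeight p R)
        (P * (genMatrix c ∅ ^ s) z u * genMatrix c ∅ u y) ≤
        (p + (2 * l + R.card + 1) * (1 + p)) *
          monomialFunctional (cycleWeight p R) (P * (genMatrix c ∅ ^ s) z u) := by
      intro u _
      exact sum_cycleWeight_mul_genMatrix_le hp hN R
        (monomialCone_mono _ (by omega : k + s ≤ l) (mul_genMatrix_pow_mem_monomialCone hP s z u)) u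
    refine (Finset.sum_le_sum h2).trans ?_
    rw [← Finset.mul_sum, pow_succ', mul_assoc]
    exact mul_le_mul_of_nonneg_left (ih (by omega)) (by positivity)

/-- The weight of the walks from `z` to a given end point is bounded in `N`. -/
theorem cycleWeight_mul_genMatrix_pow_le (hp : 0 < p) (hN : 1 ≤ N) (R : Finset (Fin N)) {k : ℕ}
    {P : EdgePoly (Fin N)} (hP : P ∈ monomialCone (Fin N) k) (s l : ℕ) (hl : k + s ≤ l)
    (z y : Fin N) :
    monomialFunctional (cycleWeight p R) (P * (genMatrix c ∅ ^ s) z y) ≤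
      (p + (2 * l + R.card + 1) * (1 + p)) ^ s * monomialFunctional (cycleWeight p R) P :=
  (Finset.single_le_sum
    (f := fun y => monomialFunctional (cycleWeight p R) (P * (genMatrix c ∅ ^ s) z y))
    (fun y _ => monomialFunctional_cycleWeight_nonneg hp R
      (mul_genMatrix_pow_mem_monomialCone hP s z y)) (Finset.mem_univ y)).trans
    (sum_cycleWeight_mul_genMatrix_pow_le hp hN R hP s l hl z)

theorem monomialFunctional_cycleWeight_one (R : Finset (Fin N)) (z : Fin N) :
    monomialFunctional (cycleWeight p R) 1 = 1 := by
  have : Nonempty (Fin N) := ⟨z⟩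
  rw [show (1 : EdgePoly (Fin N)) = monomial 0 1 from rfl, monomialFunctional_monomial,
    cycleWeight, if_pos (by simpa using isRootedForest_empty R)]
  simp

theorem abs_edgeWeight_le (hp : 0 < p) (X' : ℕ → ℝ) {k : ℕ} {μ : Sym2 (Fin N) →₀ ℕ}
    (hμ : μ.degree ≤ k) : |edgeWeight (p / N) X' μ| ≤
      (1 + ∑ j ∈ Finset.range (k + 1), |X' j|) ^ k * (p / N) ^ μ.support.card := by
  set B := 1 + ∑ j ∈ Finset.range (k + 1), |X' j| with hB
  have hB1 : 1 ≤ B := by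
    have : 0 ≤ ∑ j ∈ Finset.range (k + 1), |X' j| := by positivity
    linarith
  rw [edgeWeight, Finset.abs_prod]
  calc ∏ e ∈ μ.support, |p / N * X' (μ e)| ≤ ∏ e ∈ μ.support, (p / N * B) := by
        refine Finset.prod_le_prod (fun _ _ => abs_nonneg _) fun e _ => ?_
        rw [abs_mul, abs_of_nonneg (by positivity : 0 ≤ p / N)]
        refine mul_le_mul_of_nonneg_left ?_ (by positivity)
        have h1 : μ e ≤ k := (Finsupp.le_degree e μ).trans hμ
        have h2 := Finset.single_le_sum (f := fun j => |X' j|) (fun _ _ => abs_nonneg _)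
          (Finset.mem_range.2 (Nat.lt_succ_of_le h1))
        rw [hB]
        have h3 : |X' (μ e)| ≤ ∑ j ∈ Finset.range (k + 1), |X' j| := h2
        linarith
    _ = B ^ μ.support.card * (p / N) ^ μ.support.card := by
        rw [Finset.prod_const, mul_pow, mul_comm]
    _ ≤ B ^ k * (p / N) ^ μ.support.card := by
        refine mul_le_mul_of_nonneg_right ?_ (by positivity)
        exact pow_le_pow_right₀ hB1 ((card_support_le_degree μ).trans hμ)

/-- A monomial with a cycle has expectation of the order of `1 / N` times its `cycleWeight`. -/
theorem abs_edgeExp_sub_forestExp_le (hp : 0 < p) (hN : 1 ≤ N) (X' : ℕ → ℝ) (R : Finset (Fin N))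
    {k : ℕ} {P : EdgePoly (Fin N)} (hP : P ∈ monomialCone (Fin N) k) :
    |edgeExp (p / N) X' P - forestExp (p / N) X' R P| ≤
      (1 + ∑ j ∈ Finset.range (k + 1), |X' j|) ^ k *
        monomialFunctional (cycleWeight p R) P / N := by
  have hN0 : (0 : ℝ) < N := by exact_mod_cast hN
  induction hP using AddSubmonoid.closure_induction with
  | mem P h =>
    obtain ⟨μ, a, ha, hμ, rfl⟩ := h
    rw [edgeExp, forestExp, monomialFunctional_monomial, monomialFunctional_monomial,
      monomialFunctional_monomial, cycleWeight]
    split_ifs with hf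
    · rw [sub_self, abs_zero]; positivity
    · rw [mul_zero, sub_zero, abs_mul, abs_of_nonneg ha]
      calc a * |edgeWeight (p / N) X' μ| ≤ a * ((1 + ∑ j ∈ Finset.range (k + 1), |X' j|) ^ k *
            (p / N) ^ μ.support.card) := by
            gcongr; exact abs_edgeWeight_le hp X' hμ
        _ = _ := by field_simp
  | zero => simp
  | add P Q _ _ hP hQ =>
    rw [map_add, map_add, map_add, mul_add, add_div]
    refine le_trans (le_of_eq ?_) ((abs_add_le _ _).trans (add_le_add hP hQ))
    congr 1
    ring

theorem abs_edgeExp_le (hp : 0 < p) (hN : 1 ≤ N) (X' : ℕ → ℝ) (R : Finset (Fin N))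
    {k : ℕ} {P : EdgePoly (Fin N)} (hP : P ∈ monomialCone (Fin N) k) :
    |edgeExp (p / N) X' P| ≤
      (1 + ∑ j ∈ Finset.range (k + 1), |X' j|) ^ k * monomialFunctional (cycleWeight p R) P := by
  have hN1 : (1 : ℝ) ≤ N := by exact_mod_cast hN
  induction hP using AddSubmonoid.closure_induction with
  | mem P h =>
    obtain ⟨μ, a, ha, hμ, rfl⟩ := h
    rw [edgeExp, monomialFunctional_monomial, monomialFunctional_monomial, abs_mul,
      abs_of_nonneg ha]
    calc a * |edgeWeight (p / N) X' μ| ≤ a * ((1 + ∑ j ∈ Finset.range (k + 1), |X' j|) ^ k *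
          (p / N) ^ μ.support.card) := by
          gcongr; exact abs_edgeWeight_le hp X' hμ
      _ ≤ a * ((1 + ∑ j ∈ Finset.range (k + 1), |X' j|) ^ k * cycleWeight p R μ) := by
          gcongr
          rw [cycleWeight]
          refine le_mul_of_one_le_right (by positivity) ?_
          split_ifs
          · exact le_rfl
          · exact hN1
      _ = _ := by ring
  | zero => simp
  | add P Q _ _ hP hQ =>
    rw [map_add, map_add, mul_add]
    exact (abs_add_le _ _).trans (add_le_add hP hQ)

end Excess

/-! ### Convergence of the expected spectral moments and of their squares -/

section Trace

open MvPolynomial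

variable {p α : ℝ} {N : ℕ} {c : Fin N → Bool}

/-- The limit of the expected weighted number of closed walks of length `s` at a vertex of colour `b`. -/
noncomputable def vertexMoment (p α : ℝ) (X : ℕ → ℝ) (b : Bool) (s : ℕ) : ℝ :=
  ∑ r ∈ Finset.range (s + 1), rootMoment p α X b s r

theorem colourWeight_mul_vertexMoment (hα : α ∈ Set.Ioo (0 : ℝ) 1) (X : ℕ → ℝ) (s : ℕ) :
    colourWeight α true * vertexMoment p α X true s +
      colourWeight α false * vertexMoment p α X false s = limitMoment p α X s := by
  by_cases hs : Even s
  · obtain ⟨k, rfl⟩ : ∃ k, s = 2 * k := ⟨s / 2, by obtain ⟨k, rfl⟩ := hs; omega⟩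
    have h1 : ∀ b, colourWeight α b * vertexMoment p α X b (2 * k) =
        ∑ i ∈ Finset.Icc 0 k, coupledS p α X b k i := by
      intro b
      have hsub : Finset.Icc 0 k ⊆ Finset.range (2 * k + 1) := by
        intro i hi
        have := (Finset.mem_Icc.1 hi).2
        exact Finset.mem_range.2 (by omega)
      rw [vertexMoment, ← Finset.sum_subset hsub, Finset.mul_sum]
      · refine Finset.sum_congr rfl fun i _ => ?_
        rw [rootMoment_two_mul, mul_div_cancel₀ _ (colourWeight_pos hα b).ne']
      · intro i _ hi
        refine rootMoment_of_lt _ _ _ _ ?_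
        simp only [Finset.mem_Icc, zero_le, true_and, not_le] at hi
        omega
    rw [h1, h1, limitMoment_two_mul, ← Finset.sum_add_distrib]
    rfl
  · have h1 : ∀ b, vertexMoment p α X b s = 0 := fun b =>
      Finset.sum_eq_zero fun r _ => rootMoment_of_odd _ _ _ _ hs r
    rw [h1, h1, limitMoment, if_neg hs]
    simp

theorem mk_genMatrix_pow_apply_self (s : ℕ) (x : Fin N) :
    Ideal.Quotient.mk (cycleIdeal {x}) ((genMatrix c ∅ ^ s) x x) =
      Ideal.Quotient.mk (cycleIdeal {x}) (∑ r ∈ Finset.range (s + 1),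
        PowerSeries.coeff s (excursionSeries c {x} x ^ r)) := by
  have h := mk_coeff_walkSeries_pow (c := c) (U := ∅) (Finset.notMem_empty x) 0 s
  rw [zero_add, pow_one, coeff_walkSeries] at h
  rw [insert_empty_eq] at h
  simpa only [zero_add, Nat.choose_zero_right, Nat.cast_one, one_mul] using h

theorem forestExp_genMatrix_pow (q : ℝ) (X' : ℕ → ℝ) (s : ℕ) (x : Fin N) :
    forestExp q X' {x} ((genMatrix c ∅ ^ s) x x) =
      ∑ r ∈ Finset.range (s + 1), forestMoment c q X' {x} (fun _ => s) (fun _ => r) := by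
  rw [forestExp_congr q X' (mk_genMatrix_pow_apply_self s x), map_sum]
  refine Finset.sum_congr rfl fun r _ => ?_
  rw [forestMoment, Finset.prod_singleton]

theorem mk_genMatrix_pow_apply_self_pair (s : ℕ) {x y : Fin N} (hxy : x ≠ y) :
    Ideal.Quotient.mk (cycleIdeal {x, y}) ((genMatrix c ∅ ^ s) y y) =
      Ideal.Quotient.mk (cycleIdeal {x, y}) (∑ r ∈ Finset.range (s + 1),
        PowerSeries.coeff s (excursionSeries c {x, y} y ^ r)) := by
  have h1 := Ideal.Quotient.eq.1 (mk_genMatrix_pow_apply_self (c := c) s y)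
  have hle : cycleIdeal {y} ≤ cycleIdeal {x, y} := cycleIdeal_mono (by simp)
  rw [Ideal.Quotient.eq.2 (hle h1), map_sum, map_sum]
  refine Finset.sum_congr rfl fun r _ => ?_
  exact mk_coeff_pow_eq_of_map_eq _
    (map_excursionSeries (Finset.mem_singleton_self y) (by simpa using hxy)) r s

theorem forestExp_genMatrix_pow_mul (q : ℝ) (X' : ℕ → ℝ) (s : ℕ) {x y : Fin N} (hxy : x ≠ y) :
    forestExp q X' {x, y} ((genMatrix c ∅ ^ s) x x * (genMatrix c ∅ ^ s) y y) =
      ∑ r ∈ Finset.range (s + 1), ∑ r' ∈ Finset.range (s + 1),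
        forestMoment c q X' {x, y} (fun _ => s) (fun z => if z = x then r else r') := by
  have h1 := mk_genMatrix_pow_apply_self_pair (c := c) s hxy
  have h2 := mk_genMatrix_pow_apply_self_pair (c := c) s hxy.symm
  rw [Finset.pair_comm] at h2
  have h3 : Ideal.Quotient.mk (cycleIdeal {x, y})
      ((genMatrix c ∅ ^ s) x x * (genMatrix c ∅ ^ s) y y) =
      Ideal.Quotient.mk (cycleIdeal {x, y})
        ((∑ r ∈ Finset.range (s + 1), PowerSeries.coeff s (excursionSeries c {x, y} x ^ r)) *
        ∑ r ∈ Finset.range (s + 1), PowerSeries.coeff s (excursionSeries c {x, y} y ^ r)) := by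
    rw [map_mul, h1, h2, ← map_mul]
  rw [forestExp_congr q X' h3, Finset.sum_mul_sum, map_sum]
  refine Finset.sum_congr rfl fun r _ => ?_
  rw [map_sum]
  refine Finset.sum_congr rfl fun r' _ => ?_
  rw [forestMoment, Finset.prod_pair hxy, if_pos rfl, if_neg hxy.symm]

variable (X : ℕ → ℝ)

/-- The expected weighted number of closed walks at a vertex converges to the limit for its colour. -/
theorem exists_abs_edgeExp_pow_sub_le (hp : 0 < p) (hα : α ∈ Set.Ioo (0 : ℝ) 1) (s : ℕ) :
    ∃ C : ℝ, 0 ≤ C ∧ ∀ (N : ℕ), 1 ≤ N → ∀ c : Fin N → Bool,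
      (∀ b, |((Finset.univ.filter fun x => c x = b).card : ℝ) - colourWeight α b * N| ≤ 1) →
      ∀ x, |edgeExp (p / N) X ((genMatrix c ∅ ^ s) x x) - vertexMoment p α X (c x) s| ≤ C / N := by
  obtain ⟨C, hC0, hC⟩ := exists_abs_forestMoment_sub_le hp hα X s 1 s
  refine ⟨(1 + ∑ j ∈ Finset.range (s + 1), |X j|) ^ s *
    (p + (2 * s + 1 + 1) * (1 + p)) ^ s + (s + 1) * C, by positivity, fun N hN c hc x => ?_⟩
  have hmem := mul_genMatrix_pow_mem_monomialCone (c := c) (one_mem_monomialCone (Fin N)) s x x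
  have hle := cycleWeight_mul_genMatrix_pow_le (c := c) hp hN {x} (one_mem_monomialCone (Fin N))
    s s (by omega) x x
  rw [monomialFunctional_cycleWeight_one _ x, mul_one] at hle
  rw [one_mul] at hmem hle
  rw [zero_add] at hmem
  have h1 := abs_edgeExp_sub_forestExp_le hp hN X {x} hmem
  have h2 : |forestExp (p / N) X {x} ((genMatrix c ∅ ^ s) x x) - vertexMoment p α X (c x) s| ≤
      (s + 1) * C / N := by
    rw [forestExp_genMatrix_pow, vertexMoment, ← Finset.sum_sub_distrib]
    refine (Finset.abs_sum_le_sum_abs _ _).trans ((Finset.sum_le_card_nsmul _ _ (C / N)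
      fun r hr => ?_).trans (le_of_eq ?_))
    · have := hC N hN c hc {x} (fun _ => s) (fun _ => r) (by simp) (by simp)
        (fun _ _ => Nat.lt_succ_iff.1 (Finset.mem_range.1 hr))
      rwa [Finset.prod_singleton] at this
    · rw [Finset.card_range, nsmul_eq_mul]; push_cast; ring
  rw [Finset.card_singleton, Nat.cast_one] at hle
  calc _ ≤ |edgeExp (p / N) X ((genMatrix c ∅ ^ s) x x) -
          forestExp (p / N) X {x} ((genMatrix c ∅ ^ s) x x)| +
        |forestExp (p / N) X {x} ((genMatrix c ∅ ^ s) x x) - vertexMoment p α X (c x) s| :=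
        abs_sub_le _ _ _
    _ ≤ (1 + ∑ j ∈ Finset.range (s + 1), |X j|) ^ s *
        (p + (2 * s + 1 + 1) * (1 + p)) ^ s / N + (s + 1) * C / N := by
        refine add_le_add (h1.trans ?_) h2
        gcongr
    _ = _ := by ring

/-- Closed walks at two different vertices are asymptotically uncorrelated. -/
theorem exists_abs_edgeExp_pow_mul_pow_sub_le (hp : 0 < p) (hα : α ∈ Set.Ioo (0 : ℝ) 1) (s : ℕ) :
    ∃ C : ℝ, 0 ≤ C ∧ ∀ (N : ℕ), 1 ≤ N → ∀ c : Fin N → Bool,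
      (∀ b, |((Finset.univ.filter fun x => c x = b).card : ℝ) - colourWeight α b * N| ≤ 1) →
      ∀ x y, |edgeExp (p / N) X ((genMatrix c ∅ ^ s) x x * (genMatrix c ∅ ^ s) y y) -
        vertexMoment p α X (c x) s * vertexMoment p α X (c y) s| ≤
          if x = y then C else C / N := by
  obtain ⟨C, hC0, hC⟩ := exists_abs_forestMoment_sub_le hp hα X (2 * s) 2 s
  set A : ℝ := (1 + ∑ j ∈ Finset.range (2 * s + 1), |X j|) ^ (2 * s) *
    ((p + (2 * (2 * s : ℕ) + 2 + 1) * (1 + p)) ^ s *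
      (p + (2 * (2 * s : ℕ) + 2 + 1) * (1 + p)) ^ s) with hA
  have hA0 : 0 ≤ A := by positivity
  set Γ : ℝ := (|vertexMoment p α X true s| + |vertexMoment p α X false s|) ^ 2 with hΓ
  have hΓ0 : 0 ≤ Γ := by positivity
  refine ⟨A + (s + 1) * ((s + 1) * C) + Γ, by positivity, fun N hN c hc x y => ?_⟩
  have hN0 : (0 : ℝ) < N := by exact_mod_cast hN
  have hmem1 := mul_genMatrix_pow_mem_monomialCone (c := c) (one_mem_monomialCone (Fin N)) s x x
  rw [one_mul, zero_add] at hmem1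
  have hmem := mul_genMatrix_pow_mem_monomialCone (c := c) hmem1 s y y
  rw [← two_mul] at hmem
  have hle : monomialFunctional (cycleWeight p {x, y})
      ((genMatrix c ∅ ^ s) x x * (genMatrix c ∅ ^ s) y y) ≤
      (p + (2 * (2 * s : ℕ) + 2 + 1) * (1 + p)) ^ s *
        (p + (2 * (2 * s : ℕ) + 2 + 1) * (1 + p)) ^ s := by
    have h1 := cycleWeight_mul_genMatrix_pow_le (c := c) hp hN {x, y}
      (one_mem_monomialCone (Fin N)) s (2 * s) (by omega) x x
    rw [monomialFunctional_cycleWeight_one _ x, mul_one, one_mul] at h1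
    have h2 := cycleWeight_mul_genMatrix_pow_le (c := c) hp hN {x, y} hmem1 s (2 * s) (by omega) y y
    have hcard : (({x, y} : Finset (Fin N)).card : ℝ) ≤ 2 := by
      exact_mod_cast Finset.card_le_two
    refine h2.trans ((mul_le_mul_of_nonneg_left h1 (by positivity)).trans ?_)
    gcongr
  split_ifs with hxy
  · have h1 := abs_edgeExp_le hp hN X {x, y} hmem
    have h2 : |edgeExp (p / N) X ((genMatrix c ∅ ^ s) x x * (genMatrix c ∅ ^ s) y y)| ≤ A :=
      h1.trans (by rw [hA]; gcongr)
    have h3 : ∀ b, |vertexMoment p α X b s| ≤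
        |vertexMoment p α X true s| + |vertexMoment p α X false s| := by
      intro b
      cases b
      · exact le_add_of_nonneg_left (abs_nonneg _)
      · exact le_add_of_nonneg_right (abs_nonneg _)
    have h4 : |vertexMoment p α X (c x) s * vertexMoment p α X (c y) s| ≤ Γ := by
      rw [abs_mul, hΓ, sq]
      exact mul_le_mul (h3 _) (h3 _) (abs_nonneg _) (by positivity)
    have h5 : 0 ≤ (s + 1 : ℝ) * ((s + 1) * C) := by positivity
    refine (abs_sub _ _).trans ?_
    linarith
  · have h1 := abs_edgeExp_sub_forestExp_le hp hN X {x, y} hmem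
    have h2 : |forestExp (p / N) X {x, y} ((genMatrix c ∅ ^ s) x x * (genMatrix c ∅ ^ s) y y) -
        vertexMoment p α X (c x) s * vertexMoment p α X (c y) s| ≤
        (s + 1) * ((s + 1) * C) / N := by
      rw [forestExp_genMatrix_pow_mul _ _ _ hxy, vertexMoment, vertexMoment, Finset.sum_mul_sum,
        ← Finset.sum_sub_distrib]
      refine (Finset.abs_sum_le_sum_abs _ _).trans ((Finset.sum_le_card_nsmul _ _
        ((s + 1) * C / N) fun r hr => ?_).trans (le_of_eq ?_))
      · rw [← Finset.sum_sub_distrib]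
        refine (Finset.abs_sum_le_sum_abs _ _).trans ((Finset.sum_le_card_nsmul _ _
          (C / N) fun r' hr' => ?_).trans (le_of_eq ?_))
        · have := hC N hN c hc {x, y} (fun _ => s) (fun z => if z = x then r else r')
            (Finset.card_pair hxy) (by rw [Finset.sum_pair hxy]; omega)
            (fun z _ => by
              have h3 := Finset.mem_range.1 hr
              have h4 := Finset.mem_range.1 hr'
              split_ifs <;> omega)
          rwa [Finset.prod_pair hxy, if_pos rfl, if_neg (Ne.symm hxy)] at this
        · rw [Finset.card_range, nsmul_eq_mul]; push_cast; ring
      · rw [Finset.card_range, nsmul_eq_mul]; push_cast; ring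
    calc _ ≤ |edgeExp (p / N) X ((genMatrix c ∅ ^ s) x x * (genMatrix c ∅ ^ s) y y) -
          forestExp (p / N) X {x, y} ((genMatrix c ∅ ^ s) x x * (genMatrix c ∅ ^ s) y y)| +
        |forestExp (p / N) X {x, y} ((genMatrix c ∅ ^ s) x x * (genMatrix c ∅ ^ s) y y) -
          vertexMoment p α X (c x) s * vertexMoment p α X (c y) s| := abs_sub_le _ _ _
      _ ≤ A / N + (s + 1) * ((s + 1) * C) / N := by
          refine add_le_add (h1.trans ?_) h2
          rw [hA]
          gcongr
      _ = (A + (s + 1) * ((s + 1) * C)) / N := by ring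
      _ ≤ _ := by
          exact div_le_div_of_nonneg_right (by linarith) hN0.le

end Trace

section TraceVariance

open MvPolynomial

variable {p α : ℝ}

theorem edgeExp_one {V : Type*} (q : ℝ) (X : ℕ → ℝ) : edgeExp q X (1 : EdgePoly V) = 1 := by
  rw [show (1 : EdgePoly V) = monomial 0 1 from rfl, edgeExp, monomialFunctional_monomial,
    edgeWeight]
  simp

theorem sum_colour_eq {N : ℕ} (c : Fin N → Bool) (v : Bool → ℝ) :
    ∑ x, v (c x) = (Finset.univ.filter fun x => c x = true).card * v true +
      (Finset.univ.filter fun x => c x = false).card * v false := by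
  have h : ∀ x, v (c x) = (if c x = true then v true else 0) +
      (if c x = false then v false else 0) := by
    intro x
    cases c x <;> simp
  rw [Finset.sum_congr rfl fun x _ => h x, Finset.sum_add_distrib, ← Finset.sum_filter,
    ← Finset.sum_filter, Finset.sum_const, Finset.sum_const, nsmul_eq_mul, nsmul_eq_mul]

/-- The normalized trace of the `s`-th power of the generic bipartite matrix concentrates at
`limitMoment p α X s`: the mean square deviation is of order `1 / N`. -/
theorem exists_edgeExp_sq_trace_sub_le (hp : 0 < p) (hα : α ∈ Set.Ioo (0 : ℝ) 1) (X : ℕ → ℝ)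
    (s : ℕ) : ∃ K : ℝ, 0 ≤ K ∧ ∀ (N : ℕ), 1 ≤ N → ∀ c : Fin N → Bool,
      (∀ b, |((Finset.univ.filter fun x => c x = b).card : ℝ) - colourWeight α b * N| ≤ 1) →
      edgeExp (p / N) X (((N : ℝ)⁻¹ • (genMatrix c ∅ ^ s).trace - C (limitMoment p α X s)) ^ 2) ≤
        K / N := by
  obtain ⟨C₁, hC₁0, hC₁⟩ := exists_abs_edgeExp_pow_sub_le X hp hα s
  obtain ⟨C₂, hC₂0, hC₂⟩ := exists_abs_edgeExp_pow_mul_pow_sub_le X hp hα s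
  set v : Bool → ℝ := fun b => vertexMoment p α X b s with hv
  set m := limitMoment p α X s with hm
  set B := |v true| + |v false| with hB
  have hB0 : 0 ≤ B := by positivity
  refine ⟨B ^ 2 + 2 * C₂ + 2 * |m| * C₁, by positivity, fun N hN c hc => ?_⟩
  have hN0 : (0 : ℝ) < N := by exact_mod_cast hN
  have hN1 : (1 : ℝ) ≤ N := by exact_mod_cast hN
  set M := genMatrix c ∅ ^ s with hM
  set D := (N : ℝ)⁻¹ * ∑ x, v (c x) - m with hD
  have hDle : |D| ≤ B / N := by
    have h1 : D = (N : ℝ)⁻¹ *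
        ((((Finset.univ.filter fun x => c x = true).card : ℝ) - colourWeight α true * N) * v true +
        (((Finset.univ.filter fun x => c x = false).card : ℝ) - colourWeight α false * N) *
          v false) := by
      rw [hD, sum_colour_eq, hm, ← colourWeight_mul_vertexMoment hα]
      simp only [hv]
      field_simp
      ring
    rw [h1, abs_mul, abs_of_pos (by positivity : (0 : ℝ) < (N : ℝ)⁻¹), div_eq_inv_mul]
    refine mul_le_mul_of_nonneg_left ((abs_add_le _ _).trans ?_) (by positivity)
    rw [abs_mul, abs_mul]
    exact add_le_add (mul_le_of_le_one_left (abs_nonneg _) (hc true))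
      (mul_le_of_le_one_left (abs_nonneg _) (hc false))
  have hT : |(N : ℝ)⁻¹ * edgeExp (p / N) X M.trace - (N : ℝ)⁻¹ * ∑ x, v (c x)| ≤ C₁ / N := by
    rw [← mul_sub, abs_mul, abs_of_pos (by positivity : (0 : ℝ) < (N : ℝ)⁻¹), Matrix.trace, map_sum,
      ← Finset.sum_sub_distrib]
    calc (N : ℝ)⁻¹ * |∑ x, (edgeExp (p / N) X (M.diag x) - v (c x))|
        ≤ (N : ℝ)⁻¹ * ∑ x : Fin N, C₁ / N := by
          refine mul_le_mul_of_nonneg_left ((Finset.abs_sum_le_sum_abs _ _).trans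
            (Finset.sum_le_sum fun x _ => hC₁ N hN c hc x)) (by positivity)
      _ = C₁ / N := by
          rw [Finset.sum_const, Finset.card_univ, Fintype.card_fin, nsmul_eq_mul]
          field_simp
  have hT2 : |(N : ℝ)⁻¹ ^ 2 * edgeExp (p / N) X (M.trace * M.trace) -
      ((N : ℝ)⁻¹ * ∑ x, v (c x)) ^ 2| ≤ 2 * C₂ / N := by
    rw [mul_pow, ← mul_sub, abs_mul, abs_of_pos (by positivity : (0 : ℝ) < (N : ℝ)⁻¹ ^ 2),
      Matrix.trace, Finset.sum_mul_sum, sq (∑ x, v (c x)), Finset.sum_mul_sum, map_sum,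
      ← Finset.sum_sub_distrib]
    have h1 : ∀ x : Fin N, |edgeExp (p / N) X (∑ y, M.diag x * M.diag y) -
        ∑ y, v (c x) * v (c y)| ≤ 2 * C₂ := by
      intro x
      rw [map_sum, ← Finset.sum_sub_distrib]
      calc _ ≤ ∑ y, |edgeExp (p / N) X (M.diag x * M.diag y) - v (c x) * v (c y)| :=
            Finset.abs_sum_le_sum_abs _ _
        _ ≤ ∑ y : Fin N, ((if x = y then C₂ else 0) + C₂ / N) := by
            refine Finset.sum_le_sum fun y _ => (hC₂ N hN c hc x y).trans ?_
            split_ifs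
            · exact le_add_of_nonneg_right (by positivity)
            · rw [zero_add]
        _ = 2 * C₂ := by
            rw [Finset.sum_add_distrib, Finset.sum_ite_eq, if_pos (Finset.mem_univ x),
              Finset.sum_const, Finset.card_univ, Fintype.card_fin, nsmul_eq_mul]
            field_simp
            ring
    calc _ ≤ (N : ℝ)⁻¹ ^ 2 * ∑ x : Fin N, 2 * C₂ := by
          refine mul_le_mul_of_nonneg_left ((Finset.abs_sum_le_sum_abs _ _).trans
            (Finset.sum_le_sum fun x _ => h1 x)) (by positivity)
      _ = 2 * C₂ / N := by
          rw [Finset.sum_const, Finset.card_univ, Fintype.card_fin, nsmul_eq_mul]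
          field_simp
  have hexp : edgeExp (p / N) X (((N : ℝ)⁻¹ • M.trace - C m) ^ 2) =
      (N : ℝ)⁻¹ ^ 2 * edgeExp (p / N) X (M.trace * M.trace) -
        2 * m * ((N : ℝ)⁻¹ * edgeExp (p / N) X M.trace) + m ^ 2 := by
    have h1 : ((N : ℝ)⁻¹ • M.trace - C m) ^ 2 = (N : ℝ)⁻¹ ^ 2 • (M.trace * M.trace) -
        (2 * m * (N : ℝ)⁻¹) • M.trace + m ^ 2 • (1 : EdgePoly (Fin N)) := by
      simp only [smul_eq_C_mul, map_mul, map_pow, map_ofNat]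
      ring
    rw [h1, map_add, map_sub, map_smul, map_smul, map_smul, edgeExp_one]
    simp only [smul_eq_mul]
    ring
  have hD2 : D ^ 2 ≤ B ^ 2 / N := by
    calc D ^ 2 = |D| ^ 2 := (sq_abs D).symm
      _ ≤ (B / N) ^ 2 := pow_le_pow_left₀ (abs_nonneg _) hDle 2
      _ ≤ B ^ 2 / N := by
          rw [div_pow]
          refine div_le_div_of_nonneg_left (by positivity) hN0 ?_
          nlinarith
  have hcross : -(2 * m * ((N : ℝ)⁻¹ * edgeExp (p / N) X M.trace - (N : ℝ)⁻¹ * ∑ x, v (c x))) ≤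
      2 * |m| * (C₁ / N) := by
    refine (neg_le_abs _).trans ?_
    rw [abs_mul, abs_mul, abs_two]
    exact mul_le_mul_of_nonneg_left hT (by positivity)
  have hsum : (N : ℝ)⁻¹ * ∑ x, v (c x) = m + D := by rw [hD]; ring
  rw [hexp]
  rw [hsum] at hT2 hcross
  have h3 := (abs_le.1 hT2).2
  calc _ ≤ 2 * C₂ / N + B ^ 2 / N + 2 * |m| * (C₁ / N) := by nlinarith
    _ = _ := by ring

end TraceVariance

/-! ### The expectation of a polynomial in the matrix entries -/

section Expectation

open MvPolynomial

theorem integrable_prod_of_iIndepFun {ι Ω : Type*} [Fintype ι] [MeasurableSpace Ω] {P : Measure Ω}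
    {Y : ι → Ω → ℝ} (hY : iIndepFun Y P) (hint : ∀ i, Integrable (Y i) P) :
    Integrable (fun ω => ∏ i, Y i ω) P := by
  have := hY.isProbabilityMeasure
  have hm : ∀ i, AEMeasurable (Y i) P := fun i => (hint i).aemeasurable
  have h1 : Integrable (fun x : ι → ℝ => ∏ i, x i) (P.map fun ω i => Y i ω) := by
    rw [hY.map_fun_eq_pi_map hm]
    have : ∀ i, SigmaFinite (P.map (Y i)) := fun i => by
      have := Measure.isProbabilityMeasure_map (hm i)
      infer_instance
    refine Integrable.fintype_prod (f := fun _ x => x) fun i => ?_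
    exact (integrable_map_measure aestronglyMeasurable_id (hm i)).2 (hint i)
  exact h1.comp_aemeasurable (aemeasurable_pi_lambda _ hm)

variable {Ω : Type*} {a : Sym2 ℕ → Ω → ℝ} {d : (N : ℕ) → Sym2 (Fin N) → Ω → ℝ}

/-- The entry `a_e d_e` of the matrix. -/
def edgeEntry (a : Sym2 ℕ → Ω → ℝ) (d : (N : ℕ) → Sym2 (Fin N) → Ω → ℝ) (N : ℕ) (ω : Ω)
    (e : Sym2 (Fin N)) : ℝ :=
  a (e.map Fin.val) ω * d N e ω

/-- The colouring of the vertices: `true` for the first part. -/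
noncomputable def partColour (α : ℝ) (N : ℕ) (i : Fin N) : Bool := decide (InFirstPart α N i)

theorem bipartiteMatrix_eq_map_genMatrix (α : ℝ) (N : ℕ) (ω : Ω) :
    bipartiteMatrix α N (fun e => a e ω) (fun e => d N e ω) =
      (genMatrix (partColour α N) ∅).map (aeval (edgeEntry a d N ω)) := by
  ext i j
  rw [Matrix.map_apply, genMatrix_empty, bipartiteMatrix]
  by_cases hi : InFirstPart α N i <;> by_cases hj : InFirstPart α N j <;>
    simp [partColour, hi, hj, edgeEntry]

theorem trace_bipartiteMatrix_pow (α : ℝ) (N : ℕ) (ω : Ω) (s : ℕ) :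
    (bipartiteMatrix α N (fun e => a e ω) (fun e => d N e ω) ^ s).trace =
      aeval (edgeEntry a d N ω) (genMatrix (partColour α N) ∅ ^ s).trace := by
  have h := map_pow (AlgHom.mapMatrix (aeval (edgeEntry a d N ω))) (genMatrix (partColour α N) ∅) s
  rw [AlgHom.mapMatrix_apply, AlgHom.mapMatrix_apply] at h
  rw [bipartiteMatrix_eq_map_genMatrix, AddMonoidHom.map_trace, h]

variable [MeasurableSpace Ω] {P : Measure Ω} {p : ℝ} {X : ℕ → ℝ}

theorem IsSparseModel.moment_two_mul_nonneg (h : IsSparseModel P p X a d) (f : ℕ) :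
    0 ≤ X (2 * f) := by
  rw [← h.moment_weight s(0, 0) (2 * f)]
  exact integral_nonneg fun ω => by
    simp only [pow_mul]
    positivity

variable [IsProbabilityMeasure P]

theorem IsSparseModel.moment_zero (h : IsSparseModel P p X a d) : X 0 = 1 := by
  rw [← h.moment_weight s(0, 0) 0]
  simp

theorem IsSparseModel.edge_pow_ae_eq (h : IsSparseModel P p X a d) {N : ℕ} (hN : p ≤ N)
    (e : Sym2 (Fin N)) {k : ℕ} (hk : k ≠ 0) :
    (fun ω => d N e ω ^ k) =ᵐ[P] Set.indicator {ω | d N e ω = 1} 1 := by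
  have hm1 : MeasurableSet {ω | d N e ω = 1} :=
    h.measurable_edge N hN e (measurableSet_singleton 1)
  have hm0 : MeasurableSet {ω | d N e ω = 0} :=
    h.measurable_edge N hN e (measurableSet_singleton 0)
  have hdisj : Disjoint {ω | d N e ω = 1} {ω | d N e ω = 0} := by
    rw [Set.disjoint_left]
    intro ω h1 h0
    exact one_ne_zero (Eq.trans (Eq.symm h1) h0)
  have h1 : P.real ({ω | d N e ω = 1} ∪ {ω | d N e ω = 0}) = 1 := by
    rw [measureReal_union hdisj hm0, h.prob_one N hN, h.prob_zero N hN]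
    ring
  have h2 : ∀ᵐ ω ∂P, ω ∈ {ω | d N e ω = 1} ∪ {ω | d N e ω = 0} := by
    have h3 : P ({ω | d N e ω = 1} ∪ {ω | d N e ω = 0}) = 1 := by
      rw [← ofReal_measureReal, h1, ENNReal.ofReal_one]
    exact (prob_compl_eq_zero_iff (hm1.union hm0)).2 h3
  filter_upwards [h2] with ω hω
  rcases hω with hω | hω
  · rw [Set.indicator_of_mem hω, show d N e ω = 1 from hω, one_pow, Pi.one_apply]
  · rw [Set.indicator_of_notMem, show d N e ω = 0 from hω, zero_pow hk]
    exact fun h' => Set.disjoint_left.1 hdisj h' hω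

theorem IsSparseModel.integrable_edge_pow (h : IsSparseModel P p X a d) {N : ℕ} (hN : p ≤ N)
    (e : Sym2 (Fin N)) (k : ℕ) : Integrable (fun ω => d N e ω ^ k) P := by
  rcases eq_or_ne k 0 with rfl | hk
  · simp
  · rw [integrable_congr (h.edge_pow_ae_eq hN e hk)]
    exact (integrable_const (1 : ℝ)).indicator (h.measurable_edge N hN e (measurableSet_singleton 1))

theorem IsSparseModel.integral_edge_pow (h : IsSparseModel P p X a d) {N : ℕ} (hN : p ≤ N)
    (e : Sym2 (Fin N)) (k : ℕ) : ∫ ω, d N e ω ^ k ∂P = if k = 0 then 1 else p / N := by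
  split_ifs with hk
  · simp [hk]
  · have hm : MeasurableSet {ω | d N e ω = 1} :=
      h.measurable_edge N hN e (measurableSet_singleton 1)
    rw [integral_congr_ae (h.edge_pow_ae_eq hN e hk), integral_indicator_one hm, h.prob_one N hN]

/-- The expectation of a monomial in the entries, which factorizes by independence. -/
theorem IsSparseModel.integral_prod_edgeEntry_pow (h : IsSparseModel P p X a d) {N : ℕ}
    (hN : p ≤ N) (μ : Sym2 (Fin N) →₀ ℕ) :
    Integrable (fun ω => ∏ e, edgeEntry a d N ω e ^ μ e) P ∧
      ∫ ω, ∏ e, edgeEntry a d N ω e ^ μ e ∂P = edgeWeight (p / N) X μ := by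
  have hinj : Function.Injective (Sym2.map (Fin.val : Fin N → ℕ)) :=
    Sym2.map.injective Fin.val_injective
  have ha : iIndepFun (fun e : Sym2 (Fin N) => fun ω => a (e.map Fin.val) ω ^ μ e) P :=
    (h.indep_weight.precomp hinj).comp (fun e x => x ^ μ e) fun e => measurable_id.pow_const _
  have hd : iIndepFun (fun e : Sym2 (Fin N) => fun ω => d N e ω ^ μ e) P :=
    (h.indep_edge N hN).comp (fun e x => x ^ μ e) fun e => measurable_id.pow_const _
  have hai := integrable_prod_of_iIndepFun ha fun e => h.integrable_weight _ _
  have hdi := integrable_prod_of_iIndepFun hd fun e => h.integrable_edge_pow hN _ _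
  have hind : IndepFun (fun ω => ∏ e : Sym2 (Fin N), a (e.map Fin.val) ω ^ μ e)
      (fun ω => ∏ e : Sym2 (Fin N), d N e ω ^ μ e) P :=
    (h.indep_weight_edge N hN).comp
      (φ := fun x : Sym2 ℕ → ℝ => ∏ e : Sym2 (Fin N), x (e.map Fin.val) ^ μ e)
      (ψ := fun x : Sym2 (Fin N) → ℝ => ∏ e : Sym2 (Fin N), x e ^ μ e)
      (by fun_prop) (by fun_prop)
  have hprod : (fun ω => ∏ e, edgeEntry a d N ω e ^ μ e) = fun ω =>
      (∏ e : Sym2 (Fin N), a (e.map Fin.val) ω ^ μ e) * ∏ e : Sym2 (Fin N), d N e ω ^ μ e := by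
    funext ω
    simp only [edgeEntry, mul_pow, Finset.prod_mul_distrib]
  rw [hprod]
  refine ⟨hind.integrable_mul hai hdi, ?_⟩
  rw [hind.integral_fun_mul_eq_mul_integral hai.aestronglyMeasurable hdi.aestronglyMeasurable,
    ha.integral_fun_prod_eq_prod_integral fun e => (h.integrable_weight _ _).aestronglyMeasurable,
    hd.integral_fun_prod_eq_prod_integral fun e => (h.integrable_edge_pow hN _ _).aestronglyMeasurable,
    ← Finset.prod_mul_distrib, edgeWeight]
  symm
  refine Finset.prod_subset_one_on_sdiff (Finset.subset_univ _) (fun e he => ?_) fun e he => ?_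
  · have h0 : μ e = 0 := by simpa using he
    rw [h.moment_weight, h.integral_edge_pow hN, h0, h.moment_zero, if_pos rfl, one_mul]
  · rw [h.moment_weight, h.integral_edge_pow hN, if_neg (Finsupp.mem_support_iff.1 he), mul_comm]

theorem IsSparseModel.integral_aeval (h : IsSparseModel P p X a d) {N : ℕ} (hN : p ≤ N)
    (Q : EdgePoly (Fin N)) :
    Integrable (fun ω => aeval (edgeEntry a d N ω) Q) P ∧
      ∫ ω, aeval (edgeEntry a d N ω) Q ∂P = edgeExp (p / N) X Q := by
  induction Q using MvPolynomial.induction_on' with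
  | monomial μ c =>
    have h1 : (fun ω => aeval (edgeEntry a d N ω) (monomial μ c)) =
        fun ω => c * ∏ e, edgeEntry a d N ω e ^ μ e := by
      funext ω
      rw [aeval_monomial, Finsupp.prod_fintype _ _ fun e => pow_zero _]
      rfl
    obtain ⟨h2, h3⟩ := h.integral_prod_edgeEntry_pow hN μ
    rw [h1, integral_const_mul, h3, edgeExp, monomialFunctional_monomial]
    exact ⟨h2.const_mul c, rfl⟩
  | add Q Q' hQ hQ' =>
    simp only [map_add]
    rw [integral_add hQ.1 hQ'.1, hQ.2, hQ'.2]
    exact ⟨hQ.1.add hQ'.1, rfl⟩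

theorem abs_card_partColour_sub_le {α : ℝ} (hα : α ∈ Set.Ioo (0 : ℝ) 1) (N : ℕ) (b : Bool) :
    |((Finset.univ.filter fun x : Fin N => partColour α N x = b).card : ℝ) -
      colourWeight α b * N| ≤ 1 := by
  have hfl : ⌊α * (N : ℝ)⌋₊ ≤ N := by
    refine Nat.floor_le_of_le ?_
    exact mul_le_of_le_one_left (Nat.cast_nonneg N) hα.2.le
  have h0 : 0 ≤ α * (N : ℝ) := mul_nonneg hα.1.le (Nat.cast_nonneg N)
  have h1 := Nat.floor_le h0
  have h2 := Nat.lt_floor_add_one (α * (N : ℝ))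
  have htrue : (Finset.univ.filter fun x : Fin N => partColour α N x = true).card =
      ⌊α * (N : ℝ)⌋₊ := by
    simp only [partColour, decide_eq_true_eq]
    rw [Fin.card_filter_val_lt, min_eq_right hfl]
  cases b
  · have h3 : (Finset.univ.filter fun x : Fin N => partColour α N x = true).card +
        (Finset.univ.filter fun x : Fin N => partColour α N x = false).card = N := by
      have := Finset.card_filter_add_card_filter_not (s := Finset.univ)
        (fun x : Fin N => partColour α N x = true)
      simpa using this
    rw [htrue] at h3
    have h4 : (⌊α * (N : ℝ)⌋₊ : ℝ) +
        (Finset.univ.filter fun x : Fin N => partColour α N x = false).card = N := by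
      exact_mod_cast h3
    simp only [colourWeight, Bool.false_eq_true, if_false]
    rw [abs_le]
    constructor <;> linarith
  · rw [htrue]
    simp only [colourWeight, if_true]
    rw [abs_le]
    constructor <;> linarith

/-- The mean square deviation of the spectral moments from their limits is of order `1 / N`. -/
theorem IsSparseModel.exists_integral_sq_trace_sub_le (h : IsSparseModel P p X a d) (hp : 0 < p)
    {α : ℝ} (hα : α ∈ Set.Ioo (0 : ℝ) 1) (s : ℕ) : ∃ K : ℝ, 0 ≤ K ∧ ∀ N : ℕ, p ≤ N →
      Integrable (fun ω => ((N : ℝ)⁻¹ * (bipartiteMatrix α N (fun e => a e ω)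
        (fun e => d N e ω) ^ s).trace - limitMoment p α X s) ^ 2) P ∧
      ∫ ω, ((N : ℝ)⁻¹ * (bipartiteMatrix α N (fun e => a e ω)
        (fun e => d N e ω) ^ s).trace - limitMoment p α X s) ^ 2 ∂P ≤ K / N := by
  obtain ⟨K, hK0, hK⟩ := exists_edgeExp_sq_trace_sub_le hp hα X s
  refine ⟨K, hK0, fun N hN => ?_⟩
  have hN1 : 1 ≤ N := by
    have : (0 : ℝ) < N := hp.trans_le hN
    exact_mod_cast this
  have h1 : (fun ω => ((N : ℝ)⁻¹ * (bipartiteMatrix α N (fun e => a e ω)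
      (fun e => d N e ω) ^ s).trace - limitMoment p α X s) ^ 2) = fun ω =>
      aeval (edgeEntry a d N ω) (((N : ℝ)⁻¹ • (genMatrix (partColour α N) ∅ ^ s).trace -
        C (limitMoment p α X s)) ^ 2) := by
    funext ω
    rw [trace_bipartiteMatrix_pow, map_pow, map_sub, map_smul, smul_eq_mul, aeval_C]
    rfl
  rw [h1]
  obtain ⟨h2, h3⟩ := h.integral_aeval hN (((N : ℝ)⁻¹ • (genMatrix (partColour α N) ∅ ^ s).trace -
        C (limitMoment p α X s)) ^ 2)
  exact ⟨h2, h3.trans_le (hK N hN1 _ fun b => abs_card_partColour_sub_le hα N b)⟩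

end Expectation

/-! ### Moments of the eigenvalue counting measure -/

section Spectrum

theorem trace_pow_eq_sum_eigenvalues_pow {n : Type*} [Fintype n] [DecidableEq n]
    {A : Matrix n n ℝ} (hA : A.IsHermitian) (s : ℕ) :
    (A ^ s).trace = ∑ j, hA.eigenvalues j ^ s := by
  have h : A ^ s = Unitary.conjStarAlgAut ℝ _ hA.eigenvectorUnitary
      (Matrix.diagonal (RCLike.ofReal ∘ hA.eigenvalues) ^ s) := by
    rw [map_pow, ← hA.spectral_theorem]
  rw [h, Unitary.conjStarAlgAut_apply, Matrix.trace_mul_comm, ← mul_assoc,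
    Unitary.coe_star_mul_self, one_mul, Matrix.diagonal_pow, Matrix.trace_diagonal]
  rfl

variable {N : ℕ} {A : Matrix (Fin N) (Fin N) ℝ} (hA : A.IsHermitian)

theorem isProbabilityMeasure_eigenvalueMeasure (hN : 1 ≤ N) :
    IsProbabilityMeasure (eigenvalueMeasure A hA) := by
  refine ⟨?_⟩
  rw [eigenvalueMeasure, Measure.smul_apply, Measure.finsetSum_apply]
  simp only [measure_univ, Finset.sum_const, Finset.card_univ, Fintype.card_fin, nsmul_eq_mul,
    mul_one, smul_eq_mul]
  exact ENNReal.inv_mul_cancel (by exact_mod_cast (by omega : N ≠ 0)) (ENNReal.natCast_ne_top N)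

theorem integrable_eigenvalueMeasure (hN : 1 ≤ N) (f : ℝ → ℝ) :
    Integrable f (eigenvalueMeasure A hA) := by
  refine Integrable.smul_measure ?_ (ENNReal.inv_ne_top.2 (by exact_mod_cast (by omega : N ≠ 0)))
  exact integrable_finsetSum_measure.2 fun j _ => integrable_dirac (by simp)

theorem integral_eigenvalueMeasure (f : ℝ → ℝ) :
    ∫ x, f x ∂(eigenvalueMeasure A hA) = (N : ℝ)⁻¹ * ∑ j, f (hA.eigenvalues j) := by
  rw [eigenvalueMeasure, integral_smul_measure, integral_finsetSum_measure]
  · simp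
  · exact fun j _ => integrable_dirac (by simp)

theorem integral_pow_eigenvalueMeasure (s : ℕ) :
    ∫ x, x ^ s ∂(eigenvalueMeasure A hA) = (N : ℝ)⁻¹ * (A ^ s).trace := by
  rw [integral_eigenvalueMeasure, trace_pow_eq_sum_eigenvalues_pow hA]

end Spectrum

/-! ### Measurability -/

section Measurability

/-- If the power sums of finitely many real functions are measurable, so are all their continuous
symmetric statistics of the form `∑ⱼ f (λⱼ)`, by polynomial approximation. -/
theorem measurable_sum_of_measurable_sum_pow {Ω ι : Type*} [MeasurableSpace Ω] [Fintype ι]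
    {l : Ω → ι → ℝ} (hl : ∀ s : ℕ, Measurable fun ω => ∑ j, l ω j ^ s) {f : ℝ → ℝ}
    (hf : Continuous f) : Measurable fun ω => ∑ j, f (l ω j) := by
  have hpoly : ∀ q : Polynomial ℝ, Measurable fun ω => ∑ j, q.eval (l ω j) := by
    intro q
    have h1 : (fun ω => ∑ j, q.eval (l ω j)) =
        fun ω => ∑ i ∈ Finset.range (q.natDegree + 1), q.coeff i * ∑ j, l ω j ^ i := by
      funext ω
      simp_rw [Polynomial.eval_eq_sum_range, Finset.mul_sum]
      exact Finset.sum_comm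
    rw [h1]
    exact Finset.measurable_sum _ fun i _ => (hl i).const_mul _
  have happrox : ∀ n : ℕ, ∃ q : Polynomial ℝ, ∀ x ∈ Set.Icc (-(n : ℝ)) n,
      |q.eval x - f x| < 1 / ((n : ℝ) + 1) := fun n =>
    exists_polynomial_near_of_continuousOn _ _ f hf.continuousOn _ Nat.one_div_pos_of_nat
  choose q hq using happrox
  refine measurable_of_tendsto_metrizable (fun n => hpoly (q n)) (tendsto_pi_nhds.2 fun ω => ?_)
  refine tendsto_finsetSum _ fun j _ => ?_
  rw [tendsto_iff_dist_tendsto_zero]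
  obtain ⟨n₀, hn₀⟩ := exists_nat_ge |l ω j|
  refine squeeze_zero' (Eventually.of_forall fun n => dist_nonneg) ?_
    tendsto_one_div_add_atTop_nhds_zero_nat
  filter_upwards [eventually_ge_atTop n₀] with n hn
  have h1 : |l ω j| ≤ n := hn₀.trans (by exact_mod_cast hn)
  exact (hq n _ (abs_le.1 h1)).le

variable {Ω : Type*} [MeasurableSpace Ω] {P : Measure Ω} {p : ℝ} {X : ℕ → ℝ}
  {a : Sym2 ℕ → Ω → ℝ} {d : (N : ℕ) → Sym2 (Fin N) → Ω → ℝ}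

theorem IsSparseModel.measurable_aeval (h : IsSparseModel P p X a d) {N : ℕ} (hN : p ≤ N)
    (Q : EdgePoly (Fin N)) : Measurable fun ω => MvPolynomial.aeval (edgeEntry a d N ω) Q := by
  induction Q using MvPolynomial.induction_on with
  | C c => simp
  | add Q Q' hQ hQ' => simp only [map_add]; exact hQ.add hQ'
  | mul_X Q e hQ =>
    simp only [map_mul, MvPolynomial.aeval_X]
    exact hQ.mul ((h.measurable_weight _).mul (h.measurable_edge N hN e))

theorem IsSparseModel.measurable_integral_spectralMeasure (h : IsSparseModel P p X a d) {N : ℕ}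
    (hN : p ≤ N) (α : ℝ) {f : ℝ → ℝ} (hf : Continuous f) :
    Measurable fun ω => ∫ x, f x ∂(spectralMeasure α a d N ω) := by
  simp_rw [spectralMeasure, integral_eigenvalueMeasure]
  refine (measurable_sum_of_measurable_sum_pow (fun s => ?_) hf).const_mul _
  simp_rw [← trace_pow_eq_sum_eigenvalues_pow, trace_bipartiteMatrix_pow]
  exact h.measurable_aeval hN _

end Measurability

/-! ### Almost sure convergence along subsequences, and the limit -/

section Limit

variable {Ω : Type*} [MeasurableSpace Ω] {P : Measure Ω}

/-- Random variables with summable second moments tend to zero almost surely. -/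
theorem ae_tendsto_zero_of_integral_sq_le {Z : ℕ → Ω → ℝ} {K : ℝ}
    (hint : ∀ k, Integrable (fun ω => Z k ω ^ 2) P)
    (hK : ∀ k, ∫ ω, Z k ω ^ 2 ∂P ≤ K * (1 / 2) ^ k) :
    ∀ᵐ ω ∂P, Tendsto (fun k => Z k ω) atTop (𝓝 0) := by
  have hsum : ∑' k, ∫⁻ ω, ENNReal.ofReal (Z k ω ^ 2) ∂P ≠ ⊤ := by
    have h1 : ∀ k, ∫⁻ ω, ENNReal.ofReal (Z k ω ^ 2) ∂P = ENNReal.ofReal (∫ ω, Z k ω ^ 2 ∂P) :=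
      fun k => (ofReal_integral_eq_lintegral_ofReal (hint k)
        (Eventually.of_forall fun ω => sq_nonneg _)).symm
    simp_rw [h1]
    refine ne_top_of_le_ne_top ?_ (ENNReal.tsum_le_tsum fun k => ENNReal.ofReal_le_ofReal (hK k))
    have h2 : Summable fun k : ℕ => K * (1 / 2 : ℝ) ^ k := summable_geometric_two.mul_left K
    exact h2.tsum_ofReal_ne_top
  rw [← lintegral_tsum fun k => (hint k).aemeasurable.ennreal_ofReal] at hsum
  have hmeas : AEMeasurable (fun ω => ∑' k, ENNReal.ofReal (Z k ω ^ 2)) P :=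
    AEMeasurable.tsum fun k => (hint k).aemeasurable.ennreal_ofReal
  filter_upwards [ae_lt_top' hmeas hsum] with ω hω
  have h3 := ENNReal.tendsto_atTop_zero_of_tsum_ne_top hω.ne
  have h4 : Tendsto (fun k => Z k ω ^ 2) atTop (𝓝 0) := by
    have := (ENNReal.tendsto_toReal ENNReal.zero_ne_top).comp h3
    simpa [Function.comp_def, ENNReal.toReal_ofReal, sq_nonneg] using this
  rw [tendsto_zero_iff_abs_tendsto_zero]
  have h5 := h4.sqrt
  simpa [Real.sqrt_sq_eq_abs, Function.comp_def] using h5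

variable [IsProbabilityMeasure P] {p α : ℝ} {X : ℕ → ℝ}
  {a : Sym2 ℕ → Ω → ℝ} {d : (N : ℕ) → Sym2 (Fin N) → Ω → ℝ}

/-- Along a sequence which grows exponentially, all the moments converge almost surely. -/
theorem IsSparseModel.ae_tendsto_moments (h : IsSparseModel P p X a d) (hp : 0 < p)
    (hα : α ∈ Set.Ioo (0 : ℝ) 1) {ns : ℕ → ℕ} (hns : ∀ k, 2 ^ k ≤ ns k) (hge : ∀ k, p ≤ ns k) :
    ∀ᵐ ω ∂P, ∀ s, Tendsto (fun k => ∫ x, x ^ s ∂(spectralMeasure α a d (ns k) ω)) atTop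
      (𝓝 (limitMoment p α X s)) := by
  refine ae_all_iff.2 fun s => ?_
  obtain ⟨K, hK0, hK⟩ := h.exists_integral_sq_trace_sub_le hp hα s
  have h1 := ae_tendsto_zero_of_integral_sq_le (K := K) (fun k => (hK (ns k) (hge k)).1) fun k => by
    refine (hK (ns k) (hge k)).2.trans ?_
    rw [div_eq_mul_inv, one_div, inv_pow]
    refine mul_le_mul_of_nonneg_left (inv_anti₀ (by positivity) ?_) hK0
    exact_mod_cast hns k
  filter_upwards [h1] with ω hω
  have h2 := hω.add_const (limitMoment p α X s)
  simpa [spectralMeasure, integral_pow_eigenvalueMeasure] using h2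

theorem hasLimitMoments_iff {σ : Measure ℝ} : HasLimitMoments p α X σ ↔
    (∀ s : ℕ, Integrable (fun x : ℝ => x ^ s) σ) ∧ ∀ s, ∫ x, x ^ s ∂σ = limitMoment p α X s := by
  refine and_congr_right fun _ => ⟨fun h s => ?_, fun h => ⟨fun k => ?_, fun k => ?_⟩⟩
  · obtain ⟨k, rfl | rfl⟩ := Nat.even_or_odd' s
    · rw [h.1, limitMoment_two_mul]
    · rw [h.2, limitMoment_two_mul_add_one]
  · rw [h, limitMoment_two_mul]
  · rw [h, limitMoment_two_mul_add_one]

/-- The limiting moments determine a measure. -/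
theorem HasLimitMoments.unique (hp : 0 < p) (hα : α ∈ Set.Ioo (0 : ℝ) 1)
    (hX0 : ∀ f, 0 ≤ X (2 * f)) {C : ℝ} (hX : ∀ m : ℕ, 1 ≤ m → X (2 * m) ≤ (C * m) ^ (2 * m))
    {μ ν : Measure ℝ} (hμ : HasLimitMoments p α X μ) (hν : HasLimitMoments p α X ν) : μ = ν := by
  obtain ⟨K, hK0, hK⟩ := exists_limitMoment_le hp hα hX0 hX
  rw [hasLimitMoments_iff] at hμ hν
  -- the moment of order `0` is finite
  have hfin : ∀ {ρ : Measure ℝ}, (∀ s : ℕ, Integrable (fun x : ℝ => x ^ s) ρ) →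
      IsFiniteMeasure ρ := fun hρ => by
    have h0 := hρ 0
    simp only [pow_zero] at h0
    exact (integrable_const_iff_isFiniteMeasure one_ne_zero).1 h0
  have := hfin hμ.1
  have := hfin hν.1
  exact Measure.ext_of_moments hK0 hμ.1 hν.1 (fun s => (hμ.2 s).trans (hν.2 s).symm)
    fun k => (hμ.2 _).trans_le (hK k)

end Limit

theorem theorem1 {Ω : Type*} [MeasurableSpace Ω] (P : Measure Ω) [IsProbabilityMeasure P]
    (p α : ℝ) (hp : 0 < p) (hα : α ∈ Set.Ioo (0 : ℝ) 1) (X : ℕ → ℝ)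
    (a : Sym2 ℕ → Ω → ℝ) (d : (N : ℕ) → Sym2 (Fin N) → Ω → ℝ)
    (hmodel : IsSparseModel P p X a d)
    (C : ℝ) (hX : ∀ m : ℕ, 1 ≤ m → X (2 * m) ≤ (C * m) ^ (2 * m)) :
    ∃ σ : Measure ℝ, IsProbabilityMeasure σ ∧
      TendstoWeaklyInProbability P (spectralMeasure α a d) σ ∧
      HasLimitMoments p α X σ ∧
      ∀ ν : Measure ℝ, HasLimitMoments p α X ν → ν = σ := by
  have hX0 := hmodel.moment_two_mul_nonneg
  -- the model is only defined for `N ≥ p`, hence the shift by `N₀`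
  set N₀ := ⌈p⌉₊ with hN₀
  have hge : ∀ n : ℕ, p ≤ (n + N₀ : ℕ) := fun n =>
    (Nat.le_ceil p).trans (by exact_mod_cast Nat.le_add_left N₀ n)
  have hone : ∀ n : ℕ, 1 ≤ n + N₀ := fun n => by
    have : 0 < N₀ := Nat.ceil_pos.2 hp
    omega
  let ρ : Ω → ℕ → ProbabilityMeasure ℝ := fun ω n =>
    ⟨spectralMeasure α a d (n + N₀) ω, isProbabilityMeasure_eigenvalueMeasure _ (hone n)⟩
  have hρint : ∀ ω n (s : ℕ), Integrable (fun x : ℝ => x ^ s) (ρ ω n : Measure ℝ) :=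
    fun ω n s => integrable_eigenvalueMeasure _ (hone n) _
  have hae : ∀ ns : ℕ → ℕ, StrictMono ns → ∀ᵐ ω ∂P, ∀ s, Tendsto
      (fun k => ∫ x, x ^ s ∂(ρ ω (ns (2 ^ k)) : Measure ℝ)) atTop (𝓝 (limitMoment p α X s)) :=
    fun ns hns => hmodel.ae_tendsto_moments (ns := fun k => ns (2 ^ k) + N₀) hp hα
      (fun k => hns.le_apply.trans (Nat.le_add_right _ _)) fun k => hge _
  -- any outcome for which the moments converge yields the limit measure
  obtain ⟨ω₀, hω₀⟩ := (hae id strictMono_id).exists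
  obtain ⟨σ, -, -, -, hσint, hσm⟩ :=
    exists_subseq_tendsto_of_moments (fun n s => hρint ω₀ _ s) hω₀
  have hσ : HasLimitMoments p α X (σ : Measure ℝ) := hasLimitMoments_iff.2 ⟨hσint, hσm⟩
  refine ⟨σ, inferInstance, fun f => ?_, hσ, fun ν hν => hν.unique hp hα hX0 hX hσ⟩
  have hshift : TendstoInMeasure P (fun n ω => ∫ x, f x ∂(ρ ω n : Measure ℝ)) atTop
      fun _ => ∫ x, f x ∂(σ : Measure ℝ) := by
    refine (exists_seq_tendstoInMeasure_atTop_iff fun n =>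
      (hmodel.measurable_integral_spectralMeasure (hge n) α
        f.continuous).aestronglyMeasurable).2 fun ns hns => ?_
    -- along `ns (2 ^ k)` the mean square deviations of the moments are summable
    refine ⟨fun k => 2 ^ k, pow_right_strictMono₀ one_lt_two, ?_⟩
    filter_upwards [hae ns hns] with ω hω
    refine ProbabilityMeasure.tendsto_iff_forall_integral_tendsto.1 (tendsto_of_moments
      (fun n s => hρint ω _ s) hω fun ν hνint hνm => Subtype.ext ?_) f
    exact (hasLimitMoments_iff.2 ⟨hνint, hνm⟩ : HasLimitMoments p α X (ν : Measure ℝ)).unique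
      hp hα hX0 hX hσ
  intro ε hε
  exact (tendsto_add_atTop_iff_nat N₀).1 (hshift ε hε)
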